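/- **Setting.** For an operator $A$ on $n\ge 1$ qubits let $\|A\|_2=(2^{-n}\operatorname{Tr}A^\dagger A)^{1/2}$ be its Pauli 2-norm (normalized Schatten 2-norm), $\|A\|$ its operator norm, and $\operatorname{supp}(A)$ the union of the supports of the Pauli strings that occur in $A$ with non-zero coefficient. Let $H=\sum_l\alpha_lG_l=\sum_{\gamma=1}^{\Gamma}H_\gamma$ be an $n$-qubit Hamiltonian, with Pauli strings $G_l$ of weight at most $k_h$ and real $|\alpha_l|\le a$, arranged in $\Gamma$ layers $H_\gamma$ such that the strings of one layer have pairwise disjoint supports. Let $O=\sum_P\beta_PP$ be an observable with real coefficients and Pauli strings of weight at most $k_o$. Let $p=1$ or let $p\ge 2$ be even, and let $\tilde U$ be the $p$-th order Trotter–Suzuki formula for $e^{-iHt/r}$ with respect to $H=\sum_\gamma H_\gamma$: $\prod_{\gamma=1}^{\Gamma}e^{-iH_\gamma s}$ with $s=t/r$ for $p=1$, $\tilde U_2(s)=\prod_{\gamma=1}^{\Gamma}e^{-iH_\gamma s/2}\prod_{\gamma=\Gamma}^{1}e^{-iH_\gamma s/2}$, and $\tilde U_p(s)=\tilde U_{p-2}(us)^2\,\tilde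 U_{p-2}((1-4u)s)\,\tilde U_{p-2}(us)^2$ with $u=1/(4-4^{1/(p-1)})$. Put $$\Lambda_2=\sum_{\gamma_1,\dots,\gamma_{p+1}=1}^{\Gamma}\big\|[H_{\gamma_{p+1}},[H_{\gamma_p},\dots,[H_{\gamma_2},H_{\gamma_1}]]]\big\|_2 .$$ **Algorithm (LPD).** Keep the observable as a table of Pauli strings with real coefficients, initially $O$. In each of $r$ Trotter steps, conjugate the table, $\tilde O\mapsto\tilde U^\dagger\tilde O\tilde U$, layer by layer: every term $P$ is passed through those Pauli rotations of the layer that act on its support, by $e^{i\theta G}Pe^{-i\theta G}=P$ if $[G,P]=0$ and $=\cos(2\theta)P+i\sin(2\theta)GP$ if $\{G,P\}=0$; equal strings are merged. At the end of the step discard all Pauli strings of weight $>w^*$. Let $\tilde O^{(r)}_{\le w^*}$ be the final operator; the output is $\operatorname{Tr}(\rho\,\tilde O^{(r)}_{\le w^*})$, computed by summation over the remaining Pauli strings. Time is the number of elementary operations, where one operation on a Pauli string or a coefficient (computing one transition of a string under a rotation, writing a term into the table, testing a weight, looking up the rotation of a layer that acts on a given qubit, querying a Pauli coefficient of $O$ or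 of $\rho$) costs one unit. Memory is the largest number of Pauli terms held at any time. **Entanglement condition.** Let $S(\rho_A)=-\operatorname{Tr}\rho_A\log_2\rho_A$ for the reduced state $\rho_A$ of a pure state $|\psi\rangle$ on a set $A$ of qubits. Call $|\psi\rangle$ *sufficiently entangled* for an operator $D$ up to $\eta\ge 0$ if there are operators $B_1,\dots,B_J$ with $\|D-\sum_jB_j\|\le\eta$ and, for all $j,j'$ and $A=\operatorname{supp}(B_j^\dagger B_{j'})$, $$S(\rho_A)\ \ge\ |A|-\frac12\,\frac{\|\sum_jB_j\|_2^4}{(\sum_j\|B_j\|)^4}.$$ **Theorem.** For all $p,\Gamma,k_h,k_o$ and $a$ there are constants $t_0\in(0,1)$ and $C>0$, depending on nothing else (in particular not on $n$), such that the following holds for all $n\ge 1$, all $H$ and $O$ as above, all $0<t<t_0$ and $\epsilon>0$, all pure states $\rho=|\psi\rangle\langle\psi|$, and all integers $r\ge 1$ and $w^*\ge 0$ with $$r\ \ge\ C\,(\Lambda_2\|O\|_2\,\epsilon^{-1})^{1/p}\,t^{1+1/p},\qquad w^*\ \ge\ k_o+C\max\Big(1,\ \frac{\log(t\|O\|_2/\epsilon)}{\log(1/t)}\Big).$$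 LPD with $r$ Trotter steps and truncation weight $w^*$ runs in time at most $C^{w^*+1}(r+1)\,n^{w^*}$ and memory at most $C^{w^*+1}n^{w^*}$. If moreover $|\psi\rangle$ is sufficiently entangled, up to $\epsilon/4$, for the Trotter error operator $(\tilde U^{\dagger})^{r}O\tilde U^{r}-e^{iHt}Oe^{-iHt}$ and for the truncation error operator $(\tilde U^{\dagger})^{r}O\tilde U^{r}-\tilde O^{(r)}_{\le w^*}$, then $$\big|\operatorname{Tr}(\rho\,\tilde O^{(r)}_{\le w^*})-\operatorname{Tr}(\rho\,e^{iHt}Oe^{-iHt})\big|\ \le\ 2\epsilon .$$ -/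

import Mathlib

open scoped Matrix

noncomputable section

namespace LowWeightPauli

/-! ### Qubits, Pauli strings and operators -/

/-- Basis labels of `n` qubits, restricted to the qubits in an index type `ι`. -/
abbrev Bits (ι : Type) := ι → Fin 2

/-- Operators on `n` qubits, as matrices in the computational basis. -/
abbrev Op (n : ℕ) := Matrix (Bits (Fin n)) (Bits (Fin n)) ℂ

/-- The four single-qubit Pauli letters. -/
inductive Letter
  | I | X | Y | Z
  deriving DecidableEq

namespace Letter

instance : Fintype Letter := ⟨{I, X, Y, Z}, fun a => by cases a <;> decide⟩

/-- The Pauli matrices. -/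
def mat : Letter → Matrix (Fin 2) (Fin 2) ℂ
  | I => !![1, 0; 0, 1]
  | X => !![0, 1; 1, 0]
  | Y => !![0, -Complex.I; Complex.I, 0]
  | Z => !![1, 0; 0, -1]

/-- Product of two Pauli letters up to phase. -/
def mul : Letter → Letter → Letter
  | I, b => b
  | a, I => a
  | X, X => I
  | Y, Y => I
  | Z, Z => I
  | X, Y => Z
  | Y, X => Z
  | Y, Z => X
  | Z, Y => X
  | Z, X => Y
  | X, Z => Y

/-- The exponent `e` of the phase in `a.mat * b.mat = i ^ e • (a.mul b).mat`. -/
def phase : Letter → Letter → ℕ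
  | X, Y => 1
  | Y, Z => 1
  | Z, X => 1
  | Y, X => 3
  | Z, Y => 3
  | X, Z => 3
  | _, _ => 0

end Letter

/-- Unsigned Pauli strings on `n` qubits. -/
abbrev PauliString (n : ℕ) := Fin n → Letter

namespace PauliString

variable {n : ℕ}

/-- The tensor product of the letters of the string. -/
def mat (P : PauliString n) : Op n :=
  Matrix.of fun a b => ∏ q, (P q).mat (a q) (b q)

/-- The qubits on which the string is not the identity. -/
def supp (P : PauliString n) : Finset (Fin n) :=
  Finset.univ.filter fun q => P q ≠ Letter.I

/-- The Pauli weight. -/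
def weight (P : PauliString n) : ℕ := P.supp.card

/-- Product of two strings up to phase. -/
def mul (G P : PauliString n) : PauliString n := fun q => (G q).mul (P q)

/-- The exponent `e` of the phase in `G.mat * P.mat = i ^ e • (G.mul P).mat`. -/
def phase (G P : PauliString n) : ℕ := ∑ q, (G q).phase (P q)

/-- Two strings anticommute iff they have an odd number of sites with distinct non-identity
letters. -/
def Anticommute (G P : PauliString n) : Prop :=
  Odd (Finset.univ.filter fun q =>
    G q ≠ Letter.I ∧ P q ≠ Letter.I ∧ G q ≠ P q).card

instance (G P : PauliString n) : Decidable (Anticommute G P) := by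
  unfold Anticommute; infer_instance

end PauliString

/-- The Pauli 2-norm (normalized Schatten 2-norm) `(2⁻ⁿ Tr(A† A))^{1/2}`. -/
def pauliNorm {n : ℕ} (A : Op n) : ℝ := Real.sqrt ((Aᴴ * A).trace.re / 2 ^ n)

/-- The operator norm (largest singular value). -/
def opNorm {n : ℕ} (A : Op n) : ℝ := ‖Matrix.toEuclideanCLM (𝕜 := ℂ) A‖

/-- The coefficient of `P` in the Pauli expansion of `A`. -/
def pauliCoeff {n : ℕ} (A : Op n) (P : PauliString n) : ℂ := (P.mat * A).trace / 2 ^ n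

open Classical in
/-- The support of an operator: the union of the supports of its non-zero Pauli terms. -/
def opSupp {n : ℕ} (A : Op n) : Finset (Fin n) :=
  Finset.univ.filter fun q => ∃ P : PauliString n, pauliCoeff A P ≠ 0 ∧ q ∈ P.supp

/-! ### Pure states, reduced states, entropy, and sufficient entanglement -/

/-- The density matrix of a state vector. -/
def density {n : ℕ} (ψ : Bits (Fin n) → ℂ) : Op n := Matrix.vecMulVec ψ (star ψ)

/-- A basis label of all qubits from one on `A` and one on the complement of `A`. -/
def glue {n : ℕ} (A : Finset (Fin n)) (a : Bits {q // q ∈ A}) (c : Bits {q // q ∉ A}) :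
    Bits (Fin n) :=
  fun q => if h : q ∈ A then a ⟨q, h⟩ else c ⟨q, h⟩

/-- The reduced density matrix on the qubits in `A` (partial trace over the other qubits). -/
def reduced {n : ℕ} (ψ : Bits (Fin n) → ℂ) (A : Finset (Fin n)) :
    Matrix (Bits {q // q ∈ A}) (Bits {q // q ∈ A}) ℂ :=
  Matrix.of fun a b => ∑ c : Bits {q // q ∉ A}, density ψ (glue A a c) (glue A b c)

theorem reduced_isHermitian {n : ℕ} (ψ : Bits (Fin n) → ℂ) (A : Finset (Fin n)) :
    (reduced ψ A).IsHermitian := by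
  ext a b
  simp [reduced, density, Matrix.vecMulVec_apply, mul_comm]

/-- The entanglement entropy `-Tr(ρ_A log₂ ρ_A)`, in bits. -/
def entropy {n : ℕ} (ψ : Bits (Fin n) → ℂ) (A : Finset (Fin n)) : ℝ :=
  (∑ i, Real.negMulLog ((reduced_isHermitian ψ A).eigenvalues i)) / Real.log 2

/-- `ψ` is sufficiently entangled for the operator `∑ j, B j`, decomposed into the terms `B j`:
`S(ρ_{j,j'}) ≥ |supp(B_j† B_j')| - ½ ‖∑ B_j‖₂⁴ / (∑ ‖B_j‖)⁴` on every `supp(B_j† B_j')`. -/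
def EntangledForTerms {n J : ℕ} (ψ : Bits (Fin n) → ℂ) (B : Fin J → Op n) : Prop :=
  ∀ j j' : Fin J,
    ((opSupp ((B j)ᴴ * B j')).card : ℝ)
        - 1 / 2 * pauliNorm (∑ i, B i) ^ 4 / (∑ i, opNorm (B i)) ^ 4
      ≤ entropy ψ (opSupp ((B j)ᴴ * B j'))

/-- `ψ` is sufficiently entangled for the operator `D` up to an operator of norm at most `η`.
For `η = 0` this is the entropy condition for some decomposition `D = ∑ j, B j`; a positive `η`
only weakens it, so that `D` may have a small non-local tail. -/
def SufficientlyEntangled {n : ℕ} (ψ : Bits (Fin n) → ℂ) (D : Op n) (η : ℝ) : Prop :=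
  ∃ (J : ℕ) (B : Fin J → Op n), opNorm (D - ∑ j, B j) ≤ η ∧ EntangledForTerms ψ B

/-! ### Hamiltonians in layers and Trotter formulas -/

/-- A Hamiltonian `∑ l, α_l G_l` whose Pauli terms are arranged in `Γ` layers; the terms of one
layer act on disjoint sets of qubits, so that their rotations can be carried out simultaneously. -/
structure LayeredHamiltonian (n Γ : ℕ) where
  numTerms : ℕ
  pauli : Fin numTerms → PauliString n
  coeff : Fin numTerms → ℝ
  layer : Fin numTerms → Fin Γ
  disjoint : ∀ i j, i ≠ j → layer i = layer j →
    Disjoint (PauliString.supp (pauli i)) (PauliString.supp (pauli j))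

namespace LayeredHamiltonian

variable {n Γ : ℕ} (H : LayeredHamiltonian n Γ)

/-- `H_γ`, the sum of the terms in layer `γ`. -/
def layerOp (γ : Fin Γ) : Op n :=
  ∑ l ∈ Finset.univ.filter (fun l => H.layer l = γ), (H.coeff l : ℂ) • (H.pauli l).mat

/-- The Hamiltonian `H = ∑ γ, H_γ`. -/
def op : Op n := ∑ γ, H.layerOp γ

/-- Every term has weight at most `k` and coefficient at most `a` in absolute value. -/
def IsLocal (k : ℕ) (a : ℝ) : Prop := ∀ l, (H.pauli l).weight ≤ k ∧ |H.coeff l| ≤ a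

end LayeredHamiltonian

/-- `exp(-i s A)`. -/
def evolution {n : ℕ} (A : Op n) (s : ℝ) : Op n :=
  NormedSpace.exp ((-Complex.I * (s : ℂ)) • A)

/-- The Suzuki formula of order `2 (k + 1)` with time step `s`, as the list, from left to right,
of its factors `exp(-i s' H_γ)`, each recorded as `(γ, s')`. -/
def suzuki (Γ : ℕ) : ℕ → ℝ → List (Fin Γ × ℝ)
  | 0, s => (List.finRange Γ).map (fun γ => (γ, s / 2))
      ++ (List.finRange Γ).reverse.map (fun γ => (γ, s / 2))
  | k + 1, s =>
      let u : ℝ := 1 / (4 - (4 : ℝ) ^ (1 / (2 * (k : ℝ) + 3)))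
      suzuki Γ k (u * s) ++ suzuki Γ k (u * s) ++ suzuki Γ k ((1 - 4 * u) * s)
        ++ suzuki Γ k (u * s) ++ suzuki Γ k (u * s)

/-- The factors of the product formula of order `p`, for `p = 1` or `p` even and positive. -/
def trotterFactors (Γ p : ℕ) (s : ℝ) : List (Fin Γ × ℝ) :=
  if p = 1 then (List.finRange Γ).map (fun γ => (γ, s)) else suzuki Γ (p / 2 - 1) s

/-- The product formula of order `p` with time step `s`. -/
def trotter {n Γ : ℕ} (H : LayeredHamiltonian n Γ) (p : ℕ) (s : ℝ) : Op n :=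
  ((trotterFactors Γ p s).map fun x => evolution (H.layerOp x.1) x.2).prod

/-- `[A_k, [A_{k-1}, …, [A_1, A_0]]]`. -/
def nestedComm {n : ℕ} : (k : ℕ) → (Fin (k + 1) → Op n) → Op n
  | 0, A => A 0
  | k + 1, A =>
      A (Fin.last (k + 1)) * nestedComm k (fun i => A i.castSucc)
        - nestedComm k (fun i => A i.castSucc) * A (Fin.last (k + 1))

/-- `Λ₂`: the sum over all `γ_1, …, γ_{p+1}` of the Pauli 2-norm of
`[H_{γ_{p+1}}, […, [H_{γ_2}, H_{γ_1}]]]`. -/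
def commNorm {n Γ : ℕ} (H : LayeredHamiltonian n Γ) (p : ℕ) : ℝ :=
  ∑ γ : Fin (p + 1) → Fin Γ, pauliNorm (nestedComm p fun i => H.layerOp (γ i))

/-! ### Cost model

A program returns a value together with the number of elementary operations it has performed and
the largest number of Pauli terms it has held in memory. An elementary operation is one operation
on a Pauli string or on a coefficient: testing whether a rotation branches a term and computing the
transition, adding a term to a table, testing a weight, looking up the rotation of a layer that
acts on a given qubit, or querying a Pauli coefficient of the observable or of the input state. -/

structure Costed (α : Type) where
  val : α
  time : ℕ
  space : ℕ

namespace Costed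

instance : Monad Costed where
  pure a := ⟨a, 0, 0⟩
  bind x f := ⟨(f x.val).val, x.time + (f x.val).time, max x.space (f x.val).space⟩

/-- Perform `k` elementary operations. -/
def tick (k : ℕ) : Costed Unit := ⟨(), k, 0⟩

/-- Hold `k` Pauli terms in memory. -/
def hold (k : ℕ) : Costed Unit := ⟨(), 0, k⟩

/-- Run a program on every entry of a list. -/
def forEach {α β : Type} (f : α → Costed β) : List α → Costed (List β)
  | [] => pure []
  | x :: xs => do
      let y ← f x
      let ys ← forEach f xs
      pure (y :: ys)

end Costed

open Costed

/-! ### The algorithm -/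

/-- An observable `∑ P, c_P P`, stored as the table of its non-zero Pauli coefficients. -/
abbrev PauliTable (n : ℕ) := PauliString n →₀ ℝ

/-- The operator that a table stands for. -/
def PauliTable.op {n : ℕ} (D : PauliTable n) : Op n := D.sum fun P c => (c : ℂ) • P.mat

/-- `exp(i θ G) (c P) exp(-i θ G)` as a list of terms: `c P` if `G` and `P` commute, and
`c cos(2θ) P + c sin(2θ) i G P` if they anticommute. -/
def rotate {n : ℕ} (G : PauliString n) (θ : ℝ) (x : PauliString n × ℝ) :
    List (PauliString n × ℝ) :=
  if G.Anticommute x.1 then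
    [(x.1, x.2 * Real.cos (2 * θ)),
     (G.mul x.1, x.2 * (Real.sin (2 * θ) * (Complex.I ^ (G.phase x.1 + 1)).re))]
  else [x]

/-- Conjugate one term by a list of rotations, one after another. -/
def spread {n : ℕ} : List (PauliString n × ℝ) → PauliString n × ℝ →
    Costed (List (PauliString n × ℝ))
  | [], x => pure [x]
  | g :: gs, x => do
      tick 1
      let ys ← forEach (spread gs) (rotate g.1 g.2 x)
      pure ys.flatten

/-- The rotations in `exp(-i s H_γ)` that act on the support of `P`. The others leave `P`
unchanged. There is at most one for each qubit in the support of `P`. -/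
def touching {n Γ : ℕ} (H : LayeredHamiltonian n Γ) (γ : Fin Γ) (s : ℝ) (P : PauliString n) :
    List (PauliString n × ℝ) :=
  ((List.finRange H.numTerms).filter fun l =>
      H.layer l = γ ∧ ¬ Disjoint (H.pauli l).supp P.supp).map
    fun l => (H.pauli l, H.coeff l * s)

/-- Conjugate an observable by the layer `exp(-i s H_γ)`, term by term, and collect the result in
a new table. -/
def applyLayer {n Γ : ℕ} (H : LayeredHamiltonian n Γ) (x : Fin Γ × ℝ) (D : PauliTable n) :
    Costed (PauliTable n) := do
  let blocks ← forEach
    (fun P => do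
      tick (1 + P.weight)
      spread (touching H x.1 x.2 P) (P, D P))
    D.support.toList
  tick blocks.flatten.length
  hold (D.support.card + blocks.flatten.length)
  pure (blocks.flatten.map fun y => Finsupp.single y.1 y.2).sum

/-- Conjugate an observable by a product of layers. -/
def applyLayers {n Γ : ℕ} (H : LayeredHamiltonian n Γ) :
    List (Fin Γ × ℝ) → PauliTable n → Costed (PauliTable n)
  | [], D => pure D
  | x :: xs, D => do
      let D' ← applyLayer H x D
      applyLayers H xs D'

/-- Discard all terms of weight larger than `w`. -/
def truncate {n : ℕ} (w : ℕ) (D : PauliTable n) : Costed (PauliTable n) := do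
  tick D.support.card
  hold D.support.card
  pure (D.filter fun P => P.weight ≤ w)

/-- `d` Trotter steps of order `p` and duration `s`, each followed by truncation at weight `w`. -/
def lpdEvolve {n Γ : ℕ} (H : LayeredHamiltonian n Γ) (p : ℕ) (s : ℝ) (w : ℕ) :
    ℕ → PauliTable n → Costed (PauliTable n)
  | 0, D => pure D
  | d + 1, D => do
      let D₁ ← lpdEvolve H p s w d D
      let D₂ ← applyLayers H (trotterFactors Γ p s) D₁
      truncate w D₂

/-- Low-weight Pauli dynamics: read the observable, evolve it in `r` truncated Trotter steps, and
sum `c_P Tr(ρ P)` over the remaining terms. -/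
def lpd {n Γ : ℕ} (H : LayeredHamiltonian n Γ) (O : PauliTable n) (ψ : Bits (Fin n) → ℂ)
    (p : ℕ) (t : ℝ) (r w : ℕ) : Costed ℝ := do
  tick O.support.card
  hold O.support.card
  let D ← lpdEvolve H p (t / r) w r O
  tick D.support.card
  hold D.support.card
  pure (D.sum fun P c => c * ((density ψ * P.mat).trace).re)

/-! ### Exact and approximate Heisenberg evolutions of the observable -/

/-- `e^{iHt} O e^{-iHt}`. -/
def exactOp {n Γ : ℕ} (H : LayeredHamiltonian n Γ) (O : PauliTable n) (t : ℝ) : Op n :=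
  evolution H.op (-t) * O.op * evolution H.op t

/-- `(Ũ†)^r O Ũ^r` for the product formula `Ũ` of order `p` with time step `t / r`. -/
def trotterOp {n Γ : ℕ} (H : LayeredHamiltonian n Γ) (O : PauliTable n) (p : ℕ) (t : ℝ) (r : ℕ) :
    Op n :=
  (trotter H p (t / r))ᴴ ^ r * O.op * trotter H p (t / r) ^ r

/-- The truncated observable after `r` Trotter steps. -/
def truncatedOp {n Γ : ℕ} (H : LayeredHamiltonian n Γ) (O : PauliTable n) (p : ℕ) (t : ℝ)
    (r w : ℕ) : Op n :=
  PauliTable.op (lpdEvolve H p (t / r) w r O).val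

end LowWeightPauli

end

noncomputable section
namespace LowWeightPauli

/-! ### Pauli algebra -/

namespace Letter

/-! The cost bound is a count; the error bound rests on one tool, the Pauli 2-norm `wnorm μ` in
which a string `P` carries the weight `exp (μ |P|)`. The terms of a layer are disjoint, so at most
`Γ |P|` terms of `H` anticommute with `P` (`card_anti_le`). A commutator with `H` therefore grows
only linearly in the weight, and the growth is compensated by lowering `μ` at a constant rate `κ`:
Heisenberg evolution is a contraction from `wnorm μ` to `wnorm (μ - κ T)` (`wnorm_heis_combo_le`).
All rates depend on `Γ`, `kh`, `a` and `μ`, never on `n`. Products are controlled by `pauliNorm (A *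
B) ≤ wnorm 1 A * wnorm 1 B` (`pauliNorm_mul_le`), which replaces operator-norm bounds.

Truncation (`truncation_error_le`). What a step discards is the high-weight part of the change made
by that step, which is of the order of the step length. The step lengths add up to a multiple of
`t`, so the total does not depend on `r`. For small `t` the parameter `μ` can be taken of order `log
(1 / t)`, and every unit of truncation weight gains a power of `t`.

Trotter error (`trotter_error_le`). The product formula is generated by a time-dependent Hermitian
`layersGen`. Taylor expansion through the layers writes it as a polynomial of degree less than `p`
plus a remainder bounded by `C z ^ p Λ₂`, with `C` uniform in `n`. The classical order condition,
even with constants that are out of control in `n`, forces the polynomial to be `H`. Duhamel's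
formula then turns the error of the generator into an error of the evolved observable.

Expectation values (`norm_trace_density_sum_le`). A reduced state of nearly maximal entropy is close
to maximally mixed. Applied to the terms `B_j† B_j'` of `D† D`, this bounds the second moment of the
error `D` by a multiple of `‖D‖₂²`, and Cauchy–Schwarz gives the first moment.

Cost (`lpd_cost`). At most `(4 n) ^ w` strings survive a truncation, and the fixed number of layers
in one step multiplies them by at most a constant to the power `w`. -/

theorem mat_mul_mat (a b : Letter) :
    a.mat * b.mat = Complex.I ^ a.phase b • (a.mul b).mat := by
  cases a <;> cases b <;>
    simp [mat, mul, phase, Matrix.smul_of, pow_succ]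

theorem mul_mul_cancel (a b : Letter) : a.mul (a.mul b) = b := by
  cases a <;> cases b <;> rfl

theorem mul_comm' (a b : Letter) : a.mul b = b.mul a := by
  cases a <;> cases b <;> rfl

theorem mat_conjTranspose (a : Letter) : (a.mat)ᴴ = a.mat := by
  cases a <;> ext i j <;> fin_cases i <;> fin_cases j <;> simp [mat]

/-- Completeness: the sum of `σ ⊗ σ` over the letters is twice the swap. It tensorizes and yields
the Pauli expansion. -/
theorem sum_mat_mul_mat (i j k l : Fin 2) :
    ∑ a : Letter, a.mat i j * a.mat k l = if i = l ∧ j = k then 2 else 0 := by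
  have : (Finset.univ : Finset Letter) = {I, X, Y, Z} := rfl
  rw [this]
  fin_cases i <;> fin_cases j <;> fin_cases k <;> fin_cases l <;> simp [mat] <;> norm_num

theorem trace_mat (a : Letter) : a.mat.trace = if a = I then 2 else 0 := by
  cases a <;> simp [mat, Matrix.trace]; norm_num

theorem mul_eq_I_iff (a b : Letter) : a.mul b = I ↔ a = b := by
  cases a <;> cases b <;> simp [mul]

theorem phase_mod_two (a b : Letter) :
    a.phase b % 2 = if a ≠ I ∧ b ≠ I ∧ a ≠ b then 1 else 0 := by
  cases a <;> cases b <;> simp [phase]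

theorem card_letter : Fintype.card Letter = 4 := rfl

end Letter

namespace PauliString

variable {n : ℕ}

theorem mat_apply (P : PauliString n) (a b : Bits (Fin n)) :
    P.mat a b = ∏ q, (P q).mat (a q) (b q) := rfl

theorem mat_mul_mat (G P : PauliString n) :
    G.mat * P.mat = Complex.I ^ G.phase P • (G.mul P).mat := by
  ext a b
  simp only [Matrix.mul_apply, mat_apply, Matrix.smul_apply, smul_eq_mul, phase, mul]
  rw [← Finset.prod_pow_eq_pow_sum, ← Finset.prod_mul_distrib]
  simp only [← Finset.prod_mul_distrib]
  rw [← Fintype.prod_sum (fun q j => (G q).mat (a q) j * (P q).mat j (b q))]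
  refine Finset.prod_congr rfl fun q _ => ?_
  have := congrFun (congrFun (Letter.mat_mul_mat (G q) (P q)) (a q)) (b q)
  simpa [Matrix.mul_apply] using this

theorem mul_mul_cancel (G P : PauliString n) : G.mul (G.mul P) = P :=
  funext fun _ => Letter.mul_mul_cancel _ _

theorem mul_comm' (G P : PauliString n) : G.mul P = P.mul G :=
  funext fun _ => Letter.mul_comm' _ _

theorem mat_conjTranspose (P : PauliString n) : (P.mat)ᴴ = P.mat := by
  ext a b
  simp only [Matrix.conjTranspose_apply, mat_apply, star_prod]
  refine Finset.prod_congr rfl fun q _ => ?_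
  exact congrFun (congrFun (Letter.mat_conjTranspose (P q)) (a q)) (b q)

theorem sum_mat_mul_mat (a b c d : Bits (Fin n)) :
    ∑ P : PauliString n, P.mat a b * P.mat c d = if a = d ∧ b = c then 2 ^ n else 0 := by
  simp only [mat_apply, ← Finset.prod_mul_distrib]
  rw [← Fintype.prod_sum (fun q (l : Letter) => l.mat (a q) (b q) * l.mat (c q) (d q))]
  simp only [Letter.sum_mat_mul_mat]
  split_ifs with h
  · obtain ⟨rfl, rfl⟩ := h
    simp
  · have : ∃ q, ¬ (a q = d q ∧ b q = c q) := by
      by_contra! hc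
      exact h ⟨funext fun q => (hc q).1, funext fun q => (hc q).2⟩
    obtain ⟨q, hq⟩ := this
    exact Finset.prod_eq_zero (Finset.mem_univ q) (if_neg hq)

theorem trace_mat (P : PauliString n) :
    P.mat.trace = if P = (fun _ => Letter.I) then 2 ^ n else 0 := by
  have h : P.mat.trace = ∏ q, (P q).mat.trace := by
    simp only [Matrix.trace, Matrix.diag, mat_apply]
    rw [← Fintype.prod_sum (fun q j => (P q).mat j j)]
  rw [h]
  simp only [Letter.trace_mat]
  split_ifs with hP
  · subst hP; simp
  · obtain ⟨q, hq⟩ := Function.ne_iff.1 hP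
    exact Finset.prod_eq_zero (Finset.mem_univ q) (if_neg hq)

theorem odd_phase_iff (G P : PauliString n) : Odd (G.phase P) ↔ G.Anticommute P := by
  have : G.phase P % 2 = (Finset.univ.filter fun q =>
      G q ≠ Letter.I ∧ P q ≠ Letter.I ∧ G q ≠ P q).card % 2 := by
    rw [phase, Finset.sum_nat_mod, Finset.card_filter]
    simp only [Letter.phase_mod_two]
  rw [Anticommute, Nat.odd_iff, Nat.odd_iff, this]

theorem anticommute_comm (G P : PauliString n) : G.Anticommute P ↔ P.Anticommute G := by
  unfold Anticommute
  have : (Finset.univ.filter fun q => G q ≠ Letter.I ∧ P q ≠ Letter.I ∧ G q ≠ P q)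
      = Finset.univ.filter fun q => P q ≠ Letter.I ∧ G q ≠ Letter.I ∧ P q ≠ G q := by
    ext q; simp only [Finset.mem_filter, Finset.mem_univ, true_and, ne_comm]; tauto
  rw [this]

theorem mul_self (P : PauliString n) : P.mul P = fun _ => Letter.I :=
  funext fun _ => (Letter.mul_eq_I_iff _ _).2 rfl

theorem mat_id : PauliString.mat (n := n) (fun _ => Letter.I) = 1 := by
  ext a b
  rw [mat_apply, Matrix.one_apply]
  have h2 : ∀ i j : Fin 2, Letter.I.mat i j = if i = j then 1 else 0 := by
    intro i j; fin_cases i <;> fin_cases j <;> simp [Letter.mat]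
  simp only [h2]
  split_ifs with h
  · subst h; simp
  · obtain ⟨q, hq⟩ := Function.ne_iff.1 h
    exact Finset.prod_eq_zero (Finset.mem_univ q) (if_neg hq)

theorem phase_self (P : PauliString n) : P.phase P = 0 := by
  unfold phase
  refine Finset.sum_eq_zero fun q _ => ?_
  cases P q <;> rfl

theorem mat_mul_self (P : PauliString n) : P.mat * P.mat = 1 := by
  rw [mat_mul_mat, phase_self, mul_self, mat_id]; simp

/-- `PG` is the adjoint of `GP`, and conjugating the phase `i ^ e` multiplies it by `(-1) ^ e`; only
the parity of `e` matters, which `odd_phase_iff` reads off. -/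
theorem mat_mul_mat_comm (G P : PauliString n) :
    P.mat * G.mat = (if G.Anticommute P then -1 else 1 : ℂ) • (G.mat * P.mat) := by
  have h1 : P.mat * G.mat = (G.mat * P.mat)ᴴ := by
    rw [Matrix.conjTranspose_mul, mat_conjTranspose, mat_conjTranspose]
  rw [h1, mat_mul_mat, Matrix.conjTranspose_smul, mat_conjTranspose, smul_smul]
  congr 1
  rw [star_pow]
  simp only [Complex.star_def, Complex.conj_I]
  rw [neg_pow]
  split_ifs with h
  · rw [((odd_phase_iff G P).2 h).neg_one_pow]
  · rw [(Nat.not_odd_iff_even.1 (mt (odd_phase_iff G P).1 h)).neg_one_pow]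

theorem commute_of_not_anticommute {G P : PauliString n} (h : ¬ G.Anticommute P) :
    Commute G.mat P.mat := by
  have := mat_mul_mat_comm G P
  rw [if_neg h, one_smul] at this
  exact this.symm

theorem mem_supp {P : PauliString n} {q : Fin n} : q ∈ P.supp ↔ P q ≠ Letter.I := by
  simp [supp]

theorem not_anticommute_of_disjoint {G P : PauliString n} (h : Disjoint G.supp P.supp) :
    ¬ G.Anticommute P := by
  unfold Anticommute
  rw [Finset.filter_false_of_mem]
  · simp
  · rintro q - ⟨h1, h2, -⟩
    exact Finset.disjoint_left.1 h (mem_supp.2 h1) (mem_supp.2 h2)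

theorem supp_mul_subset (G P : PauliString n) : (G.mul P).supp ⊆ G.supp ∪ P.supp := by
  intro q hq
  rw [Finset.mem_union, mem_supp, mem_supp]
  rw [mem_supp] at hq
  by_contra! h
  apply hq
  simp [mul, h.1, h.2, Letter.mul]

theorem weight_mul_le (G P : PauliString n) : (G.mul P).weight ≤ G.weight + P.weight :=
  (Finset.card_le_card (supp_mul_subset G P)).trans (Finset.card_union_le _ _)

/-- Makes `P ↦ G P` an involution of the strings that anticommute with `G`, so that sums over
anticommuting pairs can be reindexed. -/
theorem anticommute_mul (G P : PauliString n) :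
    G.Anticommute (G.mul P) ↔ G.Anticommute P := by
  unfold Anticommute
  have : (Finset.univ.filter fun q =>
      G q ≠ Letter.I ∧ G.mul P q ≠ Letter.I ∧ G q ≠ G.mul P q)
      = Finset.univ.filter fun q => G q ≠ Letter.I ∧ P q ≠ Letter.I ∧ G q ≠ P q := by
    refine Finset.filter_congr fun q _ => ?_
    unfold mul
    generalize G q = x
    generalize P q = y
    revert x y
    decide
  rw [this]

end PauliString

/-! ### The Pauli expansion -/

variable {n : ℕ}

theorem pauliCoeff_add (A B : Op n) (P : PauliString n) :
    pauliCoeff (A + B) P = pauliCoeff A P + pauliCoeff B P := by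
  simp [pauliCoeff, Matrix.mul_add, add_div]

theorem pauliCoeff_smul (c : ℂ) (A : Op n) (P : PauliString n) :
    pauliCoeff (c • A) P = c * pauliCoeff A P := by
  simp [pauliCoeff, mul_div_assoc]

/-- The Pauli coefficient as a linear functional. -/
def pauliCoeffₗ (P : PauliString n) : Op n →ₗ[ℂ] ℂ where
  toFun A := pauliCoeff A P
  map_add' A B := pauliCoeff_add A B P
  map_smul' c A := pauliCoeff_smul c A P

theorem pauliCoeff_sub (A B : Op n) (P : PauliString n) :
    pauliCoeff (A - B) P = pauliCoeff A P - pauliCoeff B P :=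
  (pauliCoeffₗ P).map_sub A B

theorem pauliCoeff_sum {ι : Type*} (s : Finset ι) (A : ι → Op n) (P : PauliString n) :
    pauliCoeff (∑ i ∈ s, A i) P = ∑ i ∈ s, pauliCoeff (A i) P :=
  map_sum (pauliCoeffₗ P) A s

theorem pauliCoeff_mat (P Q : PauliString n) :
    pauliCoeff Q.mat P = if P = Q then 1 else 0 := by
  rw [pauliCoeff, PauliString.mat_mul_mat, Matrix.trace_smul, PauliString.trace_mat]
  by_cases h : P = Q
  · subst h
    simp [PauliString.mul_self, PauliString.phase_self]
  · rw [if_neg h, if_neg]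
    · simp
    · intro h2
      exact h (funext fun q => (Letter.mul_eq_I_iff _ _).1 (congrFun h2 q))

theorem sum_pauliCoeff_smul_mat (A : Op n) : ∑ P, pauliCoeff A P • P.mat = A := by
  ext c d
  rw [Matrix.sum_apply]
  simp only [Matrix.smul_apply, smul_eq_mul, pauliCoeff, Matrix.trace, Matrix.diag,
    Matrix.mul_apply]
  have : ∀ P : PauliString n, (∑ a, ∑ b, P.mat a b * A b a) / 2 ^ n * P.mat c d
      = ∑ a, ∑ b, (A b a / 2 ^ n) * (P.mat a b * P.mat c d) := by
    intro P
    rw [Finset.sum_div, Finset.sum_mul]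
    refine Finset.sum_congr rfl fun a _ => ?_
    rw [Finset.sum_div, Finset.sum_mul]
    exact Finset.sum_congr rfl fun b _ => by ring
  simp only [this]
  rw [Finset.sum_comm]
  rw [Finset.sum_eq_single d, Finset.sum_comm, Finset.sum_eq_single c]
  · rw [← Finset.mul_sum, PauliString.sum_mat_mul_mat]; simp
  · intro b _ hb
    rw [← Finset.mul_sum, PauliString.sum_mat_mul_mat, if_neg (fun h => hb h.2), mul_zero]
  · simp
  · intro a _ ha
    rw [Finset.sum_comm]
    refine Finset.sum_eq_zero fun b _ => ?_
    rw [← Finset.mul_sum, PauliString.sum_mat_mul_mat, if_neg (fun h => ha h.1), mul_zero]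
  · simp

theorem op_ext_pauliCoeff {A B : Op n} (h : ∀ P, pauliCoeff A P = pauliCoeff B P) : A = B := by
  rw [← sum_pauliCoeff_smul_mat A, ← sum_pauliCoeff_smul_mat B]
  simp only [h]

theorem trace_conjTranspose_mul (A B : Op n) :
    (Aᴴ * B).trace = 2 ^ n * ∑ P, star (pauliCoeff A P) * pauliCoeff B P := by
  conv_lhs => rw [← sum_pauliCoeff_smul_mat A]
  rw [Matrix.conjTranspose_sum, Finset.sum_mul, Matrix.trace_sum, Finset.mul_sum]
  refine Finset.sum_congr rfl fun P _ => ?_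
  rw [Matrix.conjTranspose_smul, PauliString.mat_conjTranspose, Matrix.smul_mul,
    Matrix.trace_smul, pauliCoeff, pauliCoeff]
  field_simp
  rw [smul_eq_mul]

theorem pauliNorm_sq_eq_sum (A : Op n) : pauliNorm A ^ 2 = ∑ P, ‖pauliCoeff A P‖ ^ 2 := by
  have h : (Aᴴ * A).trace.re / 2 ^ n = ∑ P, ‖pauliCoeff A P‖ ^ 2 := by
    have h0 : (Aᴴ * A).trace = ((2 ^ n * ∑ P, ‖pauliCoeff A P‖ ^ 2 : ℝ) : ℂ) := by
      rw [trace_conjTranspose_mul]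
      push_cast
      congr 1
      refine Finset.sum_congr rfl fun P _ => ?_
      rw [Complex.star_def, mul_comm, Complex.mul_conj, Complex.normSq_eq_norm_sq]
      push_cast; rfl
    rw [h0, Complex.ofReal_re]
    field_simp
  rw [pauliNorm, Real.sq_sqrt, h]
  rw [h]; positivity

theorem pauliNorm_nonneg (A : Op n) : 0 ≤ pauliNorm A := Real.sqrt_nonneg _

/-- The coefficients of a commutator with a Pauli string. -/
theorem pauliCoeff_commutator (G P : PauliString n) (A : Op n) :
    pauliCoeff (G.mat * A - A * G.mat) P
      = if G.Anticommute P then 2 * Complex.I ^ P.phase G * pauliCoeff A (G.mul P) else 0 := by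
  have h : (P.mat * (G.mat * A - A * G.mat)).trace
      = ((P.mat * G.mat - G.mat * P.mat) * A).trace := by
    rw [Matrix.mul_sub, Matrix.trace_sub, Matrix.sub_mul, Matrix.trace_sub, ← Matrix.mul_assoc,
      ← Matrix.mul_assoc, Matrix.trace_mul_comm (P.mat * A), ← Matrix.mul_assoc]
  rw [pauliCoeff, h, PauliString.mat_mul_mat_comm P G]
  simp only [PauliString.anticommute_comm P G]
  split_ifs with hA
  · rw [neg_one_smul, sub_neg_eq_add, ← two_mul, PauliString.mat_mul_mat, pauliCoeff,
      PauliString.mul_comm' P G]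
    rw [Matrix.mul_assoc, two_mul, Matrix.smul_mul, Matrix.trace_add, Matrix.trace_smul,
      smul_eq_mul]
    ring
  · simp

end LowWeightPauli
end

noncomputable section
namespace LowWeightPauli

variable {n : ℕ}

/-! ### Weighted Pauli norms -/

/-- The vector of Pauli coefficients, weighted by `exp (μ |P|)`. -/
def weightedCoeff (μ : ℝ) : Op n →ₗ[ℂ] EuclideanSpace ℂ (PauliString n) where
  toFun A := WithLp.toLp 2 fun P => (Real.exp (μ * P.weight) : ℂ) * pauliCoeff A P
  map_add' A B := by
    ext P; simp [pauliCoeff_add, mul_add]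
  map_smul' c A := by
    ext P; simp [pauliCoeff_smul]; ring

/-- The Pauli 2-norm in which a string `P` is weighted by `exp (μ |P|)`. -/
def wnorm (μ : ℝ) (A : Op n) : ℝ := ‖weightedCoeff μ A‖

theorem wnorm_nonneg (μ : ℝ) (A : Op n) : 0 ≤ wnorm μ A := norm_nonneg _

theorem wnorm_sq (μ : ℝ) (A : Op n) :
    wnorm μ A ^ 2 = ∑ P, (Real.exp (μ * P.weight) * ‖pauliCoeff A P‖) ^ 2 := by
  rw [wnorm, EuclideanSpace.norm_sq_eq]
  refine Finset.sum_congr rfl fun P _ => ?_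
  simp only [weightedCoeff, LinearMap.coe_mk, AddHom.coe_mk]
  rw [norm_mul, Complex.norm_real, Real.norm_eq_abs, abs_of_pos (Real.exp_pos _)]

theorem wnorm_zero_left (A : Op n) : wnorm 0 A = pauliNorm A := by
  refine (sq_eq_sq₀ (wnorm_nonneg _ _) (pauliNorm_nonneg _)).1 ?_
  rw [wnorm_sq, pauliNorm_sq_eq_sum]
  simp

theorem wnorm_add_le (μ : ℝ) (A B : Op n) : wnorm μ (A + B) ≤ wnorm μ A + wnorm μ B := by
  simp only [wnorm, map_add]; exact norm_add_le _ _

theorem wnorm_sub_le (μ : ℝ) (A B : Op n) : wnorm μ (A - B) ≤ wnorm μ A + wnorm μ B := by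
  simp only [wnorm, map_sub]; exact norm_sub_le _ _

theorem wnorm_smul (μ : ℝ) (c : ℂ) (A : Op n) : wnorm μ (c • A) = ‖c‖ * wnorm μ A := by
  simp only [wnorm, map_smul, norm_smul]

theorem wnorm_real_smul (μ : ℝ) (c : ℝ) (A : Op n) : wnorm μ (c • A) = |c| * wnorm μ A := by
  have : c • A = (c : ℂ) • A := by ext; simp
  rw [this, wnorm_smul, Complex.norm_real, Real.norm_eq_abs]

theorem wnorm_sum_le {ι : Type*} (μ : ℝ) (s : Finset ι) (A : ι → Op n) :
    wnorm μ (∑ i ∈ s, A i) ≤ ∑ i ∈ s, wnorm μ (A i) := by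
  simp only [wnorm, map_sum]; exact norm_sum_le _ _

theorem wnorm_zero (μ : ℝ) : wnorm μ (0 : Op n) = 0 := by simp [wnorm]

theorem wnorm_mono {μ ν : ℝ} (h : μ ≤ ν) (A : Op n) : wnorm μ A ≤ wnorm ν A := by
  refine (sq_le_sq₀ (wnorm_nonneg _ _) (wnorm_nonneg _ _)).1 ?_
  rw [wnorm_sq, wnorm_sq]
  gcongr

theorem pauliNorm_add_le (A B : Op n) : pauliNorm (A + B) ≤ pauliNorm A + pauliNorm B := by
  simp only [← wnorm_zero_left]; exact wnorm_add_le _ _ _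

theorem pauliNorm_sub_le (A B : Op n) : pauliNorm (A - B) ≤ pauliNorm A + pauliNorm B := by
  simp only [← wnorm_zero_left]; exact wnorm_sub_le _ _ _

/-- All Pauli strings in `A` have weight at most `m`. -/
def WeightLE (m : ℕ) (A : Op n) : Prop := ∀ P, pauliCoeff A P ≠ 0 → P.weight ≤ m

theorem wnorm_le_of_weightLE {m : ℕ} {A : Op n} (h : WeightLE m A) {μ : ℝ} (hμ : 0 ≤ μ) :
    wnorm μ A ≤ Real.exp (μ * m) * pauliNorm A := by
  refine (sq_le_sq₀ (wnorm_nonneg _ _)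
    (mul_nonneg (Real.exp_pos _).le (pauliNorm_nonneg _))).1 ?_
  rw [wnorm_sq, mul_pow, pauliNorm_sq_eq_sum, Finset.mul_sum]
  refine Finset.sum_le_sum fun P _ => ?_
  by_cases hP : pauliCoeff A P = 0
  · simp [hP]
  · rw [mul_pow]
    have := h P hP
    gcongr

/-- The part of an operator on strings of weight larger than `w` is small in the Pauli norm. -/
theorem pauliNorm_le_of_high_weight {w : ℕ} {A B : Op n} {μ : ℝ} (hμ : 0 ≤ μ)
    (h : ∀ P, pauliCoeff B P = if P.weight ≤ w then 0 else pauliCoeff A P) :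
    pauliNorm B ≤ Real.exp (-(μ * w)) * wnorm μ A := by
  refine (sq_le_sq₀ (pauliNorm_nonneg _)
    (mul_nonneg (Real.exp_pos _).le (wnorm_nonneg _ _))).1 ?_
  rw [pauliNorm_sq_eq_sum, mul_pow, wnorm_sq, Finset.mul_sum]
  refine Finset.sum_le_sum fun P _ => ?_
  rw [h, ← mul_pow, ← mul_assoc, ← Real.exp_add]
  split_ifs with hw
  · rw [norm_zero, zero_pow two_ne_zero]; positivity
  · refine pow_le_pow_left₀ (norm_nonneg _) (le_mul_of_one_le_left (norm_nonneg _) ?_) 2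
    rw [Real.one_le_exp_iff]
    have : (w : ℝ) ≤ P.weight := by exact_mod_cast (not_le.1 hw).le
    nlinarith

/-- Cutting off coefficients decreases the weighted norm. -/
theorem wnorm_le_of_coeff_le {A B : Op n} (μ : ℝ)
    (h : ∀ P, ‖pauliCoeff B P‖ ≤ ‖pauliCoeff A P‖) : wnorm μ B ≤ wnorm μ A := by
  refine (sq_le_sq₀ (wnorm_nonneg _ _) (wnorm_nonneg _ _)).1 ?_
  rw [wnorm_sq, wnorm_sq]
  gcongr with P _
  exact h P

/-! ### Products of operators of low weight -/

/-- Convolution of functions on Pauli strings. -/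
def pauliConv (f g : PauliString n → ℝ) (R : PauliString n) : ℝ := ∑ P, f P * g (P.mul R)

/-- The one-qubit case; the factor 4 on non-identity letters pays for the cross terms. Each
non-identity output is a sum of three pieces, which costs a factor 3, and the identity output adds
one more: mixed terms get 3 + 1 = 4, products of non-identity letters at most 7 ≤ 16. -/
theorem letter_conv_sq_le (x y : Letter → ℝ) :
    ∑ r : Letter, (∑ a, x a * y (a.mul r)) ^ 2
      ≤ (∑ a, (if a = Letter.I then 1 else 4) * x a ^ 2)
        * ∑ a, (if a = Letter.I then 1 else 4) * y a ^ 2 := by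
  have hs : ∀ f : Letter → ℝ, ∑ a, f a = f .I + f .X + f .Y + f .Z := by
    intro f
    have : (Finset.univ : Finset Letter) = {.I, .X, .Y, .Z} := rfl
    rw [this]
    simp
    ring
  simp only [hs, Letter.mul, reduceCtorEq, if_true, if_false, one_mul]
  generalize x .I = a0 at *
  generalize x .X = a1 at *
  generalize x .Y = a2 at *
  generalize x .Z = a3 at *
  generalize y .I = b0 at *
  generalize y .X = b1 at *
  generalize y .Y = b2 at *
  generalize y .Z = b3 at *
  set p := a1 * b1 + a2 * b2 + a3 * b3 with hp
  have h3 : ∀ u v z : ℝ, (u + v + z) ^ 2 ≤ 3 * (u ^ 2 + v ^ 2 + z ^ 2) := fun u v z => by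
    nlinarith [sq_nonneg (u - v), sq_nonneg (v - z), sq_nonneg (u - z)]
  have hcs : p ^ 2 ≤ (a1 ^ 2 + a2 ^ 2 + a3 ^ 2) * (b1 ^ 2 + b2 ^ 2 + b3 ^ 2) := by
    nlinarith [sq_nonneg (a1 * b2 - a2 * b1), sq_nonneg (a1 * b3 - a3 * b1),
      sq_nonneg (a2 * b3 - a3 * b2)]
  have h0 : (a0 * b0 + p) ^ 2 ≤ a0 ^ 2 * b0 ^ 2 + (a0 ^ 2 * (b1 ^ 2 + b2 ^ 2 + b3 ^ 2)
      + (a1 ^ 2 + a2 ^ 2 + a3 ^ 2) * b0 ^ 2)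
      + (a1 ^ 2 + a2 ^ 2 + a3 ^ 2) * (b1 ^ 2 + b2 ^ 2 + b3 ^ 2) := by
    nlinarith [sq_nonneg (a0 * b1 - a1 * b0), sq_nonneg (a0 * b2 - a2 * b0),
      sq_nonneg (a0 * b3 - a3 * b0)]
  have hc : ∀ u v s t : ℝ, (u * s + v * t) ^ 2 ≤ (u ^ 2 + v ^ 2) * (s ^ 2 + t ^ 2) :=
    fun u v s t => by nlinarith [sq_nonneg (u * t - v * s)]
  have h1 := h3 (a0 * b1) (a1 * b0) (a2 * b3 + a3 * b2)
  have h2 := h3 (a0 * b2) (a2 * b0) (a1 * b3 + a3 * b1)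
  have h4 := h3 (a0 * b3) (a3 * b0) (a1 * b2 + a2 * b1)
  have k1 := hc a2 a3 b3 b2
  have k2 := hc a1 a3 b3 b1
  have k3 := hc a1 a2 b2 b1
  have hA : 0 ≤ (a1 ^ 2 + a2 ^ 2 + a3 ^ 2) * (b1 ^ 2 + b2 ^ 2 + b3 ^ 2) := by positivity
  have hB : 0 ≤ a0 ^ 2 * (b1 ^ 2 + b2 ^ 2 + b3 ^ 2) := by positivity
  have hC : 0 ≤ (a1 ^ 2 + a2 ^ 2 + a3 ^ 2) * b0 ^ 2 := by positivity
  have hD : 0 ≤ (a1 * b1) ^ 2 + (a2 * b2) ^ 2 + (a3 * b3) ^ 2 := by positivity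
  have g0 : a0 * b0 + a1 * b1 + a2 * b2 + a3 * b3 = a0 * b0 + p := by rw [hp]; ring
  have g1 : a0 * b1 + a1 * b0 + a2 * b3 + a3 * b2
    = a0 * b1 + a1 * b0 + (a2 * b3 + a3 * b2) := by ring
  have g2 : a0 * b2 + a1 * b3 + a2 * b0 + a3 * b1
    = a0 * b2 + a2 * b0 + (a1 * b3 + a3 * b1) := by ring
  have g3 : a0 * b3 + a1 * b2 + a2 * b1 + a3 * b0
    = a0 * b3 + a3 * b0 + (a1 * b2 + a2 * b1) := by ring
  rw [g0, g1, g2, g3]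
  nlinarith

theorem sum_pauliString_succ (f : PauliString (n + 1) → ℝ) :
    ∑ P, f P = ∑ a : Letter, ∑ Q : PauliString n, f (Fin.cons a Q) := by
  rw [← Fintype.sum_prod_type']
  exact (Fintype.sum_equiv (Fin.consEquiv fun _ => Letter) _ _ fun _ => rfl).symm

theorem PauliString.cons_mul (a b : Letter) (P Q : PauliString n) :
    PauliString.mul (n := n + 1) (Fin.cons a P) (Fin.cons b Q)
      = Fin.cons (a.mul b) (P.mul Q) := by
  funext q
  refine Fin.cases ?_ (fun i => ?_) q <;> simp [PauliString.mul]

theorem PauliString.weight_cons (a : Letter) (P : PauliString n) :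
    PauliString.weight (n := n + 1) (Fin.cons a P)
      = (if a = Letter.I then 0 else 1) + P.weight := by
  simp only [PauliString.weight, PauliString.supp, Finset.card_filter, Fin.sum_univ_succ,
    Fin.cons_zero, Fin.cons_succ]
  simp

/-- Tensorization: both functions are sliced by the first letter, the convolutions of the slices are
bounded by induction and combined by Minkowski's inequality, and the one-qubit inequality is applied
to the norms of the slices. No factor is lost per qubit. -/
theorem sum_pauliConv_sq_le : ∀ {n : ℕ} (f g : PauliString n → ℝ), (∀ P, 0 ≤ f P) →
    (∀ P, 0 ≤ g P) → ∑ R, pauliConv f g R ^ 2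
      ≤ (∑ P : PauliString n, (4 : ℝ) ^ P.weight * f P ^ 2) *
        ∑ P : PauliString n, (4 : ℝ) ^ P.weight * g P ^ 2
  | 0, f, g, _, _ => by
      have h : ∀ P : PauliString 0, P.weight = 0 := fun P => by
        simp [PauliString.weight, PauliString.supp]
      simp only [pauliConv, Fintype.sum_subsingleton _ (fun _ : Fin 0 => Letter.I), h]
      rw [Subsingleton.elim (PauliString.mul _ _) (fun _ : Fin 0 => Letter.I)]
      apply le_of_eq
      ring
  | n + 1, f, g, hf, hg => by
      set F : Letter → PauliString n → ℝ := fun a P => f (Fin.cons a P) with hF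
      set G : Letter → PauliString n → ℝ := fun a P => g (Fin.cons a P) with hG
      set x : Letter → ℝ := fun a =>
        Real.sqrt (∑ P : PauliString n, (4 : ℝ) ^ P.weight * F a P ^ 2) with hx
      set y : Letter → ℝ := fun a =>
        Real.sqrt (∑ P : PauliString n, (4 : ℝ) ^ P.weight * G a P ^ 2) with hy
      have hx2 : ∀ a, x a ^ 2 = ∑ P : PauliString n, (4 : ℝ) ^ P.weight * F a P ^ 2 :=
        fun a => Real.sq_sqrt (by positivity)
      have hy2 : ∀ a, y a ^ 2 = ∑ P : PauliString n, (4 : ℝ) ^ P.weight * G a P ^ 2 :=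
        fun a => Real.sq_sqrt (by positivity)
      have key : ∀ (h : PauliString (n + 1) → ℝ),
          ∑ P : PauliString (n + 1), (4 : ℝ) ^ P.weight * h P ^ 2
            = ∑ a, (if a = Letter.I then 1 else 4) *
              ∑ P : PauliString n, (4 : ℝ) ^ P.weight * h (Fin.cons a P) ^ 2 := by
        intro h
        rw [sum_pauliString_succ]
        refine Finset.sum_congr rfl fun a _ => ?_
        rw [Finset.mul_sum]
        refine Finset.sum_congr rfl fun P _ => ?_
        rw [PauliString.weight_cons]
        split_ifs <;> ring
      have hL : ∑ R, pauliConv f g R ^ 2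
          = ∑ r, ∑ R, (∑ a, pauliConv (F a) (G (a.mul r)) R) ^ 2 := by
        rw [sum_pauliString_succ]
        refine Finset.sum_congr rfl fun r _ => Finset.sum_congr rfl fun R _ => ?_
        congr 1
        rw [pauliConv, sum_pauliString_succ]
        simp only [PauliString.cons_mul]
        rfl
      rw [hL, key f, key g]
      have hfin := letter_conv_sq_le x y
      simp only [hx2, hy2] at hfin
      refine le_trans (Finset.sum_le_sum fun r _ => ?_) hfin
      have h1 : ∀ a b, ‖WithLp.toLp 2 (pauliConv (F a) (G b))‖ ≤ x a * y b := by
        intro a b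
        refine (sq_le_sq₀ (norm_nonneg _) (by positivity)).1 ?_
        rw [EuclideanSpace.norm_sq_eq, mul_pow, hx2, hy2]
        have := sum_pauliConv_sq_le (F a) (G b) (fun _ => hf _) (fun _ => hg _)
        simpa using this
      have h2 : ‖∑ a, WithLp.toLp 2 (pauliConv (F a) (G (a.mul r)))‖
          ≤ ∑ a, x a * y (a.mul r) :=
        (norm_sum_le _ _).trans (Finset.sum_le_sum fun a _ => h1 _ _)
      have h3 := pow_le_pow_left₀ (norm_nonneg _) h2 2
      rw [EuclideanSpace.norm_sq_eq] at h3
      simpa [WithLp.ofLp_sum] using h3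

theorem pauliCoeff_mul (A B : Op n) (R : PauliString n) :
    pauliCoeff (A * B) R
      = ∑ P, pauliCoeff A P * (Complex.I ^ R.phase P * pauliCoeff B (P.mul R)) := by
  conv_lhs => rw [← sum_pauliCoeff_smul_mat A]
  rw [Finset.sum_mul, pauliCoeff_sum]
  refine Finset.sum_congr rfl fun P _ => ?_
  rw [Matrix.smul_mul, pauliCoeff_smul]
  congr 1
  rw [pauliCoeff, pauliCoeff, ← Matrix.mul_assoc, PauliString.mat_mul_mat, Matrix.smul_mul,
    Matrix.trace_smul, PauliString.mul_comm' P R]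
  simp [mul_div_assoc]

/-- A product bound with 2-norms on both factors and no dependence on the dimension. The parameter 1
suffices because `exp (2 |P|)` dominates `4 ^ |P|`. -/
theorem pauliNorm_mul_le (A B : Op n) : pauliNorm (A * B) ≤ wnorm 1 A * wnorm 1 B := by
  refine (sq_le_sq₀ (pauliNorm_nonneg _)
    (mul_nonneg (wnorm_nonneg _ _) (wnorm_nonneg _ _))).1 ?_
  have h4 : ∀ (A : Op n), ∑ P : PauliString n, (4 : ℝ) ^ P.weight * ‖pauliCoeff A P‖ ^ 2
      ≤ wnorm 1 A ^ 2 := by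
    intro A
    rw [wnorm_sq]
    refine Finset.sum_le_sum fun P _ => ?_
    rw [mul_pow, one_mul]
    gcongr
    rw [← Real.exp_one_pow, ← pow_mul, mul_comm, pow_mul]
    gcongr
    nlinarith [Real.exp_one_gt_d9]
  rw [pauliNorm_sq_eq_sum, mul_pow]
  refine le_trans ?_ (mul_le_mul (h4 A) (h4 B) (by positivity) (by positivity))
  refine le_trans (Finset.sum_le_sum fun R _ => ?_)
    (sum_pauliConv_sq_le (fun P => ‖pauliCoeff A P‖) (fun P => ‖pauliCoeff B P‖)
      (fun _ => norm_nonneg _) (fun _ => norm_nonneg _))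
  refine pow_le_pow_left₀ (norm_nonneg _) ?_ 2
  rw [pauliCoeff_mul, pauliConv]
  refine (norm_sum_le _ _).trans (Finset.sum_le_sum fun P _ => ?_)
  simp

theorem WeightLE.mul {m k : ℕ} {A B : Op n} (hA : WeightLE m A) (hB : WeightLE k B) :
    WeightLE (m + k) (A * B) := by
  intro R hR
  rw [pauliCoeff_mul] at hR
  obtain ⟨P, -, hP⟩ := Finset.exists_ne_zero_of_sum_ne_zero hR
  have h1 := hA P (left_ne_zero_of_mul hP)
  have h2 := hB _ (right_ne_zero_of_mul (right_ne_zero_of_mul hP))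
  have := PauliString.weight_mul_le P (P.mul R)
  rw [PauliString.mul_mul_cancel] at this
  omega

theorem WeightLE.sub {m : ℕ} {A B : Op n} (hA : WeightLE m A) (hB : WeightLE m B) :
    WeightLE m (A - B) := by
  intro R hR
  rw [pauliCoeff_sub] at hR
  by_cases h : pauliCoeff A R = 0
  · refine hB R fun h2 => hR (by rw [h, h2, sub_zero])
  · exact hA R h

theorem WeightLE.sum {ι : Type*} {m : ℕ} {s : Finset ι} {A : ι → Op n}
    (h : ∀ i ∈ s, WeightLE m (A i)) : WeightLE m (∑ i ∈ s, A i) := by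
  intro R hR
  rw [pauliCoeff_sum] at hR
  obtain ⟨i, hi, hR⟩ := Finset.exists_ne_zero_of_sum_ne_zero hR
  exact h i hi R hR

theorem WeightLE.smul_mat {m : ℕ} {P : PauliString n} (h : P.weight ≤ m) (c : ℂ) :
    WeightLE m (c • P.mat) := by
  intro R hR
  rw [pauliCoeff_smul, pauliCoeff_mat] at hR
  by_cases e : R = P
  · rwa [e]
  · simp [e] at hR

end LowWeightPauli
end

noncomputable section
namespace LowWeightPauli

variable {n Γ : ℕ}

/-! ### Commutators with local Hamiltonians -/

namespace LayeredHamiltonian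

variable (H : LayeredHamiltonian n Γ)

/-- A linear combination of the Pauli terms of `H` with new coefficients. -/
def combo (c : Fin H.numTerms → ℝ) : Op n := ∑ l, (c l : ℂ) • (H.pauli l).mat

/-- The terms of `H` that anticommute with `P`. -/
def anti (P : PauliString n) : Finset (Fin H.numTerms) :=
  Finset.univ.filter fun l => (H.pauli l).Anticommute P

theorem mem_anti {P : PauliString n} {l : Fin H.numTerms} :
    l ∈ H.anti P ↔ (H.pauli l).Anticommute P := by simp [anti]

theorem layerOp_eq_combo (γ : Fin Γ) :
    H.layerOp γ = H.combo fun l => if H.layer l = γ then H.coeff l else 0 := by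
  rw [layerOp, combo, Finset.sum_filter]
  refine Finset.sum_congr rfl fun l _ => ?_
  split_ifs <;> simp

theorem op_eq_combo : H.op = H.combo H.coeff := by
  simp only [op, layerOp, combo, Finset.sum_filter]
  rw [Finset.sum_comm]
  refine Finset.sum_congr rfl fun l _ => ?_
  simp

theorem combo_neg (c : Fin H.numTerms → ℝ) : H.combo (fun l => -c l) = -H.combo c := by
  simp [combo]

/-- The supports in a layer are disjoint, so each qubit of `P` lies in at most one of them. -/
theorem card_touching_le (γ : Fin Γ) (P : PauliString n) :
    (Finset.univ.filter fun l => H.layer l = γ ∧ ¬ Disjoint (H.pauli l).supp P.supp).card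
      ≤ P.weight := by
  have hex : ∀ l ∈ Finset.univ.filter (fun l => H.layer l = γ ∧
      ¬ Disjoint (H.pauli l).supp P.supp), ∃ q ∈ P.supp, q ∈ (H.pauli l).supp := by
    intro l hl
    obtain ⟨q, h1, h2⟩ := Finset.not_disjoint_iff.1 (Finset.mem_filter.1 hl).2.2
    exact ⟨q, h2, h1⟩
  choose f hf1 hf2 using hex
  refine Finset.card_le_card_of_forall_subsingleton (fun l q => q ∈ (H.pauli l).supp)
    (fun l hl => ⟨f l hl, hf1 l hl, hf2 l hl⟩) fun q _ l hl l' hl' => ?_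
  by_contra hne
  have hl1 := Finset.mem_filter.1 hl.1
  have hl2 := Finset.mem_filter.1 hl'.1
  exact Finset.disjoint_left.1 (H.disjoint l l' hne (hl1.2.1.trans hl2.2.1.symm)) hl.2 hl'.2

/-- A term that anticommutes with `P` meets its support, which leaves at most `|P|` candidates per
layer. Uniformity in `n` originates here. -/
theorem card_anti_le (P : PauliString n) : (H.anti P).card ≤ Γ * P.weight := by
  have : H.anti P ⊆ Finset.univ.biUnion fun γ => Finset.univ.filter fun l =>
      H.layer l = γ ∧ ¬ Disjoint (H.pauli l).supp P.supp := by
    intro l hl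
    rw [mem_anti] at hl
    simp only [Finset.mem_biUnion, Finset.mem_univ, true_and, Finset.mem_filter]
    exact ⟨_, rfl, fun h => PauliString.not_anticommute_of_disjoint h hl⟩
  refine (Finset.card_le_card this).trans (Finset.card_biUnion_le.trans ?_)
  refine (Finset.sum_le_sum fun γ _ => H.card_touching_le γ P).trans ?_
  simp

/-- The strings with edges `P — G_l P` form an undirected graph, since `P ↦ G_l P` is an involution;
the two ends of an edge may be exchanged. -/
theorem sum_anti_swap (F : PauliString n → PauliString n → ℝ) :
    ∑ P, ∑ l ∈ H.anti P, F P ((H.pauli l).mul P)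
      = ∑ P, ∑ l ∈ H.anti P, F ((H.pauli l).mul P) P := by
  simp only [anti, Finset.sum_filter]
  rw [Finset.sum_comm]
  conv_rhs => rw [Finset.sum_comm]
  refine Finset.sum_congr rfl fun l _ => ?_
  have hinv : Function.Involutive (fun P => (H.pauli l).mul P) :=
    fun P => PauliString.mul_mul_cancel _ _
  refine Fintype.sum_equiv hinv.toPerm _ _ fun P => ?_
  simp only [Function.Involutive.coe_toPerm, PauliString.anticommute_mul,
    PauliString.mul_mul_cancel]

/-- AM–GM on each edge and an exchange of its ends leave `x P ^ 2` times the degree of `P`. -/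
theorem sum_mul_sum_anti_le (x : PauliString n → ℝ) :
    ∑ P, x P * ∑ l ∈ H.anti P, x ((H.pauli l).mul P) ≤ Γ * ∑ P, P.weight * x P ^ 2 := by
  have h1 : ∑ P, x P * ∑ l ∈ H.anti P, x ((H.pauli l).mul P)
      ≤ ∑ P, ∑ l ∈ H.anti P, (x P ^ 2 / 2 + x ((H.pauli l).mul P) ^ 2 / 2) := by
    refine Finset.sum_le_sum fun P _ => ?_
    rw [Finset.mul_sum]
    refine Finset.sum_le_sum fun l _ => ?_
    nlinarith [sq_nonneg (x P - x ((H.pauli l).mul P))]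
  have h2 := H.sum_anti_swap fun _ Q => x Q ^ 2 / 2
  simp only [Finset.sum_add_distrib] at h1
  rw [h2] at h1
  refine h1.trans ?_
  rw [← Finset.sum_add_distrib, Finset.mul_sum]
  refine Finset.sum_le_sum fun P _ => ?_
  simp only [Finset.sum_const, nsmul_eq_mul]
  have h3 : ((H.anti P).card : ℝ) ≤ Γ * P.weight := by exact_mod_cast H.card_anti_le P
  nlinarith [sq_nonneg (x P)]

/-- Cauchy–Schwarz costs the degree of `P`; after the ends are exchanged this is the degree of a
neighbour, whose weight is at most `|P| + k`. -/
theorem sum_sq_sum_anti_le {k : ℕ} (hk : ∀ l, (H.pauli l).weight ≤ k) (x : PauliString n → ℝ) :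
    ∑ P, (∑ l ∈ H.anti P, x ((H.pauli l).mul P)) ^ 2
      ≤ ∑ P, (Γ * P.weight) * (Γ * (P.weight + k)) * x P ^ 2 := by
  have h1 : ∑ P, (∑ l ∈ H.anti P, x ((H.pauli l).mul P)) ^ 2
      ≤ ∑ P, ∑ l ∈ H.anti P, (Γ * P.weight : ℝ) * x ((H.pauli l).mul P) ^ 2 := by
    refine Finset.sum_le_sum fun P _ => ?_
    refine sq_sum_le_card_mul_sum_sq.trans ?_
    rw [← Finset.mul_sum]
    have h3 : ((H.anti P).card : ℝ) ≤ Γ * P.weight := by exact_mod_cast H.card_anti_le P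
    gcongr
  refine h1.trans ?_
  rw [H.sum_anti_swap fun P Q => (Γ * P.weight : ℝ) * x Q ^ 2]
  refine Finset.sum_le_sum fun P _ => ?_
  have h3 : ((H.anti P).card : ℝ) ≤ Γ * P.weight := by exact_mod_cast H.card_anti_le P
  have h4 : ∀ l ∈ H.anti P, (Γ * ((H.pauli l).mul P).weight : ℝ) * x P ^ 2
      ≤ (Γ * (P.weight + k)) * x P ^ 2 := by
    intro l _
    have : ((H.pauli l).mul P).weight ≤ P.weight + k := by
      have := PauliString.weight_mul_le (H.pauli l) P
      have := hk l
      omega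
    have : (((H.pauli l).mul P).weight : ℝ) ≤ P.weight + k := by exact_mod_cast this
    gcongr
  refine (Finset.sum_le_sum h4).trans ?_
  rw [Finset.sum_const, nsmul_eq_mul, mul_assoc (Γ * P.weight : ℝ)]
  gcongr

variable {H}

theorem norm_pauliCoeff_commutator_le {c : Fin H.numTerms → ℝ} {b : ℝ} (hc : ∀ l, |c l| ≤ b)
    (A : Op n) (P : PauliString n) :
    ‖pauliCoeff (H.combo c * A - A * H.combo c) P‖
      ≤ 2 * b * ∑ l ∈ H.anti P, ‖pauliCoeff A ((H.pauli l).mul P)‖ := by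
  have h : H.combo c * A - A * H.combo c
      = ∑ l, (c l : ℂ) • ((H.pauli l).mat * A - A * (H.pauli l).mat) := by
    simp only [combo, Finset.sum_mul, Finset.mul_sum, smul_sub, Finset.sum_sub_distrib,
      Matrix.smul_mul, Matrix.mul_smul]
  rw [h, pauliCoeff_sum, anti, Finset.sum_filter, Finset.mul_sum]
  refine (norm_sum_le _ _).trans (Finset.sum_le_sum fun l _ => ?_)
  rw [pauliCoeff_smul, pauliCoeff_commutator]
  split_ifs
  · simp only [norm_mul, Complex.norm_real, Real.norm_eq_abs, norm_pow, Complex.norm_I, one_pow,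
      mul_one]
    have := hc l
    have h2 := norm_nonneg (pauliCoeff A ((H.pauli l).mul P))
    rw [Complex.norm_ofNat]
    nlinarith
  · simp

theorem exp_weight_le {k : ℕ} (hk : ∀ l, (H.pauli l).weight ≤ k) {μ : ℝ} (hμ : 0 ≤ μ)
    (l : Fin H.numTerms) (P : PauliString n) :
    Real.exp (μ * P.weight)
      ≤ Real.exp (μ * k) * Real.exp (μ * ((H.pauli l).mul P).weight) := by
  rw [← Real.exp_add, Real.exp_le_exp, ← mul_add]
  have h1 := PauliString.weight_mul_le (H.pauli l) ((H.pauli l).mul P)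
  rw [PauliString.mul_mul_cancel] at h1
  have : P.weight ≤ k + ((H.pauli l).mul P).weight := h1.trans (by have := hk l; omega)
  have : (P.weight : ℝ) ≤ k + ((H.pauli l).mul P).weight := by exact_mod_cast this
  gcongr

theorem exp_mul_norm_commutator_le {k : ℕ} (hk : ∀ l, (H.pauli l).weight ≤ k)
    {c : Fin H.numTerms → ℝ} {b : ℝ} (hb : 0 ≤ b) (hc : ∀ l, |c l| ≤ b) {μ : ℝ} (hμ : 0 ≤ μ)
    (A : Op n) (P : PauliString n) :
    Real.exp (μ * P.weight) * ‖pauliCoeff (H.combo c * A - A * H.combo c) P‖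
      ≤ 2 * b * Real.exp (μ * k) * ∑ l ∈ H.anti P,
        Real.exp (μ * ((H.pauli l).mul P).weight) * ‖pauliCoeff A ((H.pauli l).mul P)‖ := by
  refine (mul_le_mul_of_nonneg_left (norm_pauliCoeff_commutator_le hc A P)
    (Real.exp_pos _).le).trans ?_
  rw [mul_left_comm, mul_assoc (2 * b)]
  refine mul_le_mul_of_nonneg_left ?_ (mul_nonneg two_pos.le hb)
  rw [Finset.mul_sum, Finset.mul_sum]
  refine Finset.sum_le_sum fun l _ => ?_
  rw [← mul_assoc]
  exact mul_le_mul_of_nonneg_right (exp_weight_le hk hμ l P) (norm_nonneg _)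

/-- The commutator with a local Hamiltonian costs a unit of the weight parameter. -/
theorem wnorm_commutator_le {k : ℕ} (hk : ∀ l, (H.pauli l).weight ≤ k)
    {c : Fin H.numTerms → ℝ} {b : ℝ} (hb : 0 ≤ b) (hc : ∀ l, |c l| ≤ b) {μ : ℝ} (hμ : 0 ≤ μ)
    (A : Op n) :
    wnorm μ (H.combo c * A - A * H.combo c)
      ≤ 2 * b * Γ * Real.exp (μ * k) * (k + 1) * wnorm (μ + 1) A := by
  refine (sq_le_sq₀ (wnorm_nonneg _ _) (mul_nonneg (by positivity) (wnorm_nonneg _ _))).1 ?_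
  set x : PauliString n → ℝ := fun P => Real.exp (μ * P.weight) * ‖pauliCoeff A P‖ with hx
  have h1 : wnorm μ (H.combo c * A - A * H.combo c) ^ 2
      ≤ ∑ P, (2 * b * Real.exp (μ * k)) ^ 2 *
        (∑ l ∈ H.anti P, x ((H.pauli l).mul P)) ^ 2 := by
    rw [wnorm_sq]
    refine Finset.sum_le_sum fun P _ => ?_
    rw [← mul_pow]
    exact pow_le_pow_left₀ (by positivity) (exp_mul_norm_commutator_le hk hb hc hμ A P) 2
  refine h1.trans ?_
  rw [← Finset.mul_sum]
  refine (mul_le_mul_of_nonneg_left (H.sum_sq_sum_anti_le hk x) (by positivity)).trans ?_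
  rw [mul_pow _ (wnorm _ _), wnorm_sq, Finset.mul_sum, Finset.mul_sum]
  refine Finset.sum_le_sum fun P _ => ?_
  -- The quadratic growth in the weight is absorbed by raising the weight parameter by one.
  have h2 : (P.weight : ℝ) * (P.weight + k) ≤ (k + 1) ^ 2 * Real.exp P.weight ^ 2 := by
    have h3 : (P.weight : ℝ) + 1 ≤ Real.exp P.weight := Real.add_one_le_exp _
    have h4 : (0 : ℝ) ≤ P.weight := Nat.cast_nonneg _
    have h5 : (P.weight : ℝ) + k ≤ (k + 1) ^ 2 * Real.exp P.weight := by
      have h6 : (0 : ℝ) ≤ k := Nat.cast_nonneg _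
      nlinarith [mul_nonneg h6 h6, mul_nonneg h6 h4, mul_nonneg (mul_nonneg h6 h6) h4]
    calc (P.weight : ℝ) * (P.weight + k)
        ≤ Real.exp P.weight * ((k + 1) ^ 2 * Real.exp P.weight) :=
          mul_le_mul (by linarith) h5 (by positivity) (Real.exp_pos _).le
      _ = _ := by ring
  have h7 : Real.exp ((μ + 1) * P.weight) = Real.exp (μ * P.weight) * Real.exp P.weight := by
    rw [← Real.exp_add]; ring_nf
  rw [h7, hx]
  calc (2 * b * Real.exp (μ * k)) ^ 2 * ((Γ * P.weight) * (Γ * (P.weight + k)) *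
        (Real.exp (μ * P.weight) * ‖pauliCoeff A P‖) ^ 2)
      = ((2 * b * Real.exp (μ * k)) ^ 2 * Γ ^ 2 *
        (Real.exp (μ * P.weight) * ‖pauliCoeff A P‖) ^ 2) * (P.weight * (P.weight + k)) := by ring
    _ ≤ ((2 * b * Real.exp (μ * k)) ^ 2 * Γ ^ 2 *
        (Real.exp (μ * P.weight) * ‖pauliCoeff A P‖) ^ 2) *
          ((k + 1) ^ 2 * Real.exp P.weight ^ 2) :=
        mul_le_mul_of_nonneg_left h2 (by positivity)
    _ = _ := by ring

end LayeredHamiltonian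

/-! ### Heisenberg evolution -/

/-- The Heisenberg evolution `exp(i s K) A exp(-i s K)`. -/
def heis (K : Op n) (s : ℝ) (A : Op n) : Op n := evolution K (-s) * A * evolution K s

open scoped Matrix.Norms.Operator

theorem evolution_eq (K : Op n) (s : ℝ) :
    evolution K s = NormedSpace.exp (s • ((-Complex.I) • K)) := by
  rw [evolution]
  congr 1
  ext i j
  simp
  ring

theorem hasDerivAt_evolution (K : Op n) (s : ℝ) :
    HasDerivAt (evolution K) (evolution K s * ((-Complex.I) • K)) s := by
  rw [show evolution K = _ from funext (evolution_eq K)]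
  exact hasDerivAt_exp_smul_const (𝕂 := ℝ) ((-Complex.I) • K) s

theorem hasDerivAt_evolution' (K : Op n) (s : ℝ) :
    HasDerivAt (evolution K) (((-Complex.I) • K) * evolution K s) s := by
  rw [show evolution K = _ from funext (evolution_eq K)]
  exact hasDerivAt_exp_smul_const' (𝕂 := ℝ) ((-Complex.I) • K) s

theorem evolution_add (K : Op n) (s t : ℝ) :
    evolution K (s + t) = evolution K s * evolution K t := by
  simp only [evolution_eq]
  rw [add_smul, Matrix.exp_add_of_commute]
  exact ((Commute.refl _).smul_left _).smul_right _

theorem evolution_zero (K : Op n) : evolution K 0 = 1 := by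
  rw [evolution_eq, zero_smul, NormedSpace.exp_zero]

theorem evolution_neg_mul (K : Op n) (s : ℝ) : evolution K (-s) * evolution K s = 1 := by
  rw [← evolution_add, neg_add_cancel, evolution_zero]

theorem evolution_mul_neg (K : Op n) (s : ℝ) : evolution K s * evolution K (-s) = 1 := by
  rw [← evolution_add, add_neg_cancel, evolution_zero]

theorem evolution_neg_left (K : Op n) (s : ℝ) : evolution (-K) s = evolution K (-s) := by
  simp [evolution]

theorem evolution_commute (K : Op n) (s : ℝ) : Commute (evolution K s) K := by
  rw [evolution_eq]
  exact ((Commute.refl K).smul_left _ |>.smul_left _).exp_left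

theorem evolution_conjTranspose {K : Op n} (hK : K.IsHermitian) (s : ℝ) :
    (evolution K s)ᴴ = evolution K (-s) := by
  rw [evolution, ← Matrix.exp_conjTranspose, evolution, Matrix.conjTranspose_smul, hK.eq]
  simp

theorem heis_zero (K A : Op n) : heis K 0 A = A := by simp [heis, evolution_zero]

theorem heis_add (K : Op n) (s t : ℝ) (A : Op n) : heis K (s + t) A = heis K s (heis K t A) := by
  rw [heis, heis, heis, neg_add, evolution_add, add_comm s t, evolution_add]
  simp only [Matrix.mul_assoc]

theorem heis_neg_left (K : Op n) (s : ℝ) (A : Op n) : heis (-K) s A = heis K (-s) A := by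
  simp [heis, evolution_neg_left]

theorem hasDerivAt_heis (K A : Op n) (s : ℝ) :
    HasDerivAt (fun s => heis K s A) (heis K s (Complex.I • (K * A - A * K))) s := by
  have h1 : HasDerivAt (fun s => evolution K (-s)) (evolution K (-s) * (Complex.I • K)) s := by
    have := hasDerivAt_evolution (-K) s
    rw [show evolution (-K) = _ from funext (evolution_neg_left K)] at this
    simpa using this
  have h2 := (h1.mul_const A).mul (hasDerivAt_evolution' K s)
  refine h2.congr_deriv ?_
  rw [heis]
  simp only [Matrix.mul_smul, Matrix.smul_mul, Matrix.mul_assoc, neg_smul, mul_neg, neg_mul, sub_eq_add_neg,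
    Matrix.add_mul, Matrix.mul_add, smul_add, smul_neg]

theorem heis_commutator (K A : Op n) (s : ℝ) :
    heis K s (K * A - A * K) = K * heis K s A - heis K s A * K := by
  have h1 := (evolution_commute K s).eq
  have h2 := (evolution_commute K (-s)).eq
  simp only [heis, Matrix.mul_sub, Matrix.sub_mul, Matrix.mul_assoc]
  rw [h1, ← Matrix.mul_assoc, h2, Matrix.mul_assoc]

theorem hasDerivAt_pauliCoeff {A : ℝ → Op n} {A' : Op n} {s : ℝ} (h : HasDerivAt A A' s)
    (P : PauliString n) : HasDerivAt (fun s => pauliCoeff (A s) P) (pauliCoeff A' P) s :=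
  (LinearMap.toContinuousLinearMap ((pauliCoeffₗ P).restrictScalars ℝ)).hasFDerivAt.comp_hasDerivAt
    s h

theorem hasDerivAt_weightedCoeff {A : ℝ → Op n} {A' : Op n} {s : ℝ} (h : HasDerivAt A A' s)
    (μ : ℝ) : HasDerivAt (fun s => weightedCoeff μ (A s)) (weightedCoeff μ A') s :=
  (LinearMap.toContinuousLinearMap ((weightedCoeff μ).restrictScalars ℝ)).hasFDerivAt.comp_hasDerivAt
    s h

/-- Mean value inequality in the weighted norm. -/
theorem wnorm_sub_le_of_deriv {A A' : ℝ → Op n} {μ C T : ℝ}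
    (hA : ∀ s, HasDerivAt A (A' s) s) (hC : ∀ s ∈ Set.Ico 0 T, wnorm μ (A' s) ≤ C) (hT : 0 ≤ T) :
    wnorm μ (A T - A 0) ≤ C * T := by
  have := norm_image_sub_le_of_norm_deriv_le_segment' (f := fun s => weightedCoeff μ (A s))
    (f' := fun s => weightedCoeff μ (A' s)) (a := 0) (b := T) (C := C)
    (fun s _ => (hasDerivAt_weightedCoeff (hA s) μ).hasDerivWithinAt) hC T ⟨hT, le_rfl⟩
  rw [wnorm, map_sub]
  simpa using this

theorem pauliNorm_heis {K : Op n} (hK : K.IsHermitian) (s : ℝ) (A : Op n) :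
    pauliNorm (heis K s A) = pauliNorm A := by
  have : (heis K s A)ᴴ * heis K s A = evolution K (-s) * (Aᴴ * A) * evolution K s := by
    simp only [heis, Matrix.conjTranspose_mul, evolution_conjTranspose hK, neg_neg]
    simp only [Matrix.mul_assoc]
    rw [← Matrix.mul_assoc (evolution K s), evolution_mul_neg, Matrix.one_mul]
  rw [pauliNorm, pauliNorm, this, Matrix.trace_mul_comm, ← Matrix.mul_assoc, evolution_mul_neg,
    Matrix.one_mul]

/-! ### Contraction of the weighted norms under local evolution. -/

namespace LayeredHamiltonian

variable {H : LayeredHamiltonian n Γ}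

theorem combo_isHermitian (c : Fin H.numTerms → ℝ) : (H.combo c).IsHermitian := by
  rw [Matrix.IsHermitian, combo, Matrix.conjTranspose_sum]
  refine Finset.sum_congr rfl fun l _ => ?_
  rw [Matrix.conjTranspose_smul, PauliString.mat_conjTranspose]
  simp

theorem layerOp_isHermitian (γ : Fin Γ) : (H.layerOp γ).IsHermitian := by
  rw [layerOp_eq_combo]; exact combo_isHermitian _

/-- Bounds half the derivative of the squared weighted norm while the parameter falls at rate `κ`.
The falling weight contributes `-κ |P|`; by `sum_mul_sum_anti_le` the commutator contributes at most
`2 b Γ exp (μ k) |P|`. Both are linear in the weight, so a constant `κ` wins. -/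
theorem weighted_energy_deriv_le {k : ℕ} (hk : ∀ l, (H.pauli l).weight ≤ k)
    {c : Fin H.numTerms → ℝ} {b : ℝ} (hb : 0 ≤ b) (hc : ∀ l, |c l| ≤ b) {μ κ : ℝ} (hμ : 0 ≤ μ)
    (hκ : 2 * b * Γ * Real.exp (μ * k) ≤ κ) (A : Op n) :
    ∑ P, (-κ * P.weight * (Real.exp (μ * P.weight) * ‖pauliCoeff A P‖) ^ 2
      + (Real.exp (μ * P.weight) * ‖pauliCoeff A P‖) * (Real.exp (μ * P.weight)
        * ‖pauliCoeff (H.combo c * A - A * H.combo c) P‖)) ≤ 0 := by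
  set x : PauliString n → ℝ := fun P => Real.exp (μ * P.weight) * ‖pauliCoeff A P‖ with hx
  have hx0 : ∀ P, 0 ≤ x P := fun P => by positivity
  have h1 : ∑ P, x P * (Real.exp (μ * P.weight)
        * ‖pauliCoeff (H.combo c * A - A * H.combo c) P‖)
      ≤ ∑ P, 2 * b * Real.exp (μ * k) * (x P * ∑ l ∈ H.anti P, x ((H.pauli l).mul P)) := by
    refine Finset.sum_le_sum fun P _ => ?_
    refine (mul_le_mul_of_nonneg_left (exp_mul_norm_commutator_le hk hb hc hμ A P)
      (hx0 P)).trans (le_of_eq ?_)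
    rw [mul_left_comm]
  rw [← Finset.mul_sum] at h1
  have h2 := mul_le_mul_of_nonneg_left (H.sum_mul_sum_anti_le x)
    (show 0 ≤ 2 * b * Real.exp (μ * k) by positivity)
  have h3 : 0 ≤ ∑ P : PauliString n, P.weight * x P ^ 2 :=
    Finset.sum_nonneg fun P _ => by positivity
  have h4 : ∑ P, -κ * P.weight * x P ^ 2 = -κ * ∑ P : PauliString n, P.weight * x P ^ 2 := by
    rw [Finset.mul_sum]; exact Finset.sum_congr rfl fun P _ => by ring
  rw [Finset.sum_add_distrib, h4]
  nlinarith

/-- Evolution under a local Hamiltonian is a contraction between weighted norms, if the weight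
parameter decreases at a sufficient rate. -/
theorem wnorm_heis_combo_le {k : ℕ} (hk : ∀ l, (H.pauli l).weight ≤ k)
    {c : Fin H.numTerms → ℝ} {b : ℝ} (hb : 0 ≤ b) (hc : ∀ l, |c l| ≤ b) {μ κ T : ℝ}
    (hT : 0 ≤ T) (hμ : κ * T ≤ μ) (hκ : 2 * b * Γ * Real.exp (μ * k) ≤ κ) (A : Op n) :
    wnorm (μ - κ * T) (heis (H.combo c) T A) ≤ wnorm μ A := by
  have hκ0 : 0 ≤ κ := le_trans (by positivity) hκ
  set B : ℝ → Op n := fun s => heis (H.combo c) s A with hB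
  -- The squared weighted norm of the evolved operator at the current parameter `μ - κ s`; it is
  -- shown to be nonincreasing on `[0, T]`.
  set f : ℝ → ℝ := fun s => ∑ P : PauliString n,
    Real.exp (2 * ((μ - κ * s) * P.weight)) * ‖pauliCoeff (B s) P‖ ^ 2 with hf
  have hf2 : ∀ s, f s = wnorm (μ - κ * s) (B s) ^ 2 := by
    intro s
    rw [wnorm_sq]
    refine Finset.sum_congr rfl fun P _ => ?_
    rw [mul_pow, ← Real.exp_nat_mul]
    norm_cast
  have hder : ∀ s, ∃ f', HasDerivAt f f' s ∧ (s ∈ Set.Icc 0 T → f' ≤ 0) := by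
    intro s
    set B' := Complex.I • (H.combo c * B s - B s * H.combo c) with hB'
    have hBd : ∀ P, HasDerivAt (fun s => pauliCoeff (B s) P) (pauliCoeff B' P) s := by
      intro P
      refine hasDerivAt_pauliCoeff ?_ P
      have := hasDerivAt_heis (H.combo c) A s
      refine this.congr_deriv ?_
      rw [hB', hB, ← heis_commutator]
      simp [heis]
    refine ⟨_, HasDerivAt.fun_sum fun P _ => HasDerivAt.mul (HasDerivAt.exp
      ((((hasDerivAt_id s).const_mul κ).const_sub μ).mul_const (P.weight : ℝ) |>.const_mul 2))
      ((hBd P).norm_sq), fun hs => ?_⟩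
    have hμs : 0 ≤ μ - κ * s := by nlinarith [hs.2]
    -- The parameter has only fallen, so the rate fixed for `μ` remains sufficient.
    have hκs : 2 * b * Γ * Real.exp ((μ - κ * s) * k) ≤ κ := by
      refine le_trans ?_ hκ
      have : μ - κ * s ≤ μ := by nlinarith [hs.1]
      gcongr
    have hE := weighted_energy_deriv_le hk hb hc hμs hκs (B s)
    refine le_trans ?_ (by linarith : 2 * _ ≤ (0 : ℝ))
    rw [Finset.mul_sum]
    refine Finset.sum_le_sum fun P _ => ?_
    have h1 : inner ℝ (pauliCoeff (B s) P) (pauliCoeff B' P)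
        ≤ ‖pauliCoeff (B s) P‖ * ‖pauliCoeff (H.combo c * B s - B s * H.combo c) P‖ := by
      refine (real_inner_le_norm _ _).trans (le_of_eq ?_)
      rw [hB', pauliCoeff_smul, norm_mul, Complex.norm_I, one_mul]
    have h2 : Real.exp (2 * ((μ - κ * s) * P.weight))
        = Real.exp ((μ - κ * s) * P.weight) ^ 2 := by
      rw [← Real.exp_nat_mul]; norm_cast
    simp only [h2]
    have h3 := mul_le_mul_of_nonneg_left h1
      (by positivity : 0 ≤ Real.exp ((μ - κ * s) * P.weight) ^ 2)
    nlinarith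
  choose f' hf' hneg using hder
  have hanti : AntitoneOn f (Set.Icc 0 T) := by
    refine antitoneOn_of_deriv_nonpos (convex_Icc 0 T)
      (fun s _ => (hf' s).continuousAt.continuousWithinAt)
      (fun s _ => (hf' s).differentiableAt.differentiableWithinAt) fun s hs => ?_
    rw [(hf' s).deriv]
    exact hneg s (interior_subset hs)
  have h := hanti ⟨le_rfl, hT⟩ ⟨hT, le_rfl⟩ hT
  rw [hf2, hf2] at h
  have h0 : B 0 = A := heis_zero _ _
  rw [h0, mul_zero, sub_zero] at h
  exact (sq_le_sq₀ (wnorm_nonneg _ _) (wnorm_nonneg _ _)).1 h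

/-- Negative times are positive times for the coefficients `-c`, which obey the same bound. -/
theorem wnorm_heis_combo_le_abs {k : ℕ} (hk : ∀ l, (H.pauli l).weight ≤ k)
    {c : Fin H.numTerms → ℝ} {b : ℝ} (hb : 0 ≤ b) (hc : ∀ l, |c l| ≤ b) {μ ν κ s : ℝ}
    (hν : 0 ≤ ν) (hμ : ν + κ * |s| ≤ μ) (hκ : 2 * b * Γ * Real.exp (μ * k) ≤ κ) (A : Op n) :
    wnorm ν (heis (H.combo c) s A) ≤ wnorm μ A := by
  refine (wnorm_mono (show ν ≤ μ - κ * |s| by linarith) _).trans ?_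
  rcases le_total 0 s with hs | hs
  · have := wnorm_heis_combo_le hk hb hc (abs_nonneg s) (by linarith) hκ A
    rwa [abs_of_nonneg hs] at this ⊢
  · have := wnorm_heis_combo_le hk hb (c := fun l => -c l) (by simpa using hc) (abs_nonneg s)
      (by linarith) hκ A
    rw [abs_of_nonpos hs] at this ⊢
    rwa [combo_neg, heis_neg_left, neg_neg] at this

variable {kh : ℕ} {a : ℝ}

theorem wnorm_heis_op_le (hH : H.IsLocal kh a) {μ ν κ s : ℝ}
    (hν : 0 ≤ ν) (hμ : ν + κ * |s| ≤ μ) (hκ : 2 * |a| * Γ * Real.exp (μ * kh) ≤ κ) (A : Op n) :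
    wnorm ν (heis H.op s A) ≤ wnorm μ A := by
  rw [op_eq_combo]
  exact wnorm_heis_combo_le_abs (fun l => (hH l).1) (abs_nonneg a)
    (fun l => (hH l).2.trans (le_abs_self a)) hν hμ hκ A

theorem abs_layer_coeff_le (hH : H.IsLocal kh a) (γ : Fin Γ) (l : Fin H.numTerms) :
    |if H.layer l = γ then H.coeff l else 0| ≤ |a| := by
  split_ifs
  · exact (hH l).2.trans (le_abs_self a)
  · simp

theorem wnorm_heis_layerOp_le (hH : H.IsLocal kh a) (γ : Fin Γ) {μ ν κ s : ℝ}
    (hν : 0 ≤ ν) (hμ : ν + κ * |s| ≤ μ) (hκ : 2 * |a| * Γ * Real.exp (μ * kh) ≤ κ) (A : Op n) :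
    wnorm ν (heis (H.layerOp γ) s A) ≤ wnorm μ A := by
  rw [layerOp_eq_combo]
  exact wnorm_heis_combo_le_abs (fun l => (hH l).1) (abs_nonneg a)
    (abs_layer_coeff_le hH γ) hν hμ hκ A

theorem wnorm_commutator_layerOp_le (hH : H.IsLocal kh a) (γ : Fin Γ) {μ : ℝ} (hμ : 0 ≤ μ)
    (A : Op n) :
    wnorm μ (H.layerOp γ * A - A * H.layerOp γ)
      ≤ 2 * |a| * Γ * Real.exp (μ * kh) * (kh + 1) * wnorm (μ + 1) A := by
  rw [layerOp_eq_combo]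
  exact wnorm_commutator_le (fun l => (hH l).1) (abs_nonneg a) (abs_layer_coeff_le hH γ) hμ A

/-- A layer changes an operator by little in the weighted norm. -/
theorem wnorm_heis_layerOp_sub_le (hH : H.IsLocal kh a) (γ : Fin Γ) {μ ν κ s : ℝ}
    (hν : 0 ≤ ν) (hμ : ν + 1 + κ * |s| ≤ μ) (hκ : 2 * |a| * Γ * Real.exp (μ * kh) ≤ κ)
    (A : Op n) :
    wnorm ν (heis (H.layerOp γ) s A - A) ≤ κ * (kh + 1) * wnorm μ A * |s| := by
  have hκ0 : 0 ≤ κ := le_trans (by positivity) hκ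
  -- Both signs of the layer at nonnegative times, in order to cover negative `s`.
  have main : ∀ K : Op n, (K = H.layerOp γ ∨ K = -H.layerOp γ) → ∀ T : ℝ, 0 ≤ T → T ≤ |s| →
      wnorm ν (heis K T A - A) ≤ κ * (kh + 1) * wnorm μ A * T := by
    intro K hK T hT hTs
    have h := wnorm_sub_le_of_deriv (μ := ν) (T := T) (C := κ * (kh + 1) * wnorm μ A)
      (hasDerivAt_heis K A) (fun τ hτ => ?_) hT
    · rwa [heis_zero] at h
    · have hτ2 : |τ| ≤ |s| := by rw [abs_of_nonneg hτ.1]; exact hτ.2.le.trans hTs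
      have hκτ : κ * |τ| ≤ κ * |s| := by gcongr
      have e1 : Complex.I • (K * A - A * K) = Complex.I • (K * A - A * K) := rfl
      -- The derivative is an evolved commutator: the evolution uses at most `κ |s|` of the
      -- parameter and the commutator one more unit, which is the room between `ν` and `μ`.
      have e2 : wnorm ν (heis K τ (Complex.I • (K * A - A * K)))
          ≤ wnorm (μ - 1) (Complex.I • (H.layerOp γ * A - A * H.layerOp γ)) := by
        have hexp : 2 * |a| * Γ * Real.exp ((μ - 1) * kh) ≤ κ := by
          refine le_trans ?_ hκ
          gcongr
          linarith
        rcases hK with rfl | rfl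
        · exact wnorm_heis_layerOp_le hH γ hν (by linarith) hexp _
        · rw [heis_neg_left]
          refine (wnorm_heis_layerOp_le hH γ hν (by rw [abs_neg]; linarith) hexp _).trans
            (le_of_eq ?_)
          have : -H.layerOp γ * A - A * -H.layerOp γ
              = (-1 : ℂ) • (H.layerOp γ * A - A * H.layerOp γ) := by
            simp; abel
          rw [this, wnorm_smul, wnorm_smul, wnorm_smul]
          simp
      refine e2.trans ?_
      have hμ1 : 0 ≤ μ - 1 := by
        have := mul_nonneg hκ0 (abs_nonneg s)
        linarith
      rw [wnorm_smul, Complex.norm_I, one_mul]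
      refine (wnorm_commutator_layerOp_le hH γ hμ1 A).trans ?_
      rw [sub_add_cancel]
      have : 2 * |a| * Γ * Real.exp ((μ - 1) * kh) ≤ κ := by
        refine le_trans ?_ hκ
        gcongr
        linarith
      have h0 := wnorm_nonneg μ A
      gcongr
  rcases le_total 0 s with hs | hs
  · have := main _ (Or.inl rfl) |s| (abs_nonneg s) le_rfl
    rwa [abs_of_nonneg hs] at this ⊢
  · have := main _ (Or.inr rfl) |s| (abs_nonneg s) le_rfl
    rw [abs_of_nonpos hs] at this ⊢
    rwa [heis_neg_left, neg_neg] at this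

end LayeredHamiltonian

end LowWeightPauli
end

noncomputable section
namespace LowWeightPauli

variable {n Γ : ℕ}

open scoped Matrix.Norms.Operator

/-! ### Exact action of the rotations -/

theorem heis_add_right (K : Op n) (s : ℝ) (A B : Op n) :
    heis K s (A + B) = heis K s A + heis K s B := by
  simp [heis, Matrix.mul_add, Matrix.add_mul]

theorem heis_smul_right (K : Op n) (s : ℝ) (c : ℂ) (A : Op n) :
    heis K s (c • A) = c • heis K s A := by
  simp [heis]

theorem heis_zero_right (K : Op n) (s : ℝ) : heis K s 0 = 0 := by simp [heis]

theorem heis_sub_right (K : Op n) (s : ℝ) (A B : Op n) :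
    heis K s (A - B) = heis K s A - heis K s B := by
  simp [heis, Matrix.mul_sub, Matrix.sub_mul]

theorem heis_sum_right {ι : Type*} (K : Op n) (s : ℝ) (S : Finset ι) (A : ι → Op n) :
    heis K s (∑ i ∈ S, A i) = ∑ i ∈ S, heis K s (A i) := by
  simp [heis, Finset.mul_sum, Finset.sum_mul]

theorem heis_list_sum_right (K : Op n) (s : ℝ) (L : List (Op n)) :
    heis K s L.sum = (L.map (heis K s)).sum := by
  induction L with
  | nil => simp [heis_zero_right]
  | cons A L ih => simp [heis_add_right, ih]

theorem heis_of_commute {K A : Op n} (h : Commute K A) (s : ℝ) : heis K s A = A := by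
  have : Commute (evolution K s) A := by
    rw [evolution_eq]
    exact (h.smul_left _ |>.smul_left _).exp_left
  rw [heis, Matrix.mul_assoc, ← this.eq, ← Matrix.mul_assoc, evolution_neg_mul, Matrix.one_mul]

theorem evolution_add_left {K L : Op n} (h : Commute K L) (s : ℝ) :
    evolution (K + L) s = evolution K s * evolution L s := by
  simp only [evolution_eq]
  rw [smul_add, smul_add, Matrix.exp_add_of_commute]
  exact (h.smul_left _ |>.smul_left _).smul_right _ |>.smul_right _

theorem heis_add_left {K L : Op n} (h : Commute K L) (s : ℝ) (A : Op n) :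
    heis (K + L) s A = heis L s (heis K s A) := by
  have h2 : evolution (K + L) (-s) = evolution L (-s) * evolution K (-s) := by
    rw [add_comm, evolution_add_left h.symm]
  simp only [heis, h2, evolution_add_left h, Matrix.mul_assoc]

theorem heis_smul_left (K : Op n) (c s : ℝ) (A : Op n) :
    heis ((c : ℂ) • K) s A = heis K (c * s) A := by
  have : ∀ s : ℝ, evolution ((c : ℂ) • K) s = evolution K (c * s) := by
    intro s
    simp only [evolution, smul_smul]
    congr 2
    push_cast; ring
  rw [heis, heis, this, this, mul_neg]

/-- As `G² = 1`, the right side solves the differential equation of the evolution; its product with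
the inverse evolution is constant, with value 1 at zero. -/
theorem evolution_pauli (G : PauliString n) (s : ℝ) :
    evolution G.mat s
      = (Real.cos s : ℂ) • (1 : Op n) - (Complex.I * (Real.sin s : ℂ)) • G.mat := by
  set F : ℝ → Op n := fun s => evolution G.mat (-s) *
    ((Real.cos s : ℂ) • (1 : Op n) - (Complex.I * (Real.sin s : ℂ)) • G.mat) with hF
  have hc : ∀ s : ℝ, HasDerivAt (fun s : ℝ => (Real.cos s : ℂ)) (-(Real.sin s : ℂ)) s := by
    intro s
    simpa using (Real.hasDerivAt_cos s).ofReal_comp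
  have hs : ∀ s : ℝ, HasDerivAt (fun s : ℝ => Complex.I * (Real.sin s : ℂ))
      (Complex.I * (Real.cos s : ℂ)) s := by
    intro s
    exact (Real.hasDerivAt_sin s).ofReal_comp.const_mul Complex.I
  have h1 : ∀ s, HasDerivAt (fun s => evolution G.mat (-s))
      (evolution G.mat (-s) * (Complex.I • G.mat)) s := by
    intro s
    have := hasDerivAt_evolution (-G.mat) s
    rw [show evolution (-G.mat) = _ from funext (evolution_neg_left G.mat)] at this
    simpa using this
  have hd : ∀ s, HasDerivAt F 0 s := by
    intro s
    have := (h1 s).mul (((hc s).smul_const (1 : Op n)).sub ((hs s).smul_const G.mat))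
    refine this.congr_deriv ?_
    rw [Matrix.mul_assoc, ← Matrix.mul_add]
    convert Matrix.mul_zero (evolution G.mat (-s))
    simp only [Pi.sub_apply]
    rw [Matrix.mul_sub, Matrix.smul_mul, Matrix.smul_mul, Matrix.mul_smul, Matrix.mul_smul,
      PauliString.mat_mul_self, Matrix.mul_one, smul_smul, smul_smul, ← mul_assoc,
      Complex.I_mul_I]
    ext i j
    simp
    ring
  have h0 : F s = F 0 :=
    is_const_of_deriv_eq_zero (fun s => (hd s).differentiableAt) (fun s => (hd s).deriv) s 0
  have h00 : F 0 = 1 := by simp [hF, evolution_zero]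
  rw [h00] at h0
  have := congrArg (fun X => evolution G.mat s * X) h0
  simp only [hF, ← Matrix.mul_assoc, evolution_mul_neg, Matrix.one_mul, Matrix.mul_one] at this
  exact this.symm

theorem heis_pauli_of_anticommute {G P : PauliString n} (h : G.Anticommute P) (s : ℝ) :
    heis G.mat s P.mat = (Real.cos (2 * s) : ℂ) • P.mat
      + (Complex.I * (Real.sin (2 * s) : ℂ)) • (G.mat * P.mat) := by
  have hPG : P.mat * G.mat = -(G.mat * P.mat) := by
    rw [PauliString.mat_mul_mat_comm, if_pos h, neg_one_smul]
  have hGG : G.mat * (G.mat * P.mat) = P.mat := by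
    rw [← Matrix.mul_assoc, PauliString.mat_mul_self, Matrix.one_mul]
  rw [heis, evolution_pauli, evolution_pauli]
  simp only [Real.cos_neg, Real.sin_neg, Matrix.sub_mul, Matrix.mul_sub, Matrix.smul_mul,
    Matrix.mul_smul, Matrix.one_mul, Matrix.mul_one, Matrix.mul_assoc, hPG, Matrix.mul_neg, hGG,
    smul_sub, smul_smul, smul_neg]
  rw [Real.cos_two_mul', Real.sin_two_mul]
  ext i j
  simp
  ring_nf
  simp
  ring

/-! ### Tables of Pauli strings -/

theorem pauliTable_op_add (D E : PauliTable n) :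
    PauliTable.op (D + E) = PauliTable.op D + PauliTable.op E := by
  classical
  unfold PauliTable.op
  refine Finsupp.sum_add_index' (fun P => ?_) (fun P c d => ?_)
  · simp
  · simp [add_smul]

theorem pauliTable_op_single (P : PauliString n) (c : ℝ) :
    PauliTable.op (Finsupp.single P c) = (c : ℂ) • P.mat := by
  unfold PauliTable.op
  exact Finsupp.sum_single_index (by simp)

theorem pauliCoeff_op (D : PauliTable n) (P : PauliString n) :
    pauliCoeff D.op P = (D P : ℂ) := by
  unfold PauliTable.op Finsupp.sum
  rw [pauliCoeff_sum]
  simp only [pauliCoeff_smul, pauliCoeff_mat]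
  simp only [mul_ite, mul_one, mul_zero]
  rw [Finset.sum_ite_eq]
  split_ifs with h
  · rfl
  · rw [Finsupp.notMem_support_iff.1 h, Complex.ofReal_zero]

/-- The operator of a list of terms. -/
def listOp (xs : List (PauliString n × ℝ)) : Op n := (xs.map fun y => (y.2 : ℂ) • y.1.mat).sum

theorem listOp_nil : listOp ([] : List (PauliString n × ℝ)) = 0 := rfl

theorem listOp_cons (x : PauliString n × ℝ) (xs : List (PauliString n × ℝ)) :
    listOp (x :: xs) = (x.2 : ℂ) • x.1.mat + listOp xs := by simp [listOp]

theorem listOp_flatten (xs : List (List (PauliString n × ℝ))) :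
    listOp xs.flatten = (xs.map listOp).sum := by
  induction xs with
  | nil => rfl
  | cons x xs ih =>
    rw [List.flatten_cons, listOp, List.map_append, List.sum_append, List.map_cons, List.sum_cons,
      ← ih]
    rfl

theorem op_sum_single (xs : List (PauliString n × ℝ)) :
    PauliTable.op (xs.map fun y => Finsupp.single y.1 y.2).sum = listOp xs := by
  induction xs with
  | nil => simp [listOp, PauliTable.op]
  | cons x xs ih =>
    rw [List.map_cons, List.sum_cons, pauliTable_op_add, pauliTable_op_single, ih, listOp_cons]

theorem listOp_rotate (G : PauliString n) (θ : ℝ) (x : PauliString n × ℝ) :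
    listOp (rotate G θ x) = heis G.mat θ ((x.2 : ℂ) • x.1.mat) := by
  rw [heis_smul_right, rotate]
  split_ifs with h
  · rw [heis_pauli_of_anticommute h, listOp_cons, listOp_cons, listOp_nil, add_zero, smul_add,
      smul_smul, smul_smul, PauliString.mat_mul_mat, smul_smul]
    congr 1
    · push_cast; rfl
    · congr 1
      obtain ⟨k, hk⟩ := (PauliString.odd_phase_iff G x.1).2 h
      -- The phase exponent of an anticommuting pair is odd, so this power of `i` is `±1` and the
      -- real part taken in `rotate` loses nothing.
      have e : Complex.I ^ (G.phase x.1 + 1) = (((-1 : ℝ) ^ (k + 1) : ℝ) : ℂ) := by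
        rw [hk, show 2 * k + 1 + 1 = 2 * (k + 1) by ring, pow_mul, Complex.I_sq]
        push_cast; rfl
      have e2 : Complex.I * Complex.I ^ G.phase x.1 = (((-1 : ℝ) ^ (k + 1) : ℝ) : ℂ) := by
        rw [← e, pow_succ]; ring
      rw [e, Complex.ofReal_re]
      calc ((x.2 * (Real.sin (2 * θ) * (-1) ^ (k + 1)) : ℝ) : ℂ)
          = x.2 * (Real.sin (2 * θ) * (((-1 : ℝ) ^ (k + 1) : ℝ) : ℂ)) := by push_cast; ring
        _ = _ := by rw [← e2]; ring
  · rw [heis_of_commute (PauliString.commute_of_not_anticommute h), listOp_cons, listOp_nil,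
      add_zero]

open Costed

theorem forEach_val {α β : Type} (f : α → Costed β) (xs : List α) :
    (forEach f xs).val = xs.map fun x => (f x).val := by
  induction xs with
  | nil => rfl
  | cons x xs ih => rw [List.map_cons, ← ih]; rfl

theorem spread_cons_val (g : PauliString n × ℝ) (gs : List (PauliString n × ℝ))
    (x : PauliString n × ℝ) :
    (spread (g :: gs) x).val = ((rotate g.1 g.2 x).map fun y => (spread gs y).val).flatten := by
  rw [← forEach_val]; rfl

theorem heis_listOp {K : Op n} {s : ℝ} (xs : List (PauliString n × ℝ)) :
    (xs.map fun y => heis K s ((y.2 : ℂ) • y.1.mat)).sum = heis K s (listOp xs) := by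
  rw [listOp, heis_list_sum_right, List.map_map]; rfl

theorem commute_listOp {A : Op n} {gs : List (PauliString n × ℝ)}
    (h : ∀ g ∈ gs, Commute A g.1.mat) : Commute A (listOp gs) := by
  induction gs with
  | nil => exact Commute.zero_right _
  | cons g gs ih =>
    rw [listOp_cons]
    exact ((h g (by simp)).smul_right _).add_right (ih fun g' hg' => h g' (by simp [hg']))

/-- The generators commute, so the evolution under their sum factors into the successive rotations.
-/
theorem listOp_spread (gs : List (PauliString n × ℝ))
    (hgs : gs.Pairwise fun g g' => Commute g.1.mat g'.1.mat) (x : PauliString n × ℝ) :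
    listOp (spread gs x).val = heis (listOp gs) 1 ((x.2 : ℂ) • x.1.mat) := by
  induction gs generalizing x with
  | nil =>
    rw [listOp_nil, heis_of_commute (Commute.zero_left _)]
    change listOp [x] = _
    rw [listOp_cons, listOp_nil, add_zero]
  | cons g gs ih =>
    rw [List.pairwise_cons] at hgs
    rw [spread_cons_val, listOp_flatten, List.map_map, listOp_cons,
      heis_add_left ((commute_listOp hgs.1).smul_left _), heis_smul_left, mul_one,
      ← listOp_rotate, ← heis_listOp]
    congr 1
    exact List.map_congr_left fun y _ => ih hgs.2 y

/-! ### The action of a layer on a Pauli string. -/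

namespace LayeredHamiltonian

variable (H : LayeredHamiltonian n Γ)

theorem commute_of_layer_eq {l l' : Fin H.numTerms} (h : H.layer l = H.layer l') :
    Commute (H.pauli l).mat (H.pauli l').mat := by
  by_cases e : l = l'
  · rw [e]
  · exact PauliString.commute_of_not_anticommute
      (PauliString.not_anticommute_of_disjoint (H.disjoint l l' e h))

theorem listOp_touching (γ : Fin Γ) (s : ℝ) (P : PauliString n) :
    listOp (touching H γ s P) = ∑ l ∈ Finset.univ.filter (fun l => H.layer l = γ ∧
      ¬ Disjoint (H.pauli l).supp P.supp), ((H.coeff l * s : ℝ) : ℂ) • (H.pauli l).mat := by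
  rw [listOp, touching, List.map_map]
  rw [← List.sum_toFinset]
  · refine Finset.sum_congr ?_ fun _ _ => rfl
    ext l; simp
  · exact (List.nodup_finRange _).filter _

/-- The terms that miss the support of `P` commute with `P` and with the other terms of the layer,
so they drop out. -/
theorem heis_layerOp_single (γ : Fin Γ) (s : ℝ) (P : PauliString n) (c : ℝ) :
    heis (H.layerOp γ) s ((c : ℂ) • P.mat) = listOp (spread (touching H γ s P) (P, c)).val := by
  rw [listOp_spread]
  · set R : Op n := ∑ l ∈ Finset.univ.filter (fun l => H.layer l = γ ∧
      Disjoint (H.pauli l).supp P.supp), ((H.coeff l * s : ℝ) : ℂ) • (H.pauli l).mat with hR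
    have hsplit : (s : ℂ) • H.layerOp γ = R + listOp (touching H γ s P) := by
      rw [listOp_touching, hR, layerOp, Finset.smul_sum]
      rw [← Finset.sum_filter_add_sum_filter_not _ fun l => Disjoint (H.pauli l).supp P.supp,
        Finset.filter_filter, Finset.filter_filter]
      congr 1 <;>
      · refine Finset.sum_congr rfl fun l _ => ?_
        rw [smul_smul]; push_cast; rw [mul_comm]
    have hcomm : Commute R (listOp (touching H γ s P)) := by
      rw [listOp_touching, hR]
      refine Commute.sum_left _ _ _ fun l hl => Commute.sum_right _ _ _ fun l' hl' => ?_
      refine Commute.smul_left (Commute.smul_right (H.commute_of_layer_eq ?_) _) _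
      rw [(Finset.mem_filter.1 hl).2.1, (Finset.mem_filter.1 hl').2.1]
    have hRP : Commute R ((c : ℂ) • P.mat) := by
      refine Commute.smul_right (Commute.sum_left _ _ _ fun l hl => Commute.smul_left ?_ _) _
      exact PauliString.commute_of_not_anticommute
        (PauliString.not_anticommute_of_disjoint (Finset.mem_filter.1 hl).2.2)
    have h1 := heis_smul_left (H.layerOp γ) s 1 ((c : ℂ) • P.mat)
    rw [mul_one] at h1
    rw [← h1, hsplit, heis_add_left hcomm, heis_of_commute hRP]
  · rw [touching, List.pairwise_map]
    refine List.Pairwise.imp_of_mem ?_ ((List.nodup_finRange _).filter _)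
    intro l l' hl hl' _
    refine H.commute_of_layer_eq ?_
    simp only [List.mem_filter, decide_eq_true_eq] at hl hl'
    rw [hl.2.1, hl'.2.1]

end LayeredHamiltonian

/-- The blocks of terms that a layer makes out of the terms of a table. -/
def layerBlocks (H : LayeredHamiltonian n Γ) (x : Fin Γ × ℝ) (D : PauliTable n) :
    List (List (PauliString n × ℝ)) :=
  D.support.toList.map fun P => (spread (touching H x.1 x.2 P) (P, D P)).val

theorem applyLayer_val (H : LayeredHamiltonian n Γ) (x : Fin Γ × ℝ) (D : PauliTable n) :
    (applyLayer H x D).val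
      = ((layerBlocks H x D).flatten.map fun y => Finsupp.single y.1 y.2).sum := by
  have : layerBlocks H x D = (forEach (fun P => do
      tick (1 + P.weight)
      spread (touching H x.1 x.2 P) (P, D P)) D.support.toList).val := by
    rw [forEach_val]; rfl
  rw [this]; rfl

theorem op_applyLayer (H : LayeredHamiltonian n Γ) (x : Fin Γ × ℝ) (D : PauliTable n) :
    PauliTable.op (applyLayer H x D).val = heis (H.layerOp x.1) x.2 (PauliTable.op D) := by
  rw [applyLayer_val, op_sum_single, listOp_flatten, layerBlocks, List.map_map]
  rw [show PauliTable.op D = ∑ P ∈ D.support, (D P : ℂ) • P.mat from rfl, heis_sum_right,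
    ← Finset.sum_map_toList]
  congr 1
  refine List.map_congr_left fun P _ => ?_
  rw [H.heis_layerOp_single]; rfl

/-- Heisenberg evolution through a list of layers. -/
def heisLayers (H : LayeredHamiltonian n Γ) : List (Fin Γ × ℝ) → Op n → Op n
  | [], A => A
  | x :: xs, A => heisLayers H xs (heis (H.layerOp x.1) x.2 A)

theorem op_applyLayers (H : LayeredHamiltonian n Γ) (xs : List (Fin Γ × ℝ)) (D : PauliTable n) :
    PauliTable.op (applyLayers H xs D).val = heisLayers H xs (PauliTable.op D) := by
  induction xs generalizing D with
  | nil => rfl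
  | cons x xs ih =>
    change PauliTable.op (applyLayers H xs (applyLayer H x D).val).val = _
    rw [ih, op_applyLayer]; rfl

/-- The product of the evolutions of a list of layers. -/
def layersProd (H : LayeredHamiltonian n Γ) (xs : List (Fin Γ × ℝ)) : Op n :=
  (xs.map fun x => evolution (H.layerOp x.1) x.2).prod

theorem layersProd_cons (H : LayeredHamiltonian n Γ) (x : Fin Γ × ℝ) (xs : List (Fin Γ × ℝ)) :
    layersProd H (x :: xs) = evolution (H.layerOp x.1) x.2 * layersProd H xs := by
  simp [layersProd]

theorem heisLayers_eq (H : LayeredHamiltonian n Γ) (xs : List (Fin Γ × ℝ)) (A : Op n) :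
    heisLayers H xs A = (layersProd H xs)ᴴ * A * layersProd H xs := by
  induction xs generalizing A with
  | nil => simp [heisLayers, layersProd]
  | cons x xs ih =>
    rw [heisLayers, ih, layersProd_cons, Matrix.conjTranspose_mul,
      evolution_conjTranspose (LayeredHamiltonian.layerOp_isHermitian _), heis]
    simp only [Matrix.mul_assoc]

theorem pauliNorm_heisLayers (H : LayeredHamiltonian n Γ) (xs : List (Fin Γ × ℝ)) (A : Op n) :
    pauliNorm (heisLayers H xs A) = pauliNorm A := by
  induction xs generalizing A with
  | nil => rfl
  | cons x xs ih =>
    rw [heisLayers, ih, pauliNorm_heis (LayeredHamiltonian.layerOp_isHermitian _)]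

theorem heisLayers_sub (H : LayeredHamiltonian n Γ) (xs : List (Fin Γ × ℝ)) (A B : Op n) :
    heisLayers H xs (A - B) = heisLayers H xs A - heisLayers H xs B := by
  induction xs generalizing A B with
  | nil => rfl
  | cons x xs ih => simp only [heisLayers, heis_sub_right, ih]

/-- `r` rounds of Trotter evolution of an operator. -/
theorem trotterOp_eq_iterate (H : LayeredHamiltonian n Γ) (O : PauliTable n) (p : ℕ) (t : ℝ)
    (r : ℕ) :
    trotterOp H O p t r = (heisLayers H (trotterFactors Γ p (t / r)))^[r] O.op := by
  have : ∀ m : ℕ, (heisLayers H (trotterFactors Γ p (t / r)))^[m] O.op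
      = (trotter H p (t / r))ᴴ ^ m * O.op * trotter H p (t / r) ^ m := by
    intro m
    induction m with
    | zero => simp
    | succ m ih =>
      rw [Function.iterate_succ_apply', ih, heisLayers_eq]
      change (trotter H p (t / r))ᴴ * _ * trotter H p (t / r) = _
      rw [pow_succ, pow_succ']
      rw [(Commute.refl ((trotter H p (t / r))ᴴ)).pow_left m |>.eq]
      rw [(Commute.refl (trotter H p (t / r))).pow_right m |>.eq]
      simp only [Matrix.mul_assoc]
  rw [this]; rfl

theorem pauliCoeff_truncate (w : ℕ) (D : PauliTable n) (P : PauliString n) :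
    pauliCoeff (PauliTable.op (truncate w D).val) P
      = if P.weight ≤ w then pauliCoeff (PauliTable.op D) P else 0 := by
  rw [pauliCoeff_op, pauliCoeff_op]
  change ((D.filter fun P => P.weight ≤ w) P : ℂ) = _
  rw [Finsupp.filter_apply]
  split_ifs <;> simp

theorem lpdEvolve_succ_val (H : LayeredHamiltonian n Γ) (p : ℕ) (s : ℝ) (w d : ℕ)
    (D : PauliTable n) :
    (lpdEvolve H p s w (d + 1) D).val
      = (truncate w (applyLayers H (trotterFactors Γ p s) (lpdEvolve H p s w d D).val).val).val :=
  rfl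

theorem pauliCoeff_lpdEvolve_succ (H : LayeredHamiltonian n Γ) (p : ℕ) (s : ℝ) (w d : ℕ)
    (D : PauliTable n) (P : PauliString n) :
    pauliCoeff (PauliTable.op (lpdEvolve H p s w (d + 1) D).val) P
      = if P.weight ≤ w then pauliCoeff (heisLayers H (trotterFactors Γ p s)
        (PauliTable.op (lpdEvolve H p s w d D).val)) P else 0 := by
  rw [lpdEvolve_succ_val, pauliCoeff_truncate, op_applyLayers]

/-- Density matrix and Pauli strings are Hermitian, so the Pauli expectation values are real and the
real parts summed by the program give the full trace. -/
theorem lpd_val (H : LayeredHamiltonian n Γ) (O : PauliTable n) (ψ : Bits (Fin n) → ℂ)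
    (p : ℕ) (t : ℝ) (r w : ℕ) :
    ((lpd H O ψ p t r w).val : ℂ) = (density ψ * truncatedOp H O p t r w).trace := by
  have hreal : ∀ P : PauliString n,
      (((density ψ * P.mat).trace.re : ℝ) : ℂ) = (density ψ * P.mat).trace := by
    intro P
    rw [← Complex.conj_eq_iff_re, ← Complex.star_def, ← Matrix.trace_conjTranspose,
      Matrix.conjTranspose_mul, PauliString.mat_conjTranspose, Matrix.trace_mul_comm]
    congr 2
    ext i j
    simp [density, Matrix.vecMulVec_apply, mul_comm]
  change (((lpdEvolve H p (t / r) w r O).val.sum fun P c =>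
    c * ((density ψ * P.mat).trace).re : ℝ) : ℂ) = _
  rw [truncatedOp, PauliTable.op, Finsupp.sum, Finsupp.sum, Finset.mul_sum, Matrix.trace_sum]
  push_cast
  refine Finset.sum_congr rfl fun P _ => ?_
  rw [hreal, Matrix.mul_smul, Matrix.trace_smul, smul_eq_mul]

end LowWeightPauli
end

noncomputable section
namespace LowWeightPauli

variable {n Γ : ℕ}

open Costed

/-! ### Cost of the algorithm -/

namespace Costed

theorem forEach_time_le {α β : Type} (f : α → Costed β) (xs : List α) (k : ℕ)
    (h : ∀ x ∈ xs, (f x).time ≤ k) : (forEach f xs).time ≤ xs.length * k := by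
  induction xs with
  | nil => exact Nat.zero_le _
  | cons x xs ih =>
    have h1 := h x (by simp)
    have h2 := ih fun y hy => h y (by simp [hy])
    change (f x).time + ((forEach f xs).time + 0) ≤ _
    rw [List.length_cons, add_mul]
    omega

theorem forEach_space_le {α β : Type} (f : α → Costed β) (xs : List α) (k : ℕ)
    (h : ∀ x ∈ xs, (f x).space ≤ k) : (forEach f xs).space ≤ k := by
  induction xs with
  | nil => exact Nat.zero_le _
  | cons x xs ih =>
    change max (f x).space (max (forEach f xs).space 0) ≤ _
    have := ih fun y hy => h y (by simp [hy])
    have := h x (by simp)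
    omega

end Costed

theorem length_flatten_le {α : Type*} (xs : List (List α)) (k : ℕ)
    (h : ∀ x ∈ xs, x.length ≤ k) : xs.flatten.length ≤ xs.length * k := by
  rw [List.length_flatten]
  refine (List.sum_le_card_nsmul _ k ?_).trans ?_
  · simpa using h
  · simp

theorem rotate_length_le (G : PauliString n) (θ : ℝ) (x : PauliString n × ℝ) :
    (rotate G θ x).length ≤ 2 := by
  rw [rotate]; split_ifs <;> simp

theorem weight_of_mem_rotate {G : PauliString n} {θ : ℝ} {x y : PauliString n × ℝ}
    (h : y ∈ rotate G θ x) : y.1.weight ≤ G.weight + x.1.weight := by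
  rw [rotate] at h
  split_ifs at h
  · simp only [List.mem_cons, List.not_mem_nil, or_false] at h
    rcases h with rfl | rfl
    · exact Nat.le_add_left _ _
    · exact PauliString.weight_mul_le _ _
  · simp only [List.mem_cons, List.not_mem_nil, or_false] at h
    rw [h]; exact Nat.le_add_left _ _

theorem spread_length_le (gs : List (PauliString n × ℝ)) (x : PauliString n × ℝ) :
    (spread gs x).val.length ≤ 2 ^ gs.length := by
  induction gs generalizing x with
  | nil => exact le_rfl
  | cons g gs ih =>
    rw [spread_cons_val]
    refine (length_flatten_le _ (2 ^ gs.length) ?_).trans ?_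
    · intro y hy
      obtain ⟨z, -, rfl⟩ := List.mem_map.1 hy
      exact ih z
    · rw [List.length_map, List.length_cons, pow_succ, mul_comm]
      exact Nat.mul_le_mul_left _ (rotate_length_le _ _ _)

/-- Strictness closes the induction: `1 + 2 (2 ^ m - 1) < 2 ^ (m + 1)`. -/
theorem spread_time_lt (gs : List (PauliString n × ℝ)) (x : PauliString n × ℝ) :
    (spread gs x).time < 2 ^ gs.length := by
  induction gs generalizing x with
  | nil => exact Nat.one_pos
  | cons g gs ih =>
    change 1 + ((forEach (spread gs) (rotate g.1 g.2 x)).time + 0) < _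
    have h1 := forEach_time_le (spread gs) (rotate g.1 g.2 x) (2 ^ gs.length - 1)
      fun y _ => Nat.le_sub_one_of_lt (ih y)
    have h2 := Nat.mul_le_mul_right (2 ^ gs.length - 1) (rotate_length_le g.1 g.2 x)
    have h3 : 0 < 2 ^ gs.length := by positivity
    rw [List.length_cons, pow_succ]
    omega

theorem spread_space_eq (gs : List (PauliString n × ℝ)) (x : PauliString n × ℝ) :
    (spread gs x).space = 0 := by
  induction gs generalizing x with
  | nil => rfl
  | cons g gs ih =>
    change max 0 (max (forEach (spread gs) (rotate g.1 g.2 x)).space 0) = _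
    have h1 := forEach_space_le (spread gs) (rotate g.1 g.2 x) 0 fun y _ => (ih y).le
    omega

theorem weight_of_mem_spread {k : ℕ} (gs : List (PauliString n × ℝ))
    (hk : ∀ g ∈ gs, g.1.weight ≤ k) {x y : PauliString n × ℝ} (h : y ∈ (spread gs x).val) :
    y.1.weight ≤ gs.length * k + x.1.weight := by
  induction gs generalizing x with
  | nil =>
    have : y ∈ [x] := h
    simp only [List.mem_cons, List.not_mem_nil, or_false] at this
    simp [this]
  | cons g gs ih =>
    rw [spread_cons_val, List.mem_flatten] at h
    obtain ⟨l, hl, hy⟩ := h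
    obtain ⟨z, hz, rfl⟩ := List.mem_map.1 hl
    have h1 := ih (fun g' hg' => hk g' (by simp [hg'])) hy
    have h2 := weight_of_mem_rotate hz
    have h3 := hk g (by simp)
    rw [List.length_cons, add_mul]
    omega

variable (H : LayeredHamiltonian n Γ) {kh : ℕ} {a : ℝ}

theorem touching_length_le (γ : Fin Γ) (s : ℝ) (P : PauliString n) :
    (touching H γ s P).length ≤ P.weight := by
  rw [touching, List.length_map,
    ← List.toFinset_card_of_nodup ((List.nodup_finRange _).filter _)]
  refine le_trans (Finset.card_le_card ?_) (H.card_touching_le γ P)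
  intro l hl
  simpa using hl

variable {H}

theorem weight_of_mem_touching (hH : H.IsLocal kh a) {γ : Fin Γ} {s : ℝ} {P : PauliString n}
    {g : PauliString n × ℝ} (hg : g ∈ touching H γ s P) : g.1.weight ≤ kh := by
  obtain ⟨l, -, rfl⟩ := List.mem_map.1 hg
  exact (hH l).1

theorem layerBlocks_length_le (x : Fin Γ × ℝ) {D : PauliTable n} {m : ℕ}
    (hD : ∀ P ∈ D.support, P.weight ≤ m) :
    (layerBlocks H x D).flatten.length ≤ D.support.card * 2 ^ m := by
  refine (length_flatten_le _ (2 ^ m) ?_).trans (by simp [layerBlocks])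
  intro l hl
  obtain ⟨P, hP, rfl⟩ := List.mem_map.1 hl
  refine (spread_length_le _ _).trans (Nat.pow_le_pow_right two_pos ?_)
  exact (touching_length_le H _ _ _).trans (hD P (by simpa using hP))

theorem support_sum_single_subset (xs : List (PauliString n × ℝ)) :
    (xs.map fun y => Finsupp.single y.1 y.2).sum.support
      ⊆ (xs.map Prod.fst).toFinset := by
  classical
  induction xs with
  | nil => simp
  | cons x xs ih =>
    rw [List.map_cons, List.sum_cons, List.map_cons, List.toFinset_cons]
    refine Finsupp.support_add.trans (Finset.union_subset ?_ ?_)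
    · exact Finsupp.support_single_subset.trans (by simp)
    · exact ih.trans (Finset.subset_insert _ _)

theorem applyLayer_support_card_le (x : Fin Γ × ℝ) {D : PauliTable n} {m : ℕ}
    (hD : ∀ P ∈ D.support, P.weight ≤ m) :
    (applyLayer H x D).val.support.card ≤ D.support.card * 2 ^ m := by
  rw [applyLayer_val]
  refine (Finset.card_le_card (support_sum_single_subset _)).trans ?_
  refine (List.toFinset_card_le _).trans ?_
  rw [List.length_map]
  exact layerBlocks_length_le x hD

theorem applyLayer_weight_le (hH : H.IsLocal kh a) (x : Fin Γ × ℝ) {D : PauliTable n} {m : ℕ}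
    (hD : ∀ P ∈ D.support, P.weight ≤ m) {P : PauliString n}
    (hP : P ∈ (applyLayer H x D).val.support) : P.weight ≤ m * (kh + 1) := by
  rw [applyLayer_val] at hP
  have := support_sum_single_subset _ hP
  rw [List.mem_toFinset, List.mem_map] at this
  obtain ⟨y, hy, rfl⟩ := this
  rw [List.mem_flatten] at hy
  obtain ⟨l, hl, hy⟩ := hy
  obtain ⟨Q, hQ, rfl⟩ := List.mem_map.1 hl
  have h1 := weight_of_mem_spread _ (fun g hg => weight_of_mem_touching hH hg) hy
  have h2 := touching_length_le H x.1 x.2 Q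
  have h3 := hD Q (by simpa using hQ)
  have h4 := Nat.mul_le_mul_right kh (h2.trans h3)
  rw [mul_add, mul_one]
  exact h1.trans (Nat.add_le_add h4 h3)

theorem applyLayer_time_le (x : Fin Γ × ℝ) {D : PauliTable n} {m : ℕ}
    (hD : ∀ P ∈ D.support, P.weight ≤ m) :
    (applyLayer H x D).time ≤ 3 * (D.support.card * 2 ^ m) := by
  set f : PauliString n → Costed (List (PauliString n × ℝ)) := fun P => do
      tick (1 + P.weight)
      spread (touching H x.1 x.2 P) (P, D P) with hf
  have hblocks : (forEach f D.support.toList).val = layerBlocks H x D := by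
    rw [forEach_val]; rfl
  have e : (applyLayer H x D).time = (forEach f D.support.toList).time
      + ((forEach f D.support.toList).val.flatten.length + (0 + 0)) := rfl
  have h1 := layerBlocks_length_le (H := H) x hD
  have h2 := forEach_time_le f D.support.toList (2 * 2 ^ m) (by
    intro P hP
    have hPm := hD P (by simpa using hP)
    have h3 := spread_time_lt (touching H x.1 x.2 P) (P, D P)
    have h4 : 2 ^ (touching H x.1 x.2 P).length ≤ 2 ^ m :=
      Nat.pow_le_pow_right two_pos ((touching_length_le H _ _ _).trans hPm)
    have h5 : m < 2 ^ m := Nat.lt_two_pow_self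
    change (1 + P.weight) + (spread (touching H x.1 x.2 P) (P, D P)).time ≤ _
    omega)
  rw [Finset.length_toList] at h2
  rw [e, hblocks]
  have : D.support.card * (2 * 2 ^ m) = 2 * (D.support.card * 2 ^ m) := by ring
  omega

theorem applyLayer_space_le (x : Fin Γ × ℝ) {D : PauliTable n} {m : ℕ}
    (hD : ∀ P ∈ D.support, P.weight ≤ m) :
    (applyLayer H x D).space ≤ 2 * (D.support.card * 2 ^ m) := by
  set f : PauliString n → Costed (List (PauliString n × ℝ)) := fun P => do
      tick (1 + P.weight)
      spread (touching H x.1 x.2 P) (P, D P) with hf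
  have hblocks : (forEach f D.support.toList).val = layerBlocks H x D := by
    rw [forEach_val]; rfl
  have e : (applyLayer H x D).space = max (forEach f D.support.toList).space
      (max 0 (max (D.support.card + (forEach f D.support.toList).val.flatten.length) 0)) := rfl
  have h1 := layerBlocks_length_le (H := H) x hD
  have h2 := forEach_space_le f D.support.toList 0 (by
    intro P hP
    change max 0 (spread (touching H x.1 x.2 P) (P, D P)).space ≤ 0
    rw [spread_space_eq]; rfl)
  have h3 : D.support.card ≤ D.support.card * 2 ^ m :=
    Nat.le_mul_of_pos_right _ (by positivity)
  rw [e, hblocks]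
  omega

/-- Each layer multiplies the weight bound by `kh + 1` and the number of terms by at most 2 to the
power of the current weight bound; the last weight bound dominates all these exponents. Since
nothing is truncated here, the bound is useful only for a fixed number of layers. -/
theorem applyLayers_cost (hH : H.IsLocal kh a) (xs : List (Fin Γ × ℝ)) (D : PauliTable n)
    (m N : ℕ) (hD : ∀ P ∈ D.support, P.weight ≤ m) (hN : D.support.card ≤ N) :
    (applyLayers H xs D).val.support.card
        ≤ N * 2 ^ (xs.length * (m * (kh + 1) ^ xs.length)) ∧
      (applyLayers H xs D).time
        ≤ 3 * xs.length * (N * 2 ^ (xs.length * (m * (kh + 1) ^ xs.length))) ∧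
      (applyLayers H xs D).space
        ≤ 2 * (N * 2 ^ (xs.length * (m * (kh + 1) ^ xs.length))) := by
  induction xs generalizing D m N with
  | nil =>
    refine ⟨?_, Nat.zero_le _, Nat.zero_le _⟩
    change D.support.card ≤ _
    simpa using hN
  | cons x xs ih =>
    set L := xs.length with hL
    set M := m * (kh + 1) ^ (L + 1) with hM
    have hmM : m ≤ M := Nat.le_mul_of_pos_right _ (by positivity)
    have hM' : m * (kh + 1) * (kh + 1) ^ L = M := by rw [hM, pow_succ']; ring
    have h2m : 2 ^ m ≤ 2 ^ M := Nat.pow_le_pow_right two_pos hmM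
    obtain ⟨i1, i2, i3⟩ := ih (applyLayer H x D).val (m * (kh + 1)) (N * 2 ^ m)
      (fun P hP => applyLayer_weight_le hH x hD hP)
      ((applyLayer_support_card_le x hD).trans (Nat.mul_le_mul_right _ hN))
    rw [hM'] at i1 i2 i3
    have hbig : N * 2 ^ m * 2 ^ (L * M) ≤ N * 2 ^ ((L + 1) * M) := by
      rw [mul_assoc, ← pow_add]
      refine Nat.mul_le_mul_left _ (Nat.pow_le_pow_right two_pos ?_)
      rw [add_mul]; omega
    have hsmall : D.support.card * 2 ^ m ≤ N * 2 ^ ((L + 1) * M) := by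
      refine Nat.mul_le_mul hN (Nat.pow_le_pow_right two_pos (hmM.trans ?_))
      exact Nat.le_mul_of_pos_left _ (Nat.succ_pos _)
    rw [List.length_cons]
    refine ⟨i1.trans hbig, ?_, ?_⟩
    · change (applyLayer H x D).time + (applyLayers H xs (applyLayer H x D).val).time ≤ _
      have j1 := applyLayer_time_le (H := H) x hD
      have j2 := i2.trans (Nat.mul_le_mul_left _ hbig)
      calc _ ≤ 3 * (N * 2 ^ ((L + 1) * M)) + 3 * L * (N * 2 ^ ((L + 1) * M)) :=
            Nat.add_le_add (j1.trans (Nat.mul_le_mul_left _ hsmall)) j2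
        _ = _ := by ring
    · change max (applyLayer H x D).space (applyLayers H xs (applyLayer H x D).val).space ≤ _
      exact max_le ((applyLayer_space_le x hD).trans (Nat.mul_le_mul_left _ hsmall))
        (i3.trans (Nat.mul_le_mul_left _ hbig))

/-- The Pauli strings of weight at most `w`. -/
def lowWeight (n w : ℕ) : Finset (PauliString n) := Finset.univ.filter fun P => P.weight ≤ w

/-- A string of weight at most `w + 1` arises from one of weight at most `w` by rewriting one
letter, with `4 n` choices of qubit and letter. -/
theorem card_lowWeight_le (hn : 1 ≤ n) (w : ℕ) : (lowWeight n w).card ≤ (4 * n) ^ w := by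
  induction w with
  | zero =>
    rw [pow_zero, Finset.card_le_one]
    have : ∀ P ∈ lowWeight n 0, P = fun _ => Letter.I := by
      intro P hP
      have h0 : P.supp = ∅ := by simpa [lowWeight, PauliString.weight] using hP
      funext q
      by_contra h
      exact Finset.notMem_empty q (h0 ▸ PauliString.mem_supp.2 h)
    intro P hP Q hQ
    rw [this P hP, this Q hQ]
  | succ w ih =>
    have hsub : lowWeight n (w + 1) ⊆ ((Finset.univ : Finset (Fin n × Letter)) ×ˢ
        lowWeight n w).image fun z => Function.update z.2 z.1.1 z.1.2 := by
      intro P hP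
      have hP : P.weight ≤ w + 1 := by simpa [lowWeight] using hP
      have key : ∃ q, PauliString.weight (Function.update P q Letter.I) ≤ w := by
        -- The identity string has no letter to erase; any qubit serves, and one exists because `1 ≤
        -- n`.
        by_cases h : P.supp = ∅
        · refine ⟨⟨0, hn⟩, ?_⟩
          have : (PauliString.supp (Function.update P ⟨0, hn⟩ Letter.I)) ⊆ P.supp := by
            intro q hq
            rw [PauliString.mem_supp] at hq ⊢
            by_cases e : q = ⟨0, hn⟩
            · simp [e] at hq
            · rwa [Function.update_of_ne e] at hq
          have h2 := Finset.card_le_card this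
          rw [h, Finset.card_empty] at h2
          exact h2.trans (Nat.zero_le _)
        · obtain ⟨q, hq⟩ := Finset.nonempty_iff_ne_empty.2 h
          refine ⟨q, ?_⟩
          have : (PauliString.supp (Function.update P q Letter.I)) ⊆ P.supp.erase q := by
            intro q' hq'
            rw [Finset.mem_erase]
            rw [PauliString.mem_supp] at hq' ⊢
            by_cases e : q' = q
            · simp [e] at hq'
            · exact ⟨e, by rwa [Function.update_of_ne e] at hq'⟩
          have h2 := Finset.card_le_card this
          rw [Finset.card_erase_of_mem hq] at h2
          have : P.supp.card ≤ w + 1 := hP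
          change (PauliString.supp _).card ≤ w
          omega
      obtain ⟨q, hq⟩ := key
      refine Finset.mem_image.2 ⟨((q, P q), Function.update P q Letter.I), ?_, ?_⟩
      · simpa [lowWeight] using hq
      · simp
    refine (Finset.card_le_card hsub).trans (Finset.card_image_le.trans ?_)
    rw [Finset.card_product, Finset.card_univ, Fintype.card_prod, Fintype.card_fin,
      Letter.card_letter, pow_succ, mul_comm n, mul_comm]
    exact Nat.mul_le_mul_right _ ih

theorem support_card_le (hn : 1 ≤ n) {D : PauliTable n} {w : ℕ}
    (hD : ∀ P ∈ D.support, P.weight ≤ w) : D.support.card ≤ (4 * n) ^ w := by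
  refine le_trans (Finset.card_le_card fun P hP => ?_) (card_lowWeight_le hn w)
  simpa [lowWeight] using hD P hP

theorem lpdEvolve_weight_le (p : ℕ) (s : ℝ) (w d : ℕ) (D : PauliTable n)
    (hD : ∀ P ∈ D.support, P.weight ≤ w) :
    ∀ P ∈ (lpdEvolve H p s w d D).val.support, P.weight ≤ w := by
  cases d with
  | zero => exact hD
  | succ d =>
    intro P hP
    rw [lpdEvolve_succ_val] at hP
    have : P ∈ (Finsupp.filter (fun P : PauliString n => P.weight ≤ w)
      (applyLayers H (trotterFactors Γ p s) (lpdEvolve H p s w d D).val).val).support := hP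
    rw [Finsupp.support_filter] at this
    exact (Finset.mem_filter.1 this).2

/-- Every step starts from a table of at most `(4 n) ^ w` strings, so the growth within a step does
not accumulate over the steps. -/
theorem lpdEvolve_cost (hn : 1 ≤ n) (hH : H.IsLocal kh a) (p : ℕ) (s : ℝ) (w d : ℕ)
    (D : PauliTable n) (hD : ∀ P ∈ D.support, P.weight ≤ w) {L : ℕ}
    (hL : (trotterFactors Γ p s).length = L) :
    (lpdEvolve H p s w d D).time
        ≤ d * ((3 * L + 1) * ((4 * n) ^ w * 2 ^ (L * (w * (kh + 1) ^ L)))) ∧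
      (lpdEvolve H p s w d D).space ≤ 2 * ((4 * n) ^ w * 2 ^ (L * (w * (kh + 1) ^ L))) := by
  induction d with
  | zero => exact ⟨Nat.zero_le _, Nat.zero_le _⟩
  | succ d ih =>
    have hw := lpdEvolve_weight_le (H := H) p s w d D hD
    obtain ⟨h1, h2, h3⟩ := applyLayers_cost hH (trotterFactors Γ p s)
      (lpdEvolve H p s w d D).val w _ hw (support_card_le hn hw)
    rw [hL] at h1 h2 h3
    set B := (4 * n) ^ w * 2 ^ (L * (w * (kh + 1) ^ L)) with hB
    constructor
    · change (lpdEvolve H p s w d D).time + ((applyLayers H (trotterFactors Γ p s)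
        (lpdEvolve H p s w d D).val).time + ((applyLayers H (trotterFactors Γ p s)
        (lpdEvolve H p s w d D).val).val.support.card + (0 + 0))) ≤ _
      calc _ ≤ d * ((3 * L + 1) * B) + (3 * L * B + (B + (0 + 0))) :=
            Nat.add_le_add ih.1 (Nat.add_le_add h2 (Nat.add_le_add_right h1 _))
        _ = _ := by ring
    · change max (lpdEvolve H p s w d D).space (max (applyLayers H (trotterFactors Γ p s)
        (lpdEvolve H p s w d D).val).space (max 0 (max (applyLayers H (trotterFactors Γ p s)
        (lpdEvolve H p s w d D).val).val.support.card 0))) ≤ _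
      have := ih.2
      omega

theorem lpd_cost (hn : 1 ≤ n) (hH : H.IsLocal kh a) (p : ℕ) (t : ℝ) (r w : ℕ)
    (O : PauliTable n) (ψ : Bits (Fin n) → ℂ) (hO : ∀ P ∈ O.support, P.weight ≤ w) {L : ℕ}
    (hL : (trotterFactors Γ p (t / r)).length = L) :
    (lpd H O ψ p t r w).time
        ≤ (3 * L + 2) * (4 * 2 ^ (L * (kh + 1) ^ L)) ^ w * (r + 1) * n ^ w ∧
      (lpd H O ψ p t r w).space ≤ 2 * (4 * 2 ^ (L * (kh + 1) ^ L)) ^ w * n ^ w := by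
  obtain ⟨h1, h2⟩ := lpdEvolve_cost hn hH p (t / r) w r O hO hL
  have hw := lpdEvolve_weight_le (H := H) p (t / r) w r O hO
  have hc := support_card_le hn hw
  have hc0 := support_card_le hn hO
  set B := (4 * n) ^ w * 2 ^ (L * (w * (kh + 1) ^ L)) with hB
  have hB2 : B = (4 * 2 ^ (L * (kh + 1) ^ L)) ^ w * n ^ w := by
    rw [hB, mul_pow, mul_pow, ← pow_mul]; ring
  have hle : (4 * n) ^ w ≤ B := Nat.le_mul_of_pos_right _ (by positivity)
  constructor
  · change O.support.card + (0 + ((lpdEvolve H p (t / r) w r O).time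
      + ((lpdEvolve H p (t / r) w r O).val.support.card + (0 + 0)))) ≤ _
    calc _ ≤ B + (0 + (r * ((3 * L + 1) * B) + (B + (0 + 0)))) := by omega
      _ ≤ (3 * L + 2) * B * (r + 1) := by
          have : 0 ≤ 3 * L * B + r * B := Nat.zero_le _
          nlinarith
      _ = _ := by rw [hB2]; ring
  · change max 0 (max O.support.card (max (lpdEvolve H p (t / r) w r O).space
      (max 0 (max (lpdEvolve H p (t / r) w r O).val.support.card 0)))) ≤ _
    rw [mul_assoc, ← hB2]
    omega

end LowWeightPauli
end

noncomputable section
namespace LowWeightPauli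

variable {n Γ : ℕ}

/-! ### The truncation error -/

/-- The total absolute evolution time of a list of layers. -/
def layerTime (xs : List (Fin Γ × ℝ)) : ℝ := (xs.map fun x => |x.2|).sum

theorem layerTime_cons (x : Fin Γ × ℝ) (xs : List (Fin Γ × ℝ)) :
    layerTime (x :: xs) = |x.2| + layerTime xs := by simp [layerTime]

theorem layerTime_nonneg (xs : List (Fin Γ × ℝ)) : 0 ≤ layerTime xs := by
  refine List.sum_nonneg fun y hy => ?_
  obtain ⟨x, -, rfl⟩ := List.mem_map.1 hy
  exact abs_nonneg _

variable {H : LayeredHamiltonian n Γ} {kh : ℕ} {a : ℝ}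

theorem wnorm_heisLayers_le (hH : H.IsLocal kh a) (xs : List (Fin Γ × ℝ)) {μ ν κ : ℝ}
    (hν : 0 ≤ ν) (hμ : ν + κ * layerTime xs ≤ μ) (hκ : 2 * |a| * Γ * Real.exp (μ * kh) ≤ κ)
    (A : Op n) : wnorm ν (heisLayers H xs A) ≤ wnorm μ A := by
  have hκ0 : 0 ≤ κ := le_trans (by positivity) hκ
  induction xs generalizing μ A with
  | nil => exact wnorm_mono (by simpa [layerTime] using hμ) A
  | cons x xs ih =>
    rw [layerTime_cons, mul_add] at hμ
    have h1 : 0 ≤ κ * |x.2| := by positivity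
    have h2 : 0 ≤ κ * layerTime xs := mul_nonneg hκ0 (layerTime_nonneg xs)
    have hexp : 2 * |a| * Γ * Real.exp ((μ - κ * |x.2|) * kh) ≤ κ := by
      refine le_trans ?_ hκ
      gcongr
      linarith
    refine (ih (μ := μ - κ * |x.2|) (by linarith) hexp _).trans ?_
    exact LayeredHamiltonian.wnorm_heis_layerOp_le hH x.1 (by linarith) (by linarith) hκ A

/-- Telescopes over the layers. The unit spent on a commutator is spent in each summand separately,
so it enters only once and not once per layer. -/
theorem wnorm_heisLayers_sub_le (hH : H.IsLocal kh a) (xs : List (Fin Γ × ℝ)) {μ ν κ : ℝ}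
    (hν : 0 ≤ ν) (hμ : ν + 1 + κ * layerTime xs ≤ μ)
    (hκ : 2 * |a| * Γ * Real.exp (μ * kh) ≤ κ) (A : Op n) :
    wnorm ν (heisLayers H xs A - A) ≤ κ * (kh + 1) * wnorm μ A * layerTime xs := by
  have hκ0 : 0 ≤ κ := le_trans (by positivity) hκ
  induction xs generalizing μ A with
  | nil => simp [heisLayers, layerTime, wnorm_zero]
  | cons x xs ih =>
    rw [layerTime_cons, mul_add] at hμ
    have h1 : 0 ≤ κ * |x.2| := by positivity
    have h2 : 0 ≤ κ * layerTime xs := mul_nonneg hκ0 (layerTime_nonneg xs)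
    have hexp : 2 * |a| * Γ * Real.exp ((μ - κ * |x.2|) * kh) ≤ κ := by
      refine le_trans ?_ hκ
      gcongr
      linarith
    set B := heis (H.layerOp x.1) x.2 A with hB
    have e : heisLayers H (x :: xs) A - A = (heisLayers H xs B - B) + (B - A) := by
      rw [heisLayers]; abel
    have i1 := ih (μ := μ - κ * |x.2|) (by linarith) hexp B
    have i2 : wnorm (μ - κ * |x.2|) B ≤ wnorm μ A :=
      LayeredHamiltonian.wnorm_heis_layerOp_le hH x.1 (by linarith) (by linarith) hκ A
    have i3 := LayeredHamiltonian.wnorm_heis_layerOp_sub_le hH x.1 (s := x.2) hν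
      (by linarith : ν + 1 + κ * |x.2| ≤ μ) hκ A
    have i4 : κ * (kh + 1) * wnorm (μ - κ * |x.2|) B * layerTime xs
        ≤ κ * (kh + 1) * wnorm μ A * layerTime xs := by
      have := layerTime_nonneg xs
      gcongr
    rw [e, layerTime_cons]
    refine (wnorm_add_le _ _ _).trans ?_
    rw [mul_add]
    linarith

/-- Truncation only deletes coefficients, so a truncated run loses no more of the parameter than its
layers do. -/
theorem wnorm_lpdEvolve_le (hH : H.IsLocal kh a) (p : ℕ) (s : ℝ) (w d : ℕ) (O : PauliTable n)
    {μ ν κ : ℝ} (hν : 0 ≤ ν) (hμ : ν + κ * layerTime (trotterFactors Γ p s) * d ≤ μ)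
    (hκ : 2 * |a| * Γ * Real.exp (μ * kh) ≤ κ) :
    wnorm ν (PauliTable.op (lpdEvolve H p s w d O).val) ≤ wnorm μ O.op := by
  have hκ0 : 0 ≤ κ := le_trans (by positivity) hκ
  have ht := layerTime_nonneg (trotterFactors Γ p s)
  induction d generalizing ν with
  | zero => exact wnorm_mono (by simpa using hμ) _
  | succ d ih =>
    push_cast at hμ
    have h2 : 0 ≤ κ * layerTime (trotterFactors Γ p s) := by positivity
    have h3 : 0 ≤ κ * layerTime (trotterFactors Γ p s) * d := by positivity
    have hle : ν + κ * layerTime (trotterFactors Γ p s) ≤ μ := by linarith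
    refine le_trans ?_ (ih (ν := ν + κ * layerTime (trotterFactors Γ p s)) (by linarith)
      (by linarith))
    refine le_trans (wnorm_le_of_coeff_le ν fun P => ?_)
      (wnorm_heisLayers_le hH (trotterFactors Γ p s) hν le_rfl ?_ _)
    · rw [pauliCoeff_lpdEvolve_succ]
      split_ifs
      · exact le_rfl
      · rw [norm_zero]; exact norm_nonneg _
    · refine le_trans ?_ hκ
      gcongr

/-- The table holds no heavy strings before a step, so those discarded after it are the heavy part
of the change made by the step. This gains a factor proportional to the step length, and the `r`
errors add up to a bound without `r`. In `μ - 2`, one unit pays for all the evolution and one for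
the commutator in the change. -/
theorem truncation_error_le (hH : H.IsLocal kh a) (p : ℕ) (t : ℝ) (r w : ℕ) (O : PauliTable n)
    (hO : ∀ P ∈ O.support, P.weight ≤ w) {μ κ : ℝ} (hμ : 2 ≤ μ)
    (hκ : 2 * |a| * Γ * Real.exp (μ * kh) ≤ κ)
    (ht : κ * layerTime (trotterFactors Γ p (t / r)) * r ≤ 1) :
    pauliNorm (trotterOp H O p t r - truncatedOp H O p t r w)
      ≤ (kh + 1) * Real.exp (-((μ - 2) * w)) * wnorm μ O.op := by
  have hκ0 : 0 ≤ κ := le_trans (by positivity) hκ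
  set s := t / r with hs
  set F := trotterFactors Γ p s with hF
  have hT := layerTime_nonneg F
  set D : ℕ → Op n := fun d => PauliTable.op (lpdEvolve H p s w d O).val with hD
  have step : ∀ d : ℕ, d + 1 ≤ r → pauliNorm (heisLayers H F (D d) - D (d + 1))
      ≤ (kh + 1) * Real.exp (-((μ - 2) * w)) * wnorm μ O.op * (κ * layerTime F) := by
    intro d hd
    have hcoeff : ∀ P, pauliCoeff (heisLayers H F (D d) - D (d + 1)) P
        = if P.weight ≤ w then 0 else pauliCoeff (heisLayers H F (D d) - D d) P := by
      intro P
      rw [pauliCoeff_sub, hD, pauliCoeff_lpdEvolve_succ]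
      split_ifs with hP
      · rw [sub_self]
      · rw [sub_zero, pauliCoeff_sub, pauliCoeff_op (lpdEvolve H p s w d O).val]
        have : (lpdEvolve H p s w d O).val P = 0 := by
          by_contra h
          exact hP (lpdEvolve_weight_le (H := H) p s w d O hO P (Finsupp.mem_support_iff.2 h))
        rw [this]; simp
    have hd' : (d : ℝ) + 1 ≤ r := by exact_mod_cast hd
    have h0 : 0 ≤ κ * layerTime F := by positivity
    have hsum : κ * layerTime F * d + κ * layerTime F ≤ 1 := by nlinarith
    have hd0 : 0 ≤ κ * layerTime F * d := by positivity
    have hν : 0 ≤ μ - κ * layerTime F * d := by linarith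
    have hexp : 2 * |a| * Γ * Real.exp ((μ - κ * layerTime F * d) * kh) ≤ κ := by
      refine le_trans ?_ hκ
      gcongr
      linarith
    have h1 := pauliNorm_le_of_high_weight (by linarith : 0 ≤ μ - 2) hcoeff
    have h2 := wnorm_heisLayers_sub_le hH F (by linarith : 0 ≤ μ - 2)
      (by linarith : μ - 2 + 1 + κ * layerTime F ≤ μ - κ * layerTime F * d) hexp (D d)
    have h3 : wnorm (μ - κ * layerTime F * d) (D d) ≤ wnorm μ O.op :=
      wnorm_lpdEvolve_le hH p s w d O hν (by linarith) hκ
    refine h1.trans ((mul_le_mul_of_nonneg_left h2 (Real.exp_pos _).le).trans ?_)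
    calc _ = (kh + 1) * Real.exp (-((μ - 2) * w)) * wnorm (μ - κ * layerTime F * d) (D d)
          * (κ * layerTime F) := by ring
      _ ≤ _ := by gcongr
  have main : ∀ d : ℕ, d ≤ r → pauliNorm ((heisLayers H F)^[d] O.op - D d)
      ≤ (kh + 1) * Real.exp (-((μ - 2) * w)) * wnorm μ O.op * (κ * layerTime F) * d := by
    intro d
    induction d with
    | zero =>
      intro _
      have : D 0 = O.op := rfl
      rw [this, Function.iterate_zero, id, sub_self, ← wnorm_zero_left, wnorm_zero]
      simp
    | succ d ih =>
      intro hd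
      -- Earlier errors are carried along by the untruncated step, which preserves the Pauli norm.
      have e : (heisLayers H F)^[d + 1] O.op - D (d + 1)
          = heisLayers H F ((heisLayers H F)^[d] O.op - D d)
            + (heisLayers H F (D d) - D (d + 1)) := by
        rw [Function.iterate_succ_apply', heisLayers_sub]; abel
      rw [e]
      refine (pauliNorm_add_le _ _).trans ?_
      rw [pauliNorm_heisLayers]
      have := ih (by omega)
      have := step d hd
      push_cast
      linarith
  have hfin := main r le_rfl
  rw [trotterOp_eq_iterate]
  refine hfin.trans ?_
  rw [mul_assoc]
  refine mul_le_of_le_one_right (mul_nonneg (by positivity) (wnorm_nonneg _ _)) ht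

end LowWeightPauli
end

noncomputable section
namespace LowWeightPauli

variable {n Γ : ℕ}

open scoped Matrix.Norms.Operator Topology

/-! ### The order of the product formulas -/

/-- The layers of `F` with all times multiplied by `s`. -/
def scaleLayers (F : List (Fin Γ × ℝ)) (s : ℝ) : List (Fin Γ × ℝ) :=
  F.map fun x => (x.1, x.2 * s)

theorem scaleLayers_scaleLayers (F : List (Fin Γ × ℝ)) (s t : ℝ) :
    scaleLayers (scaleLayers F s) t = scaleLayers F (s * t) := by
  simp [scaleLayers, Function.comp_def, mul_assoc]

theorem scaleLayers_append (F G : List (Fin Γ × ℝ)) (s : ℝ) :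
    scaleLayers (F ++ G) s = scaleLayers F s ++ scaleLayers G s := by simp [scaleLayers]

theorem layerTime_scaleLayers (F : List (Fin Γ × ℝ)) (s : ℝ) :
    layerTime (scaleLayers F s) = layerTime F * |s| := by
  induction F with
  | nil => simp [layerTime, scaleLayers]
  | cons x F ih =>
    have : scaleLayers (x :: F) s = (x.1, x.2 * s) :: scaleLayers F s := rfl
    rw [this, layerTime_cons, layerTime_cons, ih, abs_mul, add_mul]

theorem suzuki_eq_scale (k : ℕ) (s : ℝ) : suzuki Γ k s = scaleLayers (suzuki Γ k 1) s := by
  induction k generalizing s with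
  | zero =>
    simp only [suzuki, scaleLayers, List.map_append, List.map_map, Function.comp_def]
    have : (1 / 2 : ℝ) * s = s / 2 := by ring
    simp only [this]
  | succ k ih =>
    simp only [suzuki, mul_one]
    set u : ℝ := 1 / (4 - (4 : ℝ) ^ (1 / (2 * (k : ℝ) + 3))) with hu
    rw [ih (u * s), ih ((1 - 4 * u) * s), ih u, ih (1 - 4 * u)]
    simp only [scaleLayers_append, scaleLayers_scaleLayers]

theorem trotterFactors_eq_scale (p : ℕ) (s : ℝ) :
    trotterFactors Γ p s = scaleLayers (trotterFactors Γ p 1) s := by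
  unfold trotterFactors
  split_ifs
  · simp [scaleLayers, Function.comp_def]
  · exact suzuki_eq_scale _ _

theorem suzuki_reverse (k : ℕ) (s : ℝ) : (suzuki Γ k s).reverse = suzuki Γ k s := by
  induction k generalizing s with
  | zero => simp [suzuki, List.map_reverse]
  | succ k ih => simp [suzuki, ih]

theorem layersProd_append (H : LayeredHamiltonian n Γ) (F G : List (Fin Γ × ℝ)) :
    layersProd H (F ++ G) = layersProd H F * layersProd H G := by simp [layersProd]

theorem layersProd_mul_reverse (H : LayeredHamiltonian n Γ) (F : List (Fin Γ × ℝ)) (s : ℝ) :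
    layersProd H (scaleLayers F s) * layersProd H (scaleLayers F.reverse (-s)) = 1 := by
  induction F with
  | nil => simp [layersProd, scaleLayers]
  | cons x F ih =>
    have h1 : scaleLayers (x :: F) s = (x.1, x.2 * s) :: scaleLayers F s := rfl
    have h2 : scaleLayers [x] (-s) = [(x.1, x.2 * -s)] := rfl
    rw [h1, layersProd_cons, List.reverse_cons, scaleLayers_append, layersProd_append, h2,
      Matrix.mul_assoc, ← Matrix.mul_assoc (layersProd H (scaleLayers F s)), ih, Matrix.one_mul,
      layersProd_cons]
    simp [layersProd, evolution_mul_neg]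

/-- Reversing the factors and negating the time inverts a product formula, and the Suzuki lists are
palindromes. -/
theorem layersProd_suzuki_symm (H : LayeredHamiltonian n Γ) (k : ℕ) (s : ℝ) :
    layersProd H (suzuki Γ k s) * layersProd H (suzuki Γ k (-s)) = 1 := by
  have := layersProd_mul_reverse H (suzuki Γ k 1) s
  rwa [suzuki_reverse, ← suzuki_eq_scale, ← suzuki_eq_scale] at this

theorem analyticAt_evolution (K : Op n) (c s : ℝ) :
    AnalyticAt ℝ (fun z => evolution K (c * z)) s := by
  simp only [evolution_eq]
  have h : AnalyticAt ℝ (fun z : ℝ => (c * z) • ((-Complex.I) • K)) s :=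
    (analyticAt_const.mul analyticAt_id).smul analyticAt_const
  exact (NormedSpace.exp_analytic (𝕂 := ℝ) _).comp h

theorem analyticAt_layersProd (H : LayeredHamiltonian n Γ) (F : List (Fin Γ × ℝ)) (s : ℝ) :
    AnalyticAt ℝ (fun z => layersProd H (scaleLayers F z)) s := by
  induction F with
  | nil => exact analyticAt_const
  | cons x F ih =>
    have : (fun z => layersProd H (scaleLayers (x :: F) z))
        = fun z => evolution (H.layerOp x.1) (x.2 * z) * layersProd H (scaleLayers F z) :=
      funext fun z => layersProd_cons H _ _
    rw [this]
    exact (analyticAt_evolution _ _ _).mul ih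

theorem hasDerivAt_evolution_mul (K : Op n) (c s : ℝ) :
    HasDerivAt (fun z => evolution K (c * z)) (((-Complex.I * c) • K) * evolution K (c * s)) s := by
  have h := (hasDerivAt_evolution' K (c * s)).scomp s ((hasDerivAt_id s).const_mul c)
  refine h.congr_deriv ?_
  simp only [mul_one, Matrix.smul_mul]
  ext i j
  simp
  ring

/-- `A z = exp(-i α z K) + z ^ m g(z)` near zero, with `g` analytic and `g 0 = X`. -/
def ApproxEvolution (K : Op n) (m : ℕ) (α : ℝ) (A : ℝ → Op n) (X : Op n) : Prop :=
  ∃ g : ℝ → Op n, AnalyticAt ℝ g 0 ∧ g 0 = X ∧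
    ∀ᶠ z in 𝓝 (0 : ℝ), A z = evolution K (α * z) + z ^ m • g z

namespace ApproxEvolution

variable {K : Op n} {m : ℕ} {α β : ℝ} {A B : ℝ → Op n} {X Y : Op n}

/-- At zero both evolutions are 1, so the leading errors add; the product of the two errors has
order `z ^ (2 m)` and does not count. -/
theorem mul (hm : m ≠ 0) (hA : ApproxEvolution K m α A X) (hB : ApproxEvolution K m β B Y) :
    ApproxEvolution K m (α + β) (fun z => A z * B z) (X + Y) := by
  obtain ⟨g, hg, rfl, hgA⟩ := hA
  obtain ⟨h, hh, rfl, hhB⟩ := hB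
  refine ⟨fun z => evolution K (α * z) * h z + g z * evolution K (β * z) + z ^ m • (g z * h z),
    ?_, ?_, ?_⟩
  · exact (((analyticAt_evolution K α 0).mul hh).add (hg.mul (analyticAt_evolution K β 0))).add
      ((analyticAt_id.pow m).smul (hg.mul hh))
  · simp [evolution_zero, hm, add_comm]
  · filter_upwards [hgA, hhB] with z h1 h2
    rw [h1, h2, add_mul α β z, evolution_add]
    simp only [Matrix.add_mul, Matrix.mul_add, Matrix.smul_mul, Matrix.mul_smul, smul_add]
    abel

theorem comp_mul (hA : ApproxEvolution K m 1 A X) (c : ℝ) :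
    ApproxEvolution K m c (fun z => A (c * z)) (c ^ m • X) := by
  obtain ⟨g, hg, rfl, hgA⟩ := hA
  have hcont : Filter.Tendsto (fun z : ℝ => c * z) (𝓝 0) (𝓝 0) := by
    have : Continuous fun z : ℝ => c * z := by fun_prop
    simpa using this.tendsto 0
  have hg0 : AnalyticAt ℝ g (c * 0) := by rwa [mul_zero]
  refine ⟨fun z => c ^ m • g (c * z), ?_, by simp, ?_⟩
  · have hc : AnalyticAt ℝ (fun _ : ℝ => c ^ m) 0 := analyticAt_const
    have hl : AnalyticAt ℝ (fun z : ℝ => c * z) 0 := analyticAt_const.mul analyticAt_id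
    exact hc.smul (AnalyticAt.comp (f := fun z : ℝ => c * z) hg0 hl)
  · filter_upwards [hcont.eventually hgA] with z h1
    rw [h1, one_mul, smul_smul, mul_pow, mul_comm (c ^ m)]

/-- An analytic remainder that vanishes at zero is `z` times its analytic difference quotient
`dslope`. -/
theorem raise (hA : ApproxEvolution K m α A 0) : ∃ Y, ApproxEvolution K (m + 1) α A Y := by
  obtain ⟨g, hg, h0, hgA⟩ := hA
  refine ⟨_, dslope g 0, ?_, rfl, ?_⟩
  · obtain ⟨q, hq⟩ := hg
    exact ⟨_, hq.has_fpower_series_dslope_fslope⟩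
  · filter_upwards [hgA] with z h1
    have := sub_smul_dslope g 0 z
    rw [h0, sub_zero, sub_zero] at this
    rw [h1, pow_succ, mul_smul, this]

/-- For even `m` the errors of `A z` and `A (-z)` have the same leading term, so their product has
leading error `2 X`; but the product is exactly 1. -/
theorem eq_zero_of_symm (hm : m ≠ 0) (he : Even m) (hA : ApproxEvolution K m 1 A X)
    (hsymm : ∀ z, A z * A (-z) = 1) : X = 0 := by
  have h2 := hA.comp_mul (-1)
  rw [he.neg_one_pow, one_smul] at h2
  obtain ⟨g, hg, hg0, hgA⟩ := hA.mul hm h2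
  have hz : ∀ᶠ z in 𝓝[≠] (0 : ℝ), g z = 0 := by
    filter_upwards [hgA.filter_mono nhdsWithin_le_nhds, self_mem_nhdsWithin] with z h3 hz0
    rw [neg_one_mul, hsymm, add_neg_cancel, zero_mul, evolution_zero] at h3
    have : z ^ m • g z = 0 := by simpa using h3
    exact (smul_eq_zero.1 this).resolve_left (pow_ne_zero _ hz0)
  have hlim : Filter.Tendsto g (𝓝[≠] 0) (𝓝 (g 0)) :=
    hg.continuousAt.tendsto.mono_left nhdsWithin_le_nhds
  have hg00 : g 0 = 0 :=
    tendsto_nhds_unique hlim (tendsto_const_nhds.congr' (hz.mono fun z h => h.symm))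
  rw [hg00] at hg0
  have : (2 : ℝ) • X = 0 := by rw [two_smul]; exact hg0.symm
  exact (smul_eq_zero.1 this).resolve_left two_ne_zero

/-- Agreement of the value and of the derivative at zero. -/
theorem of_deriv (hA : AnalyticAt ℝ A 0) (h0 : A 0 = 1)
    (hd : HasDerivAt A ((-Complex.I) • K) 0) : ∃ Y, ApproxEvolution K 2 1 A Y := by
  set f : ℝ → Op n := fun z => A z - evolution K (1 * z) with hf
  have hfa : AnalyticAt ℝ f 0 := hA.sub (analyticAt_evolution K 1 0)
  have hf0 : f 0 = 0 := by simp [hf, h0, evolution_zero]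
  have hfd : HasDerivAt f 0 0 := by
    have := hd.sub (hasDerivAt_evolution_mul K 1 0)
    refine this.congr_deriv ?_
    simp [evolution_zero]
  refine raise ⟨dslope f 0, ?_, ?_, Filter.Eventually.of_forall fun z => ?_⟩
  · obtain ⟨q, hq⟩ := hfa
    exact ⟨_, hq.has_fpower_series_dslope_fslope⟩
  · rw [dslope_same, hfd.deriv]
  · have := sub_smul_dslope f 0 z
    rw [hf0, sub_zero, sub_zero] at this
    rw [pow_one, this, hf]; simp

end ApproxEvolution

/-! ### Order conditions for the Trotter–Suzuki formulas. -/

theorem layersProd_scale_zero (H : LayeredHamiltonian n Γ) (F : List (Fin Γ × ℝ)) :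
    layersProd H (scaleLayers F 0) = 1 := by
  induction F with
  | nil => rfl
  | cons x F ih =>
    have h1 : scaleLayers (x :: F) 0 = (x.1, x.2 * 0) :: scaleLayers F 0 := rfl
    rw [h1, layersProd_cons, ih, mul_zero, evolution_zero, Matrix.mul_one]

theorem hasDerivAt_layersProd_zero (H : LayeredHamiltonian n Γ) (F : List (Fin Γ × ℝ)) :
    HasDerivAt (fun z => layersProd H (scaleLayers F z))
      ((-Complex.I) • (F.map fun x => (x.2 : ℂ) • H.layerOp x.1).sum) 0 := by
  induction F with
  | nil =>
    simp only [List.map_nil, List.sum_nil, smul_zero]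
    exact hasDerivAt_const _ _
  | cons x F ih =>
    have : (fun z => layersProd H (scaleLayers (x :: F) z))
        = fun z => evolution (H.layerOp x.1) (x.2 * z) * layersProd H (scaleLayers F z) :=
      funext fun z => layersProd_cons H _ _
    rw [this]
    refine ((hasDerivAt_evolution_mul _ _ _).mul ih).congr_deriv ?_
    rw [mul_zero, evolution_zero, layersProd_scale_zero, Matrix.mul_one, Matrix.mul_one,
      Matrix.one_mul, List.map_cons, List.sum_cons, smul_add, smul_smul]

theorem layerOp_sum_finRange (H : LayeredHamiltonian n Γ) :
    ((List.finRange Γ).map fun γ => H.layerOp γ).sum = H.op := by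
  rw [LayeredHamiltonian.op, ← List.ofFn_eq_map, List.sum_ofFn]

/-- Each recursion gains two orders. The leading errors of the five factors cancel because `4 u ^ m
+ (1 - 4 u) ^ m = 0` for `m = 2 k + 3`; the next order is even and vanishes by time symmetry. -/
theorem approx_suzuki (H : LayeredHamiltonian n Γ) (k : ℕ) :
    ∃ X, ApproxEvolution H.op (2 * k + 3) 1 (fun z => layersProd H (suzuki Γ k z)) X := by
  have symm_raise : ∀ k m : ℕ, m ≠ 0 → Even m → (∃ X, ApproxEvolution H.op m 1
      (fun z => layersProd H (suzuki Γ k z)) X) → ∃ X, ApproxEvolution H.op (m + 1) 1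
      (fun z => layersProd H (suzuki Γ k z)) X := by
    rintro k m hm he ⟨X, hX⟩
    have := hX.eq_zero_of_symm hm he fun z => layersProd_suzuki_symm H k z
    subst this
    exact hX.raise
  induction k with
  | zero =>
    have e : (fun z => layersProd H (suzuki Γ 0 z))
        = fun z => layersProd H (scaleLayers (suzuki Γ 0 1) z) :=
      funext fun z => by rw [suzuki_eq_scale 0 z]
    refine symm_raise 0 2 two_ne_zero even_two ?_
    rw [e]
    refine ApproxEvolution.of_deriv ?_ ?_ ?_
    · exact analyticAt_layersProd H _ 0
    · exact layersProd_scale_zero H _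
    · refine (hasDerivAt_layersProd_zero H _).congr_deriv ?_
      congr 1
      simp only [suzuki, List.map_append, List.map_map, Function.comp_def, List.sum_append,
        List.map_reverse, List.sum_reverse]
      have : ((List.finRange Γ).map fun γ => (((1 / 2 : ℝ)) : ℂ) • H.layerOp γ).sum
          = ((1 / 2 : ℝ) : ℂ) • H.op := by
        rw [← layerOp_sum_finRange, List.smul_sum, List.map_map]; rfl
      rw [this, ← add_smul]
      norm_num
  | succ k ih =>
    obtain ⟨X, hX⟩ := ih
    set u : ℝ := 1 / (4 - (4 : ℝ) ^ (1 / (2 * (k : ℝ) + 3))) with hu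
    have h1 := hX.comp_mul u
    have h2 := hX.comp_mul (1 - 4 * u)
    have hm : 2 * k + 3 ≠ 0 := by omega
    have h3 := (((h1.mul hm h1).mul hm h2).mul hm h1).mul hm h1
    have hα : u + u + (1 - 4 * u) + u + u = 1 := by ring
    set q : ℝ := (4 : ℝ) ^ (1 / (2 * (k : ℝ) + 3)) with hq
    have hqpow : q ^ (2 * k + 3) = 4 := by
      rw [hq, ← Real.rpow_natCast, ← Real.rpow_mul (by norm_num)]
      push_cast
      rw [one_div_mul_cancel (by positivity), Real.rpow_one]
    have hq4 : q ≠ 4 := by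
      intro h
      rw [h] at hqpow
      have : (4 : ℝ) ^ 1 < 4 ^ (2 * k + 3) := pow_lt_pow_right₀ (by norm_num) (by omega)
      rw [hqpow] at this
      norm_num at this
    -- The reason for the choice `u = 1 / (4 - q)`: as `m = 2 k + 3` is odd and `q ^ m = 4`, the
    -- middle factor contributes `-4 u ^ m`.
    have hu4 : 1 - 4 * u = -(q * u) := by
      have : 4 - q ≠ 0 := sub_ne_zero.2 (Ne.symm hq4)
      rw [hu]; field_simp; ring
    have hX0 : u ^ (2 * k + 3) • X + u ^ (2 * k + 3) • X + (1 - 4 * u) ^ (2 * k + 3) • X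
        + u ^ (2 * k + 3) • X + u ^ (2 * k + 3) • X = 0 := by
      have hodd : Odd (2 * k + 3) := ⟨k + 1, by ring⟩
      rw [hu4, hodd.neg_pow, mul_pow, hqpow, ← add_smul, ← add_smul, ← add_smul, ← add_smul]
      convert zero_smul ℝ X using 2
      ring
    rw [hα, hX0] at h3
    have hprod : (fun z => layersProd H (suzuki Γ (k + 1) z)) = fun z =>
        layersProd H (suzuki Γ k (u * z)) * layersProd H (suzuki Γ k (u * z))
          * layersProd H (suzuki Γ k ((1 - 4 * u) * z)) * layersProd H (suzuki Γ k (u * z))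
          * layersProd H (suzuki Γ k (u * z)) := by
      funext z
      simp only [suzuki, layersProd_append]
      rfl
    have h4 := h3.raise
    rw [← hprod] at h4
    exact symm_raise (k + 1) (2 * k + 4) (by omega) ⟨k + 2, by ring⟩ h4

theorem approx_trotter (H : LayeredHamiltonian n Γ) {p : ℕ} (hp : p = 1 ∨ (Even p ∧ 2 ≤ p)) :
    ∃ X, ApproxEvolution H.op (p + 1) 1 (fun z => layersProd H (trotterFactors Γ p z)) X := by
  rcases hp with rfl | ⟨⟨m, rfl⟩, hp⟩
  · have e : (fun z => layersProd H (trotterFactors Γ 1 z))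
        = fun z => layersProd H (scaleLayers (trotterFactors Γ 1 1) z) :=
      funext fun z => by rw [trotterFactors_eq_scale 1 z]
    rw [e]
    refine ApproxEvolution.of_deriv ?_ ?_ ?_
    · exact analyticAt_layersProd H _ 0
    · exact layersProd_scale_zero H _
    · refine (hasDerivAt_layersProd_zero H _).congr_deriv ?_
      congr 1
      simp only [trotterFactors, if_true, List.map_map, Function.comp_def, Complex.ofReal_one,
        one_smul]
      exact layerOp_sum_finRange H
  · obtain ⟨j, rfl⟩ : ∃ j, m = j + 1 := ⟨m - 1, by omega⟩
    have h := approx_suzuki H j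
    have e1 : 2 * j + 3 = j + 1 + (j + 1) + 1 := by ring
    have e2 : ∀ z, trotterFactors Γ (j + 1 + (j + 1)) z = suzuki Γ j z := by
      intro z
      rw [trotterFactors, if_neg (by omega)]
      congr 1
      omega
    simp only [e2]
    rwa [e1] at h

end LowWeightPauli
end

noncomputable section
namespace LowWeightPauli

variable {n Γ : ℕ}

open scoped Matrix.Norms.Operator Topology

/-! ### Operator-valued polynomials -/

/-- Operator-valued polynomials of degree less than `q`. -/
def polyLT (n q : ℕ) : Submodule ℝ (ℝ → Op n) :=
  Submodule.span ℝ {f | ∃ m < q, ∃ X : Op n, f = fun z => z ^ m • X}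

theorem monomial_mem_polyLT {m q : ℕ} (h : m < q) (X : Op n) :
    (fun z : ℝ => z ^ m • X) ∈ polyLT n q :=
  Submodule.subset_span ⟨m, h, X, rfl⟩

theorem pow_smul_mem_polyLT {i q r : ℕ} (hr : i + q ≤ r) {f : ℝ → Op n} (hf : f ∈ polyLT n q) :
    (fun z => z ^ i • f z) ∈ polyLT n r := by
  induction hf using Submodule.span_induction with
  | mem f hf =>
    obtain ⟨m, hm, X, rfl⟩ := hf
    simp only [smul_smul, ← pow_add]
    exact monomial_mem_polyLT (by omega) X
  | zero =>
    convert (polyLT n r).zero_mem using 1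
    funext z; simp
  | add f g _ _ h1 h2 =>
    convert (polyLT n r).add_mem h1 h2 using 1
    funext z; simp
  | smul c f _ h1 =>
    have := (polyLT n r).smul_mem c h1
    convert this using 1
    funext z
    simp [smul_comm c]

theorem complex_smul_mem_polyLT {q : ℕ} (c : ℂ) {f : ℝ → Op n} (hf : f ∈ polyLT n q) :
    (fun z => c • f z) ∈ polyLT n q := by
  induction hf using Submodule.span_induction with
  | mem f hf =>
    obtain ⟨m, hm, X, rfl⟩ := hf
    simp only [smul_comm c]
    exact monomial_mem_polyLT hm _
  | zero =>
    convert (polyLT n q).zero_mem using 1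
    funext z; simp
  | add f g _ _ h1 h2 =>
    convert (polyLT n q).add_mem h1 h2 using 1
    funext z; simp
  | smul d f _ h1 =>
    have := (polyLT n q).smul_mem d h1
    convert this using 1
    funext z
    simp [smul_comm d]

theorem exists_coeff_of_mem_polyLT {q : ℕ} {f : ℝ → Op n} (hf : f ∈ polyLT n q) :
    ∃ Q : ℕ → Op n, ∀ z, f z = ∑ m ∈ Finset.range q, z ^ m • Q m := by
  induction hf using Submodule.span_induction with
  | mem f hf =>
    obtain ⟨m, hm, X, rfl⟩ := hf
    refine ⟨fun k => if k = m then X else 0, fun z => ?_⟩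
    simp [hm]
  | zero => exact ⟨0, fun z => by simp⟩
  | add f g _ _ h1 h2 =>
    obtain ⟨Q, hQ⟩ := h1
    obtain ⟨R, hR⟩ := h2
    exact ⟨Q + R, fun z => by simp [hQ, hR, smul_add, Finset.sum_add_distrib]⟩
  | smul c f _ h1 =>
    obtain ⟨Q, hQ⟩ := h1
    exact ⟨c • Q, fun z => by simp [hQ, Finset.smul_sum, smul_comm c]⟩

/-- A polynomial of degree less than `q` which is `O(z ^ q)` at zero vanishes. -/
theorem polynomial_coeff_eq_zero {V : Type*} [NormedAddCommGroup V] [NormedSpace ℝ V] (q : ℕ)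
    (Q : ℕ → V) (K : ℝ)
    (h : ∀ᶠ z in 𝓝[>] (0 : ℝ), ‖∑ m ∈ Finset.range q, z ^ m • Q m‖ ≤ K * z ^ q) :
    ∀ m < q, Q m = 0 := by
  induction q generalizing Q with
  | zero => intro m hm; omega
  | succ q ih =>
    have h0 : Q 0 = 0 := by
      have c1 : Filter.Tendsto (fun z : ℝ => ∑ m ∈ Finset.range (q + 1), z ^ m • Q m)
          (𝓝[>] 0) (𝓝 (Q 0)) := by
        have : Continuous fun z : ℝ => ∑ m ∈ Finset.range (q + 1), z ^ m • Q m := by fun_prop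
        have := this.tendsto 0
        rw [Finset.sum_range_succ'] at this
        simp only [zero_pow (Nat.succ_ne_zero _), zero_smul, Finset.sum_const_zero, pow_zero,
          one_smul, zero_add] at this
        exact this.mono_left nhdsWithin_le_nhds
      have c2 : Filter.Tendsto (fun z : ℝ => K * z ^ (q + 1)) (𝓝[>] 0) (𝓝 0) := by
        have : Continuous fun z : ℝ => K * z ^ (q + 1) := by fun_prop
        have := this.tendsto 0
        rw [zero_pow (Nat.succ_ne_zero _), mul_zero] at this
        exact this.mono_left nhdsWithin_le_nhds
      exact tendsto_nhds_unique c1 (squeeze_zero_norm' h c2)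
    have h1 : ∀ᶠ z in 𝓝[>] (0 : ℝ),
        ‖∑ m ∈ Finset.range q, z ^ m • Q (m + 1)‖ ≤ K * z ^ q := by
      filter_upwards [h, self_mem_nhdsWithin] with z hz hz0
      have hz0 : 0 < z := hz0
      rw [Finset.sum_range_succ', h0, smul_zero, add_zero] at hz
      have e : ∑ m ∈ Finset.range q, z ^ (m + 1) • Q (m + 1)
          = z • ∑ m ∈ Finset.range q, z ^ m • Q (m + 1) := by
        rw [Finset.smul_sum]
        exact Finset.sum_congr rfl fun m _ => by rw [smul_smul, pow_succ']
      rw [e, norm_smul, Real.norm_eq_abs, abs_of_pos hz0, pow_succ] at hz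
      refine le_of_mul_le_mul_left ?_ hz0
      linarith
    intro m hm
    cases m with
    | zero => exact h0
    | succ m => exact ih _ h1 m (by omega)

theorem weightedCoeff_eq_zero {μ : ℝ} {A : Op n} (h : weightedCoeff μ A = 0) : A = 0 := by
  refine op_ext_pauliCoeff fun P => ?_
  have h1 := congrArg (fun v : EuclideanSpace ℂ (PauliString n) => v P) h
  simp only [weightedCoeff, LinearMap.coe_mk, AddHom.coe_mk, PiLp.zero_apply] at h1
  have h2 := (mul_eq_zero.1 h1).resolve_left (by exact_mod_cast (Real.exp_pos _).ne')
  rw [h2]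
  simp [pauliCoeff]

/-- The constant `K` is arbitrary, so it may depend on `n` and on the Hamiltonian. -/
theorem eq_zero_of_mem_polyLT {q : ℕ} {f : ℝ → Op n} (hf : f ∈ polyLT n q) {μ K : ℝ}
    (h : ∀ᶠ z in 𝓝[>] (0 : ℝ), wnorm μ (f z) ≤ K * z ^ q) (z : ℝ) : f z = 0 := by
  obtain ⟨Q, hQ⟩ := exists_coeff_of_mem_polyLT hf
  have h2 := polynomial_coeff_eq_zero q (fun m => weightedCoeff μ (Q m)) K (by
    filter_upwards [h] with z hz
    rw [wnorm, hQ, map_sum] at hz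
    have : ∀ m, weightedCoeff μ (z ^ m • Q m) = z ^ m • weightedCoeff μ (Q m) := fun m =>
      ((weightedCoeff μ).restrictScalars ℝ).map_smul (z ^ m) (Q m)
    simpa only [this] using hz)
  rw [hQ]
  refine Finset.sum_eq_zero fun m hm => ?_
  rw [weightedCoeff_eq_zero (h2 m (Finset.mem_range.1 hm)), smul_zero]

/-! ### Taylor expansion of the Heisenberg evolution -/

/-- The generator `A ↦ i [K, A]`. -/
def adI (K A : Op n) : Op n := Complex.I • (K * A - A * K)

/-- Differentiation turns the Taylor remainder of `A` into the remainder of `adI K A` with one term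
fewer, which drives the induction below. -/
theorem hasDerivAt_heis_sub_taylor (K A : Op n) (q : ℕ) (s : ℝ) :
    HasDerivAt (fun s : ℝ => heis K s A - ∑ i ∈ Finset.range (q + 1),
        (s ^ i / i.factorial) • (adI K)^[i] A)
      (heis K s (adI K A) - ∑ i ∈ Finset.range q, (s ^ i / i.factorial) • (adI K)^[i] (adI K A))
      s := by
  refine (hasDerivAt_heis K A s).sub ?_
  have e : (fun s : ℝ => ∑ i ∈ Finset.range (q + 1), (s ^ i / i.factorial) • (adI K)^[i] A)
      = fun s : ℝ => ∑ i ∈ Finset.range q,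
        (s ^ (i + 1) / (i + 1).factorial) • (adI K)^[i] (adI K A) + A := by
    funext s
    rw [Finset.sum_range_succ']
    simp
  rw [e]
  refine HasDerivAt.add_const _ (HasDerivAt.fun_sum fun i _ => ?_)
  refine HasDerivAt.smul_const ?_ _
  have := (hasDerivAt_pow (i + 1) s).div_const ((i + 1).factorial : ℝ)
  refine this.congr_deriv ?_
  rw [Nat.factorial_succ]
  have : (i.factorial : ℝ) ≠ 0 := by exact_mod_cast i.factorial_ne_zero
  push_cast
  field_simp

/-- Integrates the evolved `q`-fold commutator `q` times; the factor `1 / q!` is given away. -/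
theorem wnorm_heis_sub_taylor_le (K : Op n) (μ M T : ℝ) (q : ℕ) (A : Op n)
    (h : ∀ s ∈ Set.Icc 0 T, wnorm μ (heis K s ((adI K)^[q] A)) ≤ M) :
    ∀ z ∈ Set.Icc 0 T, wnorm μ (heis K z A - ∑ i ∈ Finset.range q,
      (z ^ i / i.factorial) • (adI K)^[i] A) ≤ M * z ^ q := by
  induction q generalizing A with
  | zero =>
    intro z hz
    simpa using h z hz
  | succ q ih =>
    intro z hz
    have hM : 0 ≤ M := (wnorm_nonneg _ _).trans (h z hz)
    have h1 := ih (adI K A) (by simpa only [Function.iterate_succ_apply] using h)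
    have h2 := wnorm_sub_le_of_deriv (μ := μ) (T := z) (C := M * z ^ q)
      (hasDerivAt_heis_sub_taylor K A q) (fun s hs => by
        refine (h1 s ⟨hs.1, hs.2.le.trans hz.2⟩).trans ?_
        have := hs.1
        have := hs.2.le
        gcongr) hz.1
    have h3 : heis K 0 A - ∑ i ∈ Finset.range (q + 1),
        ((0 : ℝ) ^ i / i.factorial) • (adI K)^[i] A = 0 := by
      rw [Finset.sum_range_succ', heis_zero]
      simp
    rw [h3, sub_zero] at h2
    rw [pow_succ, ← mul_assoc]
    exact h2

theorem adI_smul_left_iterate (K A : Op n) (c : ℂ) (i : ℕ) :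
    (adI (c • K))^[i] A = (Complex.I * c) ^ i • (fun X => K * X - X * K)^[i] A := by
  induction i with
  | zero => simp
  | succ i ih =>
    rw [Function.iterate_succ_apply', Function.iterate_succ_apply', ih, adI]
    generalize (fun X => K * X - X * K)^[i] A = Y
    rw [Matrix.smul_mul, Matrix.mul_smul, Matrix.smul_mul, Matrix.mul_smul, smul_smul c,
      smul_smul _ c, mul_comm ((Complex.I * c) ^ i) c, ← smul_sub, smul_smul, ← mul_assoc, ← pow_succ']

/-! ### Nested commutators of layers -/

/-- The nested commutator of the layers `γ`. -/
def layerComm (H : LayeredHamiltonian n Γ) (k : ℕ) (γ : Fin (k + 1) → Fin Γ) : Op n :=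
  nestedComm k fun i => H.layerOp (γ i)

variable {H : LayeredHamiltonian n Γ} {kh : ℕ} {a : ℝ}

theorem commutator_layerComm (k : ℕ) (γ : Fin (k + 1) → Fin Γ) (x : Fin Γ) :
    H.layerOp x * layerComm H k γ - layerComm H k γ * H.layerOp x
      = layerComm H (k + 1) (Fin.snoc γ x) := by
  simp only [layerComm, nestedComm, Fin.snoc_last, Fin.snoc_castSucc]

theorem iterate_commutator_layerComm (k i : ℕ) (γ : Fin (k + 1) → Fin Γ) (x : Fin Γ) :
    ∃ γ' : Fin (k + i + 1) → Fin Γ, (fun X => H.layerOp x * X - X * H.layerOp x)^[i]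
      (layerComm H k γ) = layerComm H (k + i) γ' := by
  induction i with
  | zero => exact ⟨γ, rfl⟩
  | succ i ih =>
    obtain ⟨γ', h⟩ := ih
    refine ⟨Fin.snoc γ' x, ?_⟩
    rw [Function.iterate_succ_apply', h, commutator_layerComm]
    rfl

theorem weightLE_layerOp (hH : H.IsLocal kh a) (γ : Fin Γ) : WeightLE kh (H.layerOp γ) :=
  WeightLE.sum fun l _ => WeightLE.smul_mat (hH l).1 _

theorem weightLE_layerComm (hH : H.IsLocal kh a) (k : ℕ) (γ : Fin (k + 1) → Fin Γ) :
    WeightLE ((k + 1) * kh) (layerComm H k γ) := by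
  induction k with
  | zero => simpa [layerComm, nestedComm] using weightLE_layerOp hH (γ 0)
  | succ k ih =>
    have h1 := weightLE_layerOp hH (γ (Fin.last (k + 1)))
    have h2 := ih fun i => γ i.castSucc
    have e : (k + 1 + 1) * kh = kh + (k + 1) * kh := by ring
    rw [e]
    refine WeightLE.sub (h1.mul h2) ?_
    rw [add_comm]
    exact h2.mul h1

theorem pauliNorm_layerComm_le (p : ℕ) (γ : Fin (p + 1) → Fin Γ) :
    pauliNorm (layerComm H p γ) ≤ commNorm H p :=
  Finset.single_le_sum (f := fun γ : Fin (p + 1) → Fin Γ =>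
    pauliNorm (nestedComm p fun i => H.layerOp (γ i))) (fun _ _ => pauliNorm_nonneg _)
    (Finset.mem_univ γ)

theorem commNorm_nonneg (p : ℕ) : 0 ≤ commNorm H p :=
  Finset.sum_nonneg fun _ _ => pauliNorm_nonneg _

/-- Nested commutators of local layers have bounded weight, so the weighted norm exceeds the Pauli
norm in `Λ₂` by a constant factor only. -/
theorem wnorm_layerComm_le (hH : H.IsLocal kh a) {μ : ℝ} (hμ : 0 ≤ μ) (p : ℕ)
    (γ : Fin (p + 1) → Fin Γ) :
    wnorm μ (layerComm H p γ) ≤ Real.exp (μ * ((p + 1) * kh : ℕ)) * commNorm H p :=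
  (wnorm_le_of_weightLE (weightLE_layerComm hH p γ) hμ).trans
    (mul_le_mul_of_nonneg_left (pauliNorm_layerComm_le p γ) (Real.exp_pos _).le)

theorem heisLayers_add (H : LayeredHamiltonian n Γ) (xs : List (Fin Γ × ℝ)) (A B : Op n) :
    heisLayers H xs (A + B) = heisLayers H xs A + heisLayers H xs B := by
  induction xs generalizing A B with
  | nil => rfl
  | cons x xs ih => simp only [heisLayers, heis_add_right, ih]

theorem heisLayers_smul (H : LayeredHamiltonian n Γ) (xs : List (Fin Γ × ℝ)) (c : ℂ) (A : Op n) :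
    heisLayers H xs (c • A) = c • heisLayers H xs A := by
  induction xs generalizing A with
  | nil => rfl
  | cons x xs ih => simp only [heisLayers, heis_smul_right, ih]

theorem heisLayers_sum {ι : Type*} (H : LayeredHamiltonian n Γ) (xs : List (Fin Γ × ℝ))
    (s : Finset ι) (A : ι → Op n) :
    heisLayers H xs (∑ i ∈ s, A i) = ∑ i ∈ s, heisLayers H xs (A i) := by
  induction xs generalizing A with
  | nil => rfl
  | cons x xs ih => simp only [heisLayers, heis_sum_right, ih]

/-- The evolution of a nested commutator through a list of layers is a polynomial, up to a
remainder which is controlled by the nested commutators of order `p`. -/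
theorem heisLayers_layerComm_expansion (Γ p kh : ℕ) (a κ T : ℝ)
    (hκ : 2 * |a| * Γ * Real.exp (3 * kh) ≤ κ) (F : List (Fin Γ × ℝ))
    (hF : κ * (layerTime F * T) ≤ 1) (q j : ℕ) (hj : j + q = p) :
    ∃ C : ℝ, 0 ≤ C ∧ ∀ (n : ℕ) (H : LayeredHamiltonian n Γ), H.IsLocal kh a →
      ∀ γ : Fin (j + 1) → Fin Γ, ∃ f ∈ polyLT n q, ∀ z ∈ Set.Icc 0 T,
        wnorm 1 (heisLayers H (scaleLayers F z) (layerComm H j γ) - f z)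
          ≤ C * z ^ q * commNorm H p := by
  have hκ0 : 0 ≤ κ := le_trans (by positivity) hκ
  induction F generalizing q j with
  | nil =>
    -- At depth `p` nothing is left to expand and `Λ₂` bounds the commutator; at smaller depth the
    -- commutator is itself the polynomial.
    rcases Nat.eq_zero_or_pos q with rfl | hq
    · refine ⟨Real.exp (1 * ((p + 1) * kh : ℕ)), (Real.exp_pos _).le, fun n H hH γ =>
        ⟨0, Submodule.zero_mem _, fun z _ => ?_⟩⟩
      obtain rfl : j = p := by omega
      rw [Pi.zero_apply, sub_zero, pow_zero, mul_one]
      exact wnorm_layerComm_le hH zero_le_one j γ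
    · refine ⟨0, le_rfl, fun n H hH γ => ⟨_, monomial_mem_polyLT hq (layerComm H j γ),
        fun z _ => ?_⟩⟩
      simp [scaleLayers, heisLayers, wnorm_zero]
  | cons x F ih =>
    rw [layerTime_cons] at hF
    by_cases hT : 0 ≤ T
    swap
    -- For negative `T` the time interval is empty.
    · refine ⟨0, le_rfl, fun n H _ γ => ⟨0, Submodule.zero_mem _, fun z hz => ?_⟩⟩
      exact absurd (hz.1.trans hz.2) hT
    have hTF : 0 ≤ κ * (layerTime F * T) :=
      mul_nonneg hκ0 (mul_nonneg (layerTime_nonneg F) hT)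
    have hTx : 0 ≤ κ * (|x.2| * T) := by positivity
    have hF' : κ * (layerTime F * T) ≤ 1 := by nlinarith
    have hx' : κ * (|x.2| * T) ≤ 1 := by nlinarith
    -- The head of the list acts first. Its Taylor terms are commutators of depth `j + i` with a
    -- factor `z ^ i`, so the remaining layers have to be expanded only to order `q - i`.
    have ih' : ∀ i : ℕ, ∃ C : ℝ, 0 ≤ C ∧ (i < q → ∀ (n : ℕ) (H : LayeredHamiltonian n Γ),
        H.IsLocal kh a → ∀ γ : Fin (j + i + 1) → Fin Γ, ∃ f ∈ polyLT n (q - i),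
        ∀ z ∈ Set.Icc 0 T, wnorm 1 (heisLayers H (scaleLayers F z) (layerComm H (j + i) γ) - f z)
          ≤ C * z ^ (q - i) * commNorm H p) := by
      intro i
      by_cases hi : i < q
      · obtain ⟨C, hC, h⟩ := ih hF' (q - i) (j + i) (by omega)
        exact ⟨C, hC, fun _ => h⟩
      · exact ⟨0, le_rfl, fun h => absurd h hi⟩
    choose C hC hCi using ih'
    refine ⟨∑ i ∈ Finset.range q, |x.2| ^ i * C i
      + |x.2| ^ q * Real.exp (3 * ((p + 1) * kh : ℕ)), ?_, fun n H hH γ => ?_⟩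
    · have : ∀ i ∈ Finset.range q, 0 ≤ |x.2| ^ i * C i := fun i _ =>
        mul_nonneg (by positivity) (hC i)
      have := Finset.sum_nonneg this
      positivity
    choose γ' hγ' using fun i => iterate_commutator_layerComm (H := H) j i γ x.1
    have hexists : ∀ i : ℕ, ∃ f : ℝ → Op n, i < q → f ∈ polyLT n (q - i) ∧ ∀ z ∈ Set.Icc 0 T,
        wnorm 1 (heisLayers H (scaleLayers F z) (layerComm H (j + i) (γ' i)) - f z)
          ≤ C i * z ^ (q - i) * commNorm H p := by
      intro i
      by_cases hi : i < q
      · obtain ⟨f, hf, h⟩ := hCi i hi n H hH (γ' i)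
        exact ⟨f, fun _ => ⟨hf, h⟩⟩
      · exact ⟨0, fun h => absurd h hi⟩
    choose f hf using hexists
    set K : Op n := (x.2 : ℂ) • H.layerOp x.1 with hK
    have hheis : ∀ (s : ℝ) (A : Op n), heis K s A = heis (H.layerOp x.1) (x.2 * s) A :=
      fun s A => heis_smul_left _ _ _ _
    have had : ∀ i, (adI K)^[i] (layerComm H j γ)
        = (Complex.I * x.2) ^ i • layerComm H (j + i) (γ' i) := by
      intro i
      rw [hK, adI_smul_left_iterate, hγ']
    have hcn : ∀ i : ℕ, ‖(Complex.I * (x.2 : ℂ)) ^ i‖ = |x.2| ^ i := by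
      intro i
      rw [norm_pow, norm_mul, Complex.norm_I, one_mul, Complex.norm_real, Real.norm_eq_abs]
    refine ⟨fun z => ∑ i ∈ Finset.range q, z ^ i •
      (((1 / i.factorial : ℝ) : ℂ) * (Complex.I * x.2) ^ i) • f i z, ?_, fun z hz => ?_⟩
    · have : (fun z => ∑ i ∈ Finset.range q, z ^ i •
          (((1 / i.factorial : ℝ) : ℂ) * (Complex.I * x.2) ^ i) • f i z)
          = ∑ i ∈ Finset.range q, fun z => z ^ i •
          (((1 / i.factorial : ℝ) : ℂ) * (Complex.I * x.2) ^ i) • f i z := by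
        funext z; simp
      rw [this]
      refine Submodule.sum_mem _ fun i hi => ?_
      have hi := Finset.mem_range.1 hi
      exact pow_smul_mem_polyLT (by omega) (complex_smul_mem_polyLT _ ((hf i hi).1))
    set Λ := commNorm H p with hΛ
    have hΛ0 : 0 ≤ Λ := commNorm_nonneg p
    have hz0 := hz.1
    -- the remainder of the innermost layer
    set R : Op n := heis K z (layerComm H j γ) - ∑ i ∈ Finset.range q,
      (z ^ i / i.factorial) • (adI K)^[i] (layerComm H j γ) with hR
    -- Only the `q`-fold commutator enters, which has depth `j + q = p`. The parameter falls from 3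
    -- to 2 in this layer and from 2 to 1 in the others.
    have hRn : wnorm 2 R ≤ |x.2| ^ q * (Real.exp (3 * ((p + 1) * kh : ℕ)) * Λ) * z ^ q := by
      refine wnorm_heis_sub_taylor_le K 2 _ T q _ (fun s hs => ?_) z hz
      rw [had, hheis, heis_smul_right, wnorm_smul, hcn]
      refine mul_le_mul_of_nonneg_left ?_ (by positivity)
      have hsT : κ * |x.2 * s| ≤ 1 := by
        rw [abs_mul, abs_of_nonneg hs.1]
        refine le_trans ?_ hx'
        have := hs.2
        gcongr
      refine (LayeredHamiltonian.wnorm_heis_layerOp_le (μ := 3) hH x.1 (by norm_num)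
        (by linarith) hκ _).trans ?_
      obtain rfl : p = j + q := hj.symm
      exact wnorm_layerComm_le hH (by norm_num) _ _
    have hRL : wnorm 1 (heisLayers H (scaleLayers F z) R) ≤ wnorm 2 R := by
      refine wnorm_heisLayers_le (κ := κ) hH _ zero_le_one ?_ ?_ R
      · rw [layerTime_scaleLayers, abs_of_nonneg hz0]
        have h1 := layerTime_nonneg F
        have h2 := hz.2
        have : κ * (layerTime F * z) ≤ κ * (layerTime F * T) := by gcongr
        linarith
      · refine le_trans ?_ hκ
        gcongr
        norm_num
    have hdecomp : heisLayers H (scaleLayers (x :: F) z) (layerComm H j γ)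
        - ∑ i ∈ Finset.range q, z ^ i •
          (((1 / i.factorial : ℝ) : ℂ) * (Complex.I * x.2) ^ i) • f i z
        = ∑ i ∈ Finset.range q, ((z ^ i * (1 / i.factorial) : ℝ) : ℂ) • (Complex.I * x.2) ^ i •
          (heisLayers H (scaleLayers F z) (layerComm H (j + i) (γ' i)) - f i z)
          + heisLayers H (scaleLayers F z) R := by
      have e1 : heisLayers H (scaleLayers (x :: F) z) (layerComm H j γ)
          = heisLayers H (scaleLayers F z) (heis K z (layerComm H j γ)) := by
        rw [hheis]; rfl
      have e2 : heis K z (layerComm H j γ) = ∑ i ∈ Finset.range q,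
          ((z ^ i * (1 / i.factorial) : ℝ) : ℂ) • (Complex.I * x.2) ^ i •
            layerComm H (j + i) (γ' i) + R := by
        rw [hR]
        simp only [had]
        have : ∀ i : ℕ, ((z ^ i * (1 / i.factorial) : ℝ) : ℂ) • (Complex.I * (x.2 : ℂ)) ^ i •
            layerComm H (j + i) (γ' i) = (z ^ i / i.factorial) • (Complex.I * (x.2 : ℂ)) ^ i •
            layerComm H (j + i) (γ' i) := by
          intro i
          rw [Complex.coe_smul, mul_one_div]
        simp only [this]
        abel
      rw [e1, e2, heisLayers_add, heisLayers_sum]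
      simp only [heisLayers_smul, smul_sub, Finset.sum_sub_distrib]
      have : ∀ i : ℕ, z ^ i • (((1 / i.factorial : ℝ) : ℂ) * (Complex.I * (x.2 : ℂ)) ^ i) • f i z
          = ((z ^ i * (1 / i.factorial) : ℝ) : ℂ) • (Complex.I * (x.2 : ℂ)) ^ i • f i z := by
        intro i
        rw [Complex.coe_smul, mul_smul (z ^ i), mul_smul ((1 / i.factorial : ℝ) : ℂ),
          Complex.coe_smul]
      simp only [this]
      abel
    rw [hdecomp]
    refine (wnorm_add_le _ _ _).trans ?_
    have hsum : wnorm 1 (∑ i ∈ Finset.range q, ((z ^ i * (1 / i.factorial) : ℝ) : ℂ) •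
        (Complex.I * (x.2 : ℂ)) ^ i •
          (heisLayers H (scaleLayers F z) (layerComm H (j + i) (γ' i)) - f i z))
        ≤ ∑ i ∈ Finset.range q, |x.2| ^ i * C i * (z ^ q * Λ) := by
      refine (wnorm_sum_le _ _ _).trans (Finset.sum_le_sum fun i hi => ?_)
      have hi := Finset.mem_range.1 hi
      rw [wnorm_smul, wnorm_smul, hcn, Complex.norm_real, Real.norm_eq_abs,
        abs_of_nonneg (by positivity)]
      have h1 := (hf i hi).2 z hz
      have h2 : (1 / i.factorial : ℝ) ≤ 1 := by
        rw [div_le_one (by positivity)]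
        exact_mod_cast Nat.one_le_iff_ne_zero.2 i.factorial_ne_zero
      have h3 : z ^ i * z ^ (q - i) = z ^ q := by rw [← pow_add]; congr 1; omega
      have hCi0 := hC i
      have hw := wnorm_nonneg 1 (heisLayers H (scaleLayers F z) (layerComm H (j + i) (γ' i)) - f i z)
      calc z ^ i * (1 / i.factorial) * (|x.2| ^ i * wnorm 1 (heisLayers H (scaleLayers F z)
            (layerComm H (j + i) (γ' i)) - f i z))
          ≤ z ^ i * 1 * (|x.2| ^ i * (C i * z ^ (q - i) * Λ)) := by gcongr
        _ = |x.2| ^ i * C i * ((z ^ i * z ^ (q - i)) * Λ) := by ring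
        _ = _ := by rw [h3]
    rw [← Finset.sum_mul] at hsum
    have := hRL.trans hRn
    nlinarith

/-! ### The generator of the product formula -/

/-- The Hermitian generator `G` of a product formula: `dS/dz = -i G(z) S(z)`. -/
def layersGen (H : LayeredHamiltonian n Γ) : List (Fin Γ × ℝ) → ℝ → Op n
  | [], _ => 0
  | x :: F, z => (x.2 : ℂ) • H.layerOp x.1 + heis (H.layerOp x.1) (-(x.2 * z)) (layersGen H F z)

theorem heis_conjTranspose {K : Op n} (hK : K.IsHermitian) (s : ℝ) (A : Op n) :
    (heis K s A)ᴴ = heis K s Aᴴ := by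
  simp only [heis, Matrix.conjTranspose_mul, evolution_conjTranspose hK, neg_neg, Matrix.mul_assoc]

theorem layersGen_isHermitian (F : List (Fin Γ × ℝ)) (z : ℝ) : (layersGen H F z).IsHermitian := by
  induction F with
  | nil => exact Matrix.isHermitian_zero
  | cons x F ih =>
    have h := LayeredHamiltonian.layerOp_isHermitian (H := H) x.1
    rw [Matrix.IsHermitian, layersGen, Matrix.conjTranspose_add, heis_conjTranspose h, ih.eq,
      Matrix.conjTranspose_smul, h.eq]
    simp

theorem hasDerivAt_layersProd (F : List (Fin Γ × ℝ)) (z : ℝ) :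
    HasDerivAt (fun z => layersProd H (scaleLayers F z))
      ((-Complex.I) • (layersGen H F z * layersProd H (scaleLayers F z))) z := by
  induction F with
  | nil =>
    simp only [layersGen, Matrix.zero_mul, smul_zero]
    exact hasDerivAt_const _ _
  | cons x F ih =>
    have h1 : ∀ z, layersProd H (scaleLayers (x :: F) z)
        = evolution (H.layerOp x.1) (x.2 * z) * layersProd H (scaleLayers F z) :=
      fun z => layersProd_cons H _ _
    rw [show (fun z => layersProd H (scaleLayers (x :: F) z)) = _ from funext h1]
    refine ((hasDerivAt_evolution_mul _ _ _).mul ih).congr_deriv ?_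
    rw [h1, layersGen, heis, neg_neg, Matrix.add_mul, smul_add]
    congr 1
    · simp only [Matrix.smul_mul, Matrix.mul_assoc, smul_smul]
    · simp only [Matrix.mul_assoc, Matrix.mul_smul]
      rw [← Matrix.mul_assoc (evolution _ (-(x.2 * z))), evolution_neg_mul, Matrix.one_mul]

/-- The generator is a sum of layers, each conjugated by the factors to its left, so it consists of
evolved commutators of depth zero. The list `L` collects the conjugating layers as `F` is processed.
-/
theorem layersGen_expansion (Γ p kh : ℕ) (a κ T : ℝ)
    (hκ : 2 * |a| * Γ * Real.exp (3 * kh) ≤ κ) (hT : 0 ≤ T) (F L : List (Fin Γ × ℝ))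
    (hF : κ * ((layerTime L + layerTime F) * T) ≤ 1) :
    ∃ C : ℝ, 0 ≤ C ∧ ∀ (n : ℕ) (H : LayeredHamiltonian n Γ), H.IsLocal kh a →
      ∃ f ∈ polyLT n p, ∀ z ∈ Set.Icc 0 T,
        wnorm 1 (heisLayers H (scaleLayers L z) (layersGen H F z) - f z)
          ≤ C * z ^ p * commNorm H p := by
  have hκ0 : 0 ≤ κ := le_trans (by positivity) hκ
  induction F generalizing L with
  | nil =>
    refine ⟨0, le_rfl, fun n H _ => ⟨0, Submodule.zero_mem _, fun z _ => ?_⟩⟩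
    have : heisLayers H (scaleLayers L z) (0 : Op n) = 0 := by
      simpa using heisLayers_smul H (scaleLayers L z) 0 0
    simp [layersGen, this, wnorm_zero]
  | cons x F ih =>
    rw [layerTime_cons] at hF
    have hsplit : κ * ((layerTime L + (|x.2| + layerTime F)) * T)
      = κ * (layerTime L * T) + κ * ((|x.2| + layerTime F) * T) := by ring
    have hpos : 0 ≤ κ * ((|x.2| + layerTime F) * T) :=
      mul_nonneg hκ0 (mul_nonneg (add_nonneg (abs_nonneg _) (layerTime_nonneg F)) hT)
    obtain ⟨C₁, hC₁, h₁⟩ := heisLayers_layerComm_expansion Γ p kh a κ T hκ L (by linarith) p 0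
      (by omega)
    -- Conjugation by the factor `x` is Heisenberg evolution for the opposite time, hence one more
    -- layer in front of `L`.
    obtain ⟨C₂, hC₂, h₂⟩ := ih ((x.1, -x.2) :: L) (by
      rw [layerTime_cons, abs_neg]
      refine le_trans (le_of_eq ?_) hF
      ring)
    refine ⟨|x.2| * C₁ + C₂, by positivity, fun n H hH => ?_⟩
    obtain ⟨f₁, hf₁, h₁⟩ := h₁ n H hH fun _ => x.1
    obtain ⟨f₂, hf₂, h₂⟩ := h₂ n H hH
    refine ⟨_, Submodule.add_mem _ (complex_smul_mem_polyLT (x.2 : ℂ) hf₁) hf₂, fun z hz => ?_⟩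
    have e : heisLayers H (scaleLayers L z) (layersGen H (x :: F) z)
        = (x.2 : ℂ) • heisLayers H (scaleLayers L z) (layerComm H 0 fun _ => x.1)
          + heisLayers H (scaleLayers ((x.1, -x.2) :: L) z) (layersGen H F z) := by
      rw [layersGen, heisLayers_add, heisLayers_smul, ← neg_mul]
      rfl
    have e2 : heisLayers H (scaleLayers L z) (layersGen H (x :: F) z)
        - ((fun z => (x.2 : ℂ) • f₁ z) + f₂) z
        = (x.2 : ℂ) • (heisLayers H (scaleLayers L z) (layerComm H 0 fun _ => x.1) - f₁ z)
          + (heisLayers H (scaleLayers ((x.1, -x.2) :: L) z) (layersGen H F z) - f₂ z) := by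
      rw [e, Pi.add_apply, smul_sub]; abel
    rw [e2]
    refine (wnorm_add_le _ _ _).trans ?_
    rw [wnorm_smul, Complex.norm_real, Real.norm_eq_abs]
    have i1 := mul_le_mul_of_nonneg_left (h₁ z hz) (abs_nonneg x.2)
    have i2 := h₂ z hz
    nlinarith

theorem continuous_wnorm (μ : ℝ) : Continuous fun A : Op n => wnorm μ A :=
  ((LinearMap.toContinuousLinearMap ((weightedCoeff (n := n) μ).restrictScalars ℝ)).continuous).norm

/-- The generator of a formula of order `p` agrees with the Hamiltonian up to `O(z ^ p)`. -/
theorem layersGen_sub_isBigO {F : List (Fin Γ × ℝ)} {p : ℕ} {X : Op n}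
    (h : ApproxEvolution H.op (p + 1) 1 (fun z => layersProd H (scaleLayers F z)) X) (μ : ℝ) :
    ∃ K : ℝ, ∀ᶠ z in 𝓝[>] (0 : ℝ), wnorm μ (layersGen H F z - H.op) ≤ K * z ^ p := by
  obtain ⟨g, hg, -, hgS⟩ := h
  set S : ℝ → Op n := fun z => layersProd H (scaleLayers F z) with hS
  -- The inverse of `S`, needed to divide `S` out of the differential equation.
  set V : ℝ → Op n := fun z => layersProd H (scaleLayers F.reverse (-z)) with hV
  have hSV : ∀ z, S z * V z = 1 := fun z => layersProd_mul_reverse H F z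
  obtain ⟨g', hg'⟩ : ∃ g' : ℝ → Op n, g' = deriv g := ⟨_, rfl⟩
  set h : ℝ → Op n := fun z => Complex.I • (((p + 1 : ℕ) : ℝ) • g z + z • g' z
    + (Complex.I * z) • (H.op * g z)) * V z with hh
  have hVc : ContinuousAt V 0 := by
    have h1 : ContinuousAt (fun z => layersProd H (scaleLayers F.reverse z)) (-0) :=
      (analyticAt_layersProd H F.reverse (-0)).continuousAt
    exact ContinuousAt.comp (f := fun z : ℝ => -z) h1 continuousAt_neg
  have hc : ContinuousAt h 0 := by
    have h1 := hg.continuousAt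
    have h2 : ContinuousAt g' 0 := hg' ▸ hg.deriv.continuousAt
    have h3 : ContinuousAt (fun z : ℝ => z) 0 := continuousAt_id
    have h4 : ContinuousAt (fun z : ℝ => Complex.I * (z : ℂ)) 0 := by fun_prop
    exact ((((h1.const_smul ((p + 1 : ℕ) : ℝ)).add (h3.smul h2)).add
      (h4.smul (continuousAt_const.mul h1))).const_smul Complex.I).mul hVc
  have hE : ∀ᶠ z in 𝓝 (0 : ℝ), layersGen H F z - H.op = z ^ p • h z := by
    filter_upwards [hgS.eventually_nhds, hg.eventually_analyticAt] with z hz hga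
    have d1 := hasDerivAt_layersProd (H := H) F z
    have hgd : HasDerivAt g (g' z) z := hg' ▸ hga.differentiableAt.hasDerivAt
    have d2 := (hasDerivAt_evolution_mul H.op 1 z).add
      ((hasDerivAt_pow (p + 1) z).smul hgd)
    -- The derivative of `S` is computed from the approximation and from the generator; comparison
    -- isolates the difference of the generators times `S`.
    have d3 := (d2.congr_of_eventuallyEq hz).unique d1
    have hzS : S z = evolution H.op (1 * z) + z ^ (p + 1) • g z := hz.self_of_nhds
    have e1 : evolution H.op (1 * z) = S z - z ^ (p + 1) • g z := by rw [hzS]; abel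
    rw [e1] at d3
    have key : (layersGen H F z - H.op) * S z = z ^ p • Complex.I • (((p + 1 : ℕ) : ℝ) • g z
        + z • g' z + (Complex.I * z) • (H.op * g z)) := by
      have d4 := congrArg (fun Y => Complex.I • Y) d3
      simp only [smul_smul] at d4
      have hI : Complex.I * -Complex.I = 1 := by simp
      rw [hI, one_smul] at d4
      rw [Matrix.sub_mul, show layersGen H F z * S z = _ from d4.symm]
      simp only [Matrix.smul_mul, Complex.ofReal_one, mul_one, Matrix.mul_sub, Matrix.mul_smul,
        Nat.add_sub_cancel]
      generalize H.op * S z = P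
      generalize H.op * g z = Q
      match_scalars <;> ring_nf <;> simp [Complex.I_sq]; ring
    calc layersGen H F z - H.op = (layersGen H F z - H.op) * (S z * V z) := by
          rw [hSV, Matrix.mul_one]
      _ = _ := by rw [← Matrix.mul_assoc, key, hh, Matrix.smul_mul]
  have hb : ∀ᶠ z in 𝓝 (0 : ℝ), wnorm μ (h z) < wnorm μ (h 0) + 1 :=
    (((continuous_wnorm μ).continuousAt.comp hc).eventually_lt continuousAt_const
      (by simp))
  refine ⟨wnorm μ (h 0) + 1, ?_⟩
  filter_upwards [hE.filter_mono nhdsWithin_le_nhds, hb.filter_mono nhdsWithin_le_nhds,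
    self_mem_nhdsWithin] with z h1 h2 h3
  have h3 : 0 < z := h3
  rw [h1, wnorm_real_smul, abs_of_nonneg (by positivity), mul_comm]
  gcongr

/-- The generator of the Trotter formula of order `p` differs from the Hamiltonian by a
multiple of the nested commutator norm. -/
theorem layersGen_trotter_error (Γ p kh : ℕ) (a κ T : ℝ) (hp : p = 1 ∨ (Even p ∧ 2 ≤ p))
    (hκ : 2 * |a| * Γ * Real.exp (3 * kh) ≤ κ) (hT : 0 < T)
    (hF : κ * (layerTime (trotterFactors Γ p 1) * T) ≤ 1) :
    ∃ C : ℝ, 0 ≤ C ∧ ∀ (n : ℕ) (H : LayeredHamiltonian n Γ), H.IsLocal kh a →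
      ∀ z ∈ Set.Icc 0 T, wnorm 1 (layersGen H (trotterFactors Γ p 1) z - H.op)
        ≤ C * z ^ p * commNorm H p := by
  obtain ⟨C, hC, h⟩ := layersGen_expansion Γ p kh a κ T hκ hT.le (trotterFactors Γ p 1) []
    (by simpa [layerTime] using hF)
  refine ⟨C, hC, fun n H hH z hz => ?_⟩
  obtain ⟨f, hf, hfb⟩ := h n H hH
  have hp0 : 0 < p := by omega
  have hmem : (f - fun z => z ^ 0 • H.op) ∈ polyLT n p :=
    Submodule.sub_mem _ hf (monomial_mem_polyLT hp0 H.op)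
  obtain ⟨X, hX⟩ := approx_trotter H hp
  have e : (fun z => layersProd H (trotterFactors Γ p z))
      = fun z => layersProd H (scaleLayers (trotterFactors Γ p 1) z) :=
    funext fun z => by rw [trotterFactors_eq_scale p z]
  rw [e] at hX
  obtain ⟨K, hK⟩ := layersGen_sub_isBigO hX 1
  -- The polynomial part minus `H` has degree less than `p` and is `O(z ^ p)`, so it vanishes. The
  -- constant `K`, uncontrolled in `n`, disappears here and only the uniform `C` survives.
  have hzero := eq_zero_of_mem_polyLT hmem (μ := 1) (K := K + C * commNorm H p) (by
    filter_upwards [hK, Ioc_mem_nhdsGT hT] with z h1 h2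
    have h3 := hfb z ⟨h2.1.le, h2.2⟩
    have e : (f - (fun z => z ^ 0 • H.op) : ℝ → Op n) z
        = (layersGen H (trotterFactors Γ p 1) z - H.op)
          - (layersGen H (trotterFactors Γ p 1) z - f z) := by
      simp only [Pi.sub_apply, pow_zero, one_smul]; abel
    rw [e]
    refine (wnorm_sub_le _ _ _).trans ?_
    have h3 : wnorm 1 (layersGen H (trotterFactors Γ p 1) z - f z) ≤ C * z ^ p * commNorm H p := h3
    linarith) z
  have hfz : f z = H.op := by
    have := sub_eq_zero.1 hzero
    simpa using this
  have := hfb z hz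
  rw [hfz] at this
  exact this

/-! ### The Trotter error -/

/-- The conjugate transpose as a real linear map. -/
def conjTransposeₗ (n : ℕ) : Op n →ₗ[ℝ] Op n where
  toFun A := Aᴴ
  map_add' A B := Matrix.conjTranspose_add A B
  map_smul' c A := by simp

theorem hasDerivAt_conjTranspose {A : ℝ → Op n} {A' : Op n} {s : ℝ} (h : HasDerivAt A A' s) :
    HasDerivAt (fun s => (A s)ᴴ) A'ᴴ s :=
  (LinearMap.toContinuousLinearMap (conjTransposeₗ n)).hasFDerivAt.comp_hasDerivAt s h

theorem interaction_deriv_aux (S' G B K S : Op n) :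
    (Complex.I • (S' * G) * B + S' * -(Complex.I • (K * B - B * K))) * S
        + S' * B * ((-Complex.I) • (G * S))
      = S' * (Complex.I • ((G - K) * B - B * (G - K))) * S := by
  simp only [Matrix.sub_mul, Matrix.mul_sub, Matrix.add_mul, Matrix.smul_mul,
    Matrix.mul_smul, smul_sub, Matrix.mul_neg, Matrix.neg_mul, neg_smul, Matrix.mul_assoc]
  abel

/-- Duhamel: interpolate by exact evolution for time `s - z` followed by the formula for time `z`.
The derivative is a conjugated commutator with the difference of the generators; conjugation
preserves the Pauli norm, and `pauliNorm_mul_le` bounds the commutator. -/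
theorem heisLayers_sub_heis_le (F : List (Fin Γ × ℝ)) {M B s : ℝ}
    (hs : 0 ≤ s) (A : Op n) (hM0 : 0 ≤ M)
    (hM : ∀ z ∈ Set.Icc 0 s, wnorm 1 (layersGen H F z - H.op) ≤ M)
    (hB : ∀ z ∈ Set.Icc 0 s, wnorm 1 (heis H.op z A) ≤ B) :
    pauliNorm (heisLayers H (scaleLayers F s) A - heis H.op s A) ≤ 2 * M * B * s := by
  set S : ℝ → Op n := fun z => layersProd H (scaleLayers F z) with hS
  set f : ℝ → Op n := fun z => (S z)ᴴ * heis H.op (s - z) A * S z with hf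
  set E : ℝ → Op n := fun z => layersGen H F z - H.op with hE
  have hder : ∀ z, HasDerivAt f (heisLayers H (scaleLayers F z)
      (Complex.I • (E z * heis H.op (s - z) A - heis H.op (s - z) A * E z))) z := by
    intro z
    have d1 := hasDerivAt_layersProd (H := H) F z
    have d2 : HasDerivAt (fun z => (S z)ᴴ) (Complex.I • ((S z)ᴴ * layersGen H F z)) z := by
      refine (hasDerivAt_conjTranspose d1).congr_deriv ?_
      rw [Matrix.conjTranspose_smul, Matrix.conjTranspose_mul,
        (layersGen_isHermitian F z).eq]
      simp [hS]
    have d3 : HasDerivAt (fun z => heis H.op (s - z) A)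
        (-(Complex.I • (H.op * heis H.op (s - z) A - heis H.op (s - z) A * H.op))) z := by
      have := (hasDerivAt_heis H.op A (s - z)).scomp z ((hasDerivAt_id z).const_sub s)
      refine this.congr_deriv ?_
      rw [neg_one_smul, heis_smul_right, heis_commutator]
    refine ((d2.mul d3).mul d1).congr_deriv ?_
    rw [heisLayers_eq]
    exact interaction_deriv_aux _ _ _ _ _
  have hmain := wnorm_sub_le_of_deriv (μ := 0) (T := s) (C := 2 * M * B) hder (fun z hz => by
    rw [wnorm_zero_left, pauliNorm_heisLayers, ← wnorm_zero_left, wnorm_smul, Complex.norm_I,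
      one_mul, wnorm_zero_left]
    have h1 := hM z ⟨hz.1, hz.2.le⟩
    have h2 := hB (s - z) ⟨by linarith [hz.2], by linarith [hz.1]⟩
    have h3 : wnorm 1 (E z) * wnorm 1 (heis H.op (s - z) A) ≤ M * B :=
      mul_le_mul h1 h2 (wnorm_nonneg _ _) hM0
    have h4 := pauliNorm_mul_le (E z) (heis H.op (s - z) A)
    have h5 := pauliNorm_mul_le (heis H.op (s - z) A) (E z)
    have h6 := pauliNorm_sub_le (E z * heis H.op (s - z) A) (heis H.op (s - z) A * E z)
    linarith) hs
  have e1 : f s = heisLayers H (scaleLayers F s) A := by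
    rw [heisLayers_eq, hf]; simp [heis_zero, hS]
  have e0 : f 0 = heis H.op s A := by
    simp [hf, hS, layersProd_scale_zero]
  rwa [e1, e0, wnorm_zero_left] at hmain

theorem exactOp_eq (O : PauliTable n) (t : ℝ) : exactOp H O t = heis H.op t O.op := rfl

/-- Telescopes with exact evolution first and product formulas after it: the exact part keeps a
bounded weighted norm up to time `T`, and the later steps preserve the Pauli norm, so the errors
simply add. -/
theorem trotter_error_le (Γ p kh : ℕ) (a κ T : ℝ) (hp : p = 1 ∨ (Even p ∧ 2 ≤ p))
    (hκ : 2 * |a| * Γ * Real.exp (3 * kh) ≤ κ) (hT : 0 < T)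
    (hF : κ * (layerTime (trotterFactors Γ p 1) * T) ≤ 1) (hκT : κ * T ≤ 1) :
    ∃ C : ℝ, 0 ≤ C ∧ ∀ (n : ℕ) (H : LayeredHamiltonian n Γ) (O : PauliTable n), H.IsLocal kh a →
      ∀ (t : ℝ) (r : ℕ), 0 < t → t ≤ T → 1 ≤ r →
        pauliNorm (trotterOp H O p t r - exactOp H O t)
          ≤ C * (t / r) ^ p * t * commNorm H p * wnorm 2 O.op := by
  obtain ⟨C, hC, h⟩ := layersGen_trotter_error Γ p kh a κ T hp hκ hT hF
  have hκ0 : 0 ≤ κ := le_trans (by positivity) hκ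
  refine ⟨2 * C, by positivity, fun n H O hH t r ht htT hr => ?_⟩
  have hr0 : (0 : ℝ) < r := by exact_mod_cast hr
  have hr1 : (1 : ℝ) ≤ r := by exact_mod_cast hr
  set s := t / r with hs
  have hs0 : 0 < s := div_pos ht hr0
  have hsr : s * r = t := div_mul_cancel₀ t hr0.ne'
  have hst : s ≤ t := div_le_self ht.le hr1
  set F := trotterFactors Γ p 1 with hF'
  have hΛ : 0 ≤ commNorm H p := commNorm_nonneg p
  have hheis : ∀ τ ∈ Set.Icc 0 t, wnorm 1 (heis H.op τ O.op) ≤ wnorm 2 O.op := by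
    intro τ hτ
    refine LayeredHamiltonian.wnorm_heis_op_le (κ := κ) hH zero_le_one ?_ ?_ _
    · rw [abs_of_nonneg hτ.1]
      have : κ * τ ≤ κ * T := by
        have := hτ.2.trans htT
        gcongr
      linarith
    · refine le_trans ?_ hκ
      gcongr
      norm_num
  have step : ∀ d : ℕ, d + 1 ≤ r → pauliNorm (heisLayers H (trotterFactors Γ p s)
      (heis H.op (d * s) O.op) - heis H.op s (heis H.op (d * s) O.op))
      ≤ 2 * (C * s ^ p * commNorm H p) * wnorm 2 O.op * s := by
    intro d hd
    rw [trotterFactors_eq_scale p s]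
    refine heisLayers_sub_heis_le F hs0.le _ (by positivity) (fun z hz => ?_) fun z hz => ?_
    · refine (h n H hH z ⟨hz.1, hz.2.trans (hst.trans htT)⟩).trans ?_
      have h1 := hz.1
      have h2 := hz.2
      gcongr
    · rw [← heis_add]
      refine hheis _ ⟨add_nonneg hz.1 (by positivity), ?_⟩
      have : ((d : ℝ) + 1) ≤ r := by exact_mod_cast hd
      have := mul_le_mul_of_nonneg_right this hs0.le
      have := hz.2
      linarith
  have main : ∀ d : ℕ, d ≤ r → pauliNorm ((heisLayers H (trotterFactors Γ p s))^[d] O.op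
      - heis H.op (d * s) O.op) ≤ 2 * (C * s ^ p * commNorm H p) * wnorm 2 O.op * s * d := by
    intro d
    induction d with
    | zero =>
      intro _
      simp [heis_zero, ← wnorm_zero_left, wnorm_zero]
    | succ d ih =>
      intro hd
      have e : (heisLayers H (trotterFactors Γ p s))^[d + 1] O.op
          - heis H.op ((d + 1 : ℕ) * s) O.op
          = heisLayers H (trotterFactors Γ p s) ((heisLayers H (trotterFactors Γ p s))^[d] O.op
            - heis H.op (d * s) O.op) + (heisLayers H (trotterFactors Γ p s)
            (heis H.op (d * s) O.op) - heis H.op s (heis H.op (d * s) O.op)) := by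
        rw [Function.iterate_succ_apply', heisLayers_sub, ← heis_add]
        have : ((d + 1 : ℕ) : ℝ) * s = s + d * s := by push_cast; ring
        rw [this]; abel
      rw [e]
      refine (pauliNorm_add_le _ _).trans ?_
      rw [pauliNorm_heisLayers]
      have i1 := ih (by omega)
      have i2 := step d hd
      push_cast
      linarith
  have hfin := main r le_rfl
  have hrs : (r : ℝ) * s = t := by rw [mul_comm]; exact hsr
  rw [hrs] at hfin
  rw [trotterOp_eq_iterate, exactOp_eq]
  refine hfin.trans (le_of_eq ?_)
  rw [← hsr]; ring

end LowWeightPauli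
end

noncomputable section
namespace LowWeightPauli

variable {n : ℕ}

open scoped ComplexOrder

/-! ### Expectation values and the operator norm -/

theorem opNorm_nonneg (A : Op n) : 0 ≤ opNorm A := norm_nonneg _

theorem norm_dotProduct_mulVec_le (A : Op n) (v : Bits (Fin n) → ℂ) :
    ‖star v ⬝ᵥ A *ᵥ v‖ ≤ opNorm A * ∑ b, ‖v b‖ ^ 2 := by
  set x : EuclideanSpace ℂ (Bits (Fin n)) := WithLp.toLp 2 v with hx
  have h1 : star v ⬝ᵥ A *ᵥ v = inner ℂ x (Matrix.toEuclideanCLM (𝕜 := ℂ) A x) := by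
    rw [hx, Matrix.toEuclideanCLM_toLp, EuclideanSpace.inner_toLp_toLp, dotProduct_comm]
  have h2 : ∑ b, ‖v b‖ ^ 2 = ‖x‖ ^ 2 := by rw [EuclideanSpace.norm_sq_eq]
  rw [h1, h2]
  refine (norm_inner_le_norm _ _).trans ?_
  have := (Matrix.toEuclideanCLM (𝕜 := ℂ) A).le_opNorm x
  calc ‖x‖ * ‖Matrix.toEuclideanCLM (𝕜 := ℂ) A x‖ ≤ ‖x‖ * (opNorm A * ‖x‖) := by
        gcongr; exact this
    _ = _ := by ring

theorem opNorm_mul_le (A B : Op n) : opNorm (A * B) ≤ opNorm A * opNorm B := by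
  rw [opNorm, map_mul]; exact norm_mul_le _ _

theorem opNorm_conjTranspose (A : Op n) : opNorm Aᴴ = opNorm A := by
  rw [opNorm, ← Matrix.star_eq_conjTranspose, map_star, ContinuousLinearMap.star_eq_adjoint]
  exact LinearIsometryEquiv.norm_map ContinuousLinearMap.adjoint _

theorem trace_density_mul (ψ : Bits (Fin n) → ℂ) (A : Op n) :
    (density ψ * A).trace = star ψ ⬝ᵥ A *ᵥ ψ := by
  rw [density, Matrix.trace_mul_comm, Matrix.mul_vecMulVec, Matrix.trace_vecMulVec,
    dotProduct_comm]

theorem norm_trace_density_mul_le {ψ : Bits (Fin n) → ℂ} (hψ : ∑ b, ‖ψ b‖ ^ 2 = 1) (A : Op n) :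
    ‖(density ψ * A).trace‖ ≤ opNorm A := by
  rw [trace_density_mul]
  have := norm_dotProduct_mulVec_le A ψ
  rwa [hψ, mul_one] at this

/-- Cauchy–Schwarz for the vectors `ψ` and `A ψ`. -/
theorem norm_trace_density_mul_sq_le {ψ : Bits (Fin n) → ℂ} (hψ : ∑ b, ‖ψ b‖ ^ 2 = 1)
    (A : Op n) : ‖(density ψ * A).trace‖ ^ 2 ≤ ‖(density ψ * (Aᴴ * A)).trace‖ := by
  set x : EuclideanSpace ℂ (Bits (Fin n)) := WithLp.toLp 2 ψ with hx
  have hx1 : ‖x‖ = 1 := by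
    have : ‖x‖ ^ 2 = 1 := by rw [EuclideanSpace.norm_sq_eq]; exact hψ
    nlinarith [norm_nonneg x]
  have h1 : star ψ ⬝ᵥ A *ᵥ ψ = inner ℂ x (WithLp.toLp 2 (A *ᵥ ψ)) := by
    rw [hx, EuclideanSpace.inner_toLp_toLp, dotProduct_comm]
  have h2 : star ψ ⬝ᵥ (Aᴴ * A) *ᵥ ψ
      = inner ℂ (WithLp.toLp 2 (A *ᵥ ψ)) (WithLp.toLp 2 (A *ᵥ ψ)) := by
    rw [EuclideanSpace.inner_toLp_toLp, Matrix.star_mulVec, ← Matrix.mulVec_mulVec,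
      Matrix.dotProduct_mulVec, dotProduct_comm]
  rw [trace_density_mul, trace_density_mul, h1, h2, inner_self_eq_norm_sq_to_K, norm_pow]
  have h3 := norm_inner_le_norm (𝕜 := ℂ) x (WithLp.toLp 2 (A *ᵥ ψ))
  rw [hx1, one_mul] at h3
  simpa using pow_le_pow_left₀ (norm_nonneg _) h3 2

theorem pauliNorm_le_opNorm (A : Op n) : pauliNorm A ≤ opNorm A := by
  have h1 : ∀ b, ((Aᴴ * A) b b).re ≤ opNorm A ^ 2 := by
    intro b
    have h2 := norm_dotProduct_mulVec_le (Aᴴ * A) (Pi.single b 1)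
    have h3 : star (Pi.single b (1 : ℂ)) ⬝ᵥ (Aᴴ * A) *ᵥ Pi.single b 1 = (Aᴴ * A) b b := by
      simp
    have h4 : ∑ b', ‖(Pi.single b (1 : ℂ) : Bits (Fin n) → ℂ) b'‖ ^ 2 = 1 := by
      rw [Finset.sum_eq_single b]
      · simp
      · intro b' _ h; simp [h]
      · simp
    rw [h3, h4, mul_one] at h2
    refine (Complex.re_le_norm _).trans (h2.trans ((opNorm_mul_le _ _).trans ?_))
    rw [opNorm_conjTranspose, sq]
  rw [pauliNorm, Real.sqrt_le_left (opNorm_nonneg A), div_le_iff₀ (by positivity), Matrix.trace,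
    Complex.re_sum]
  refine (Finset.sum_le_sum fun b _ => h1 b).trans (le_of_eq ?_)
  simp [mul_comm]

/-! ### Entropy and the distance from the maximally mixed state -/

/-- This is `log y ≤ y - 1` at `y = √q / √x`; summed up, it bounds the squared Hellinger distance by
the relative entropy. -/
theorem sqrt_sub_sq_le_relative_entropy {x q : ℝ} (hx : 0 ≤ x) (hq : 0 < q) :
    (√x - √q) ^ 2 ≤ -Real.negMulLog x - x * Real.log q - x + q := by
  rcases hx.eq_or_lt with rfl | hx
  · simp [Real.sq_sqrt hq.le]
  · have h1 := Real.log_le_sub_one_of_pos (show 0 < √q / √x by positivity)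
    rw [Real.log_div (by positivity) (by positivity), Real.log_sqrt hq.le,
      Real.log_sqrt hx.le] at h1
    have h2 : x * (√q / √x) = √x * √q := by
      rw [← mul_div_assoc, div_eq_iff (by positivity)]
      linear_combination (-√q) * Real.mul_self_sqrt hx.le
    have h3 := mul_le_mul_of_nonneg_left h1 hx.le
    rw [mul_sub x (√q / √x), h2] at h3
    rw [Real.negMulLog]
    nlinarith [Real.sq_sqrt hx.le, Real.sq_sqrt hq.le]

/-- The distance of a probability vector from the uniform one in terms of its entropy. -/
theorem sum_abs_sub_uniform_sq_le {ι : Type*} [Fintype ι] [Nonempty ι] (x : ι → ℝ)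
    (hx : ∀ i, 0 ≤ x i) (h1 : ∑ i, x i = 1) :
    (∑ i, |x i - 1 / Fintype.card ι|) ^ 2
      ≤ 4 * (Real.log (Fintype.card ι) - ∑ i, Real.negMulLog (x i)) := by
  set q : ℝ := 1 / Fintype.card ι with hq
  have hd : (0 : ℝ) < Fintype.card ι := by exact_mod_cast Fintype.card_pos
  have hq0 : 0 < q := by positivity
  have hsum : ∑ _i : ι, q = 1 := by
    rw [Finset.sum_const, Finset.card_univ, nsmul_eq_mul, hq]; field_simp
  -- This factorization and Cauchy–Schwarz lead from the Hellinger to the `ℓ¹` distance; the second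
  -- factor contributes the constant 4.
  have e : ∀ i, |x i - q| = |√(x i) - √q| * (√(x i) + √q) := by
    intro i
    have : x i - q = (√(x i) - √q) * (√(x i) + √q) := by
      nlinarith [Real.sq_sqrt (hx i), Real.sq_sqrt hq0.le]
    rw [this, abs_mul, abs_of_nonneg (a := √(x i) + √q) (by positivity)]
  simp only [e]
  refine (Finset.sum_mul_sq_le_sq_mul_sq _ _ _).trans ?_
  have ha : ∑ i, |√(x i) - √q| ^ 2 ≤ Real.log (Fintype.card ι) - ∑ i, Real.negMulLog (x i) := by
    refine (Finset.sum_le_sum fun i _ => (sq_abs (√(x i) - √q)).le.trans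
      (sqrt_sub_sq_le_relative_entropy (hx i) hq0)).trans (le_of_eq ?_)
    rw [Finset.sum_add_distrib, Finset.sum_sub_distrib, Finset.sum_sub_distrib, ← Finset.sum_mul,
      h1, hsum, Finset.sum_neg_distrib, hq, one_div, Real.log_inv]
    ring
  have hb : ∑ i, (√(x i) + √q) ^ 2 ≤ 4 := by
    have : ∀ i, (√(x i) + √q) ^ 2 ≤ 2 * x i + 2 * q := by
      intro i
      nlinarith [Real.sq_sqrt (hx i), Real.sq_sqrt hq0.le, sq_nonneg (√(x i) - √q)]
    refine (Finset.sum_le_sum fun i _ => this i).trans (le_of_eq ?_)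
    rw [Finset.sum_add_distrib, ← Finset.mul_sum, ← Finset.mul_sum, h1, hsum]
    norm_num
  have h0 : 0 ≤ ∑ i, |√(x i) - √q| ^ 2 := Finset.sum_nonneg fun i _ => by positivity
  nlinarith

/-- The trace of a product with a Hermitian matrix with spectrum close to a constant. -/
theorem norm_trace_mul_sub_le {ι : Type*} [Fintype ι] [DecidableEq ι] {R : Matrix ι ι ℂ}
    (hR : R.IsHermitian) (Y : Matrix ι ι ℂ) {K : ℝ}
    (hY : ∀ v : ι → ℂ, ∑ i, ‖v i‖ ^ 2 = 1 → ‖star v ⬝ᵥ Y *ᵥ v‖ ≤ K) (c : ℝ) :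
    ‖(R * Y).trace - c * Y.trace‖ ≤ K * ∑ i, |hR.eigenvalues i - c| := by
  set U : Matrix ι ι ℂ := hR.eigenvectorUnitary.1 with hU
  have hUU : star U * U = 1 := Unitary.coe_star_mul_self hR.eigenvectorUnitary
  have hUU' : U * star U = 1 := Unitary.coe_mul_star_self hR.eigenvectorUnitary
  have hspec : R = U * Matrix.diagonal (RCLike.ofReal ∘ hR.eigenvalues) * star U := by
    have := hR.spectral_theorem
    rwa [Unitary.conjStarAlgAut_apply] at this
  -- In an eigenbasis of `R` only the diagonal of `Y` matters, and its entries are expectation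
  -- values of `Y` in unit vectors.
  set W : Matrix ι ι ℂ := star U * Y * U with hW
  have h1 : (R * Y).trace = ∑ i, (hR.eigenvalues i : ℂ) * W i i := by
    conv_lhs => rw [hspec]
    rw [Matrix.mul_assoc, Matrix.mul_assoc, Matrix.trace_mul_comm, Matrix.mul_assoc, ← hW,
      Matrix.trace]
    refine Finset.sum_congr rfl fun i _ => ?_
    rw [Matrix.diag_apply, Matrix.diagonal_mul]; rfl
  have h2 : Y.trace = ∑ i, W i i := by
    have : Y.trace = W.trace := by
      rw [hW, Matrix.mul_assoc, Matrix.trace_mul_comm, Matrix.mul_assoc, hUU', Matrix.mul_one]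
    rw [this]; rfl
  have h3 : ∀ i, ‖W i i‖ ≤ K := by
    intro i
    have hv : ∑ j, ‖U j i‖ ^ 2 = 1 := by
      have h4 : (star U * U) i i = 1 := by rw [hUU, Matrix.one_apply_eq]
      rw [Matrix.mul_apply] at h4
      have h5 : ((∑ j, ‖U j i‖ ^ 2 : ℝ) : ℂ) = 1 := by
        rw [← h4]
        push_cast
        refine Finset.sum_congr rfl fun j _ => ?_
        rw [Matrix.star_apply, Complex.star_def, mul_comm, Complex.mul_conj,
          Complex.normSq_eq_norm_sq]
        push_cast; rfl
      exact_mod_cast h5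
    have h6 : W i i = star (fun j => U j i) ⬝ᵥ Y *ᵥ fun j => U j i := by
      rw [hW, Matrix.mul_assoc, Matrix.mul_apply]
      rfl
    rw [h6]
    exact hY _ hv
  rw [h1, h2, Finset.mul_sum, ← Finset.sum_sub_distrib, Finset.mul_sum]
  refine (norm_sum_le _ _).trans (Finset.sum_le_sum fun i _ => ?_)
  rw [← sub_mul, norm_mul, mul_comm]
  have : ‖(hR.eigenvalues i : ℂ) - (c : ℂ)‖ = |hR.eigenvalues i - c| := by
    rw [← Complex.ofReal_sub, Complex.norm_real, Real.norm_eq_abs]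
  rw [this]
  exact mul_le_mul_of_nonneg_right (h3 i) (abs_nonneg _)

/-! ### Reduced states -/

theorem sum_glue {M : Type*} [AddCommMonoid M] (A : Finset (Fin n)) (f : Bits (Fin n) → M) :
    ∑ x, f x = ∑ a, ∑ c, f (glue A a c) := by
  rw [← Fintype.sum_prod_type']
  exact (Fintype.sum_equiv (Equiv.piEquivPiSubtypeProd (fun q => q ∈ A) fun _ => Fin 2).symm
    (fun x => f (glue A x.1 x.2)) f fun x => rfl).symm

theorem mat_glue {A : Finset (Fin n)} {P : PauliString n} (hP : P.supp ⊆ A)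
    (a b : Bits {q // q ∈ A}) (c c' : Bits {q // q ∉ A}) :
    P.mat (glue A a c) (glue A b c')
      = if c = c' then ∏ q : {q // q ∈ A}, (P q).mat (a q) (b q) else 0 := by
  rw [PauliString.mat_apply, ← Fintype.prod_subtype_mul_prod_subtype fun q => q ∈ A]
  have h1 : ∏ q : {q // q ∈ A}, (P q).mat (glue A a c q) (glue A b c' q)
      = ∏ q : {q // q ∈ A}, (P q).mat (a q) (b q) := by
    refine Finset.prod_congr rfl fun q _ => ?_
    simp [glue, q.2]
  have h2 : ∏ q : {q // ¬ q ∈ A}, (P q).mat (glue A a c q) (glue A b c' q)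
      = if c = c' then 1 else 0 := by
    have h3 : ∀ q : {q // ¬ q ∈ A}, (P q).mat (glue A a c q) (glue A b c' q)
        = if c q = c' q then 1 else 0 := by
      intro q
      have hI : P q = Letter.I := by
        by_contra h
        exact q.2 (hP (PauliString.mem_supp.2 h))
      have h4 : ∀ i j : Fin 2, Letter.I.mat i j = if i = j then 1 else 0 := by
        intro i j; fin_cases i <;> fin_cases j <;> simp [Letter.mat]
      rw [hI, h4]
      simp [glue, q.2]
    simp only [h3]
    split_ifs with h
    · simp [h]
    · obtain ⟨q, hq⟩ := Function.ne_iff.1 h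
      exact Finset.prod_eq_zero (Finset.mem_univ q) (if_neg hq)
  refine (congrArg₂ (· * ·) (Eq.trans (by congr!) h1) h2).trans ?_
  split_ifs <;> simp

/-- The matrix on the qubits in `A` of an operator supported on `A`. -/
def localMatrix (X : Op n) (A : Finset (Fin n)) :
    Matrix (Bits {q // q ∈ A}) (Bits {q // q ∈ A}) ℂ :=
  Matrix.of fun a b => X (glue A a 0) (glue A b 0)

/-- All Pauli strings of `X` are the identity outside `A`, so `X` is the tensor product of its local
matrix and the identity. -/
theorem apply_glue {X : Op n} {A : Finset (Fin n)} (hX : opSupp X ⊆ A)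
    (a b : Bits {q // q ∈ A}) (c c' : Bits {q // q ∉ A}) :
    X (glue A a c) (glue A b c') = if c = c' then localMatrix X A a b else 0 := by
  have h : ∀ c c' : Bits {q // q ∉ A}, X (glue A a c) (glue A b c') = if c = c' then
      ∑ P, pauliCoeff X P * ∏ q : {q // q ∈ A}, (P q).mat (a q) (b q) else 0 := by
    intro c c'
    conv_lhs => rw [← sum_pauliCoeff_smul_mat X]
    rw [Matrix.sum_apply]
    have : ∀ P, (pauliCoeff X P • P.mat) (glue A a c) (glue A b c') = if c = c' then
        pauliCoeff X P * ∏ q : {q // q ∈ A}, (P q).mat (a q) (b q) else 0 := by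
      intro P
      rw [Matrix.smul_apply, smul_eq_mul]
      by_cases hP : pauliCoeff X P = 0
      · simp [hP]
      · rw [mat_glue]
        · split_ifs <;> simp
        · intro q hq
          exact hX (Finset.mem_filter.2 ⟨Finset.mem_univ _, P, hP, hq⟩)
    simp only [this]
    split_ifs <;> simp
  rw [h, localMatrix, Matrix.of_apply, h, if_pos rfl]

theorem trace_density_mul_eq_reduced (ψ : Bits (Fin n) → ℂ) {X : Op n} {A : Finset (Fin n)}
    (hX : opSupp X ⊆ A) : (density ψ * X).trace = (reduced ψ A * localMatrix X A).trace := by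
  simp only [Matrix.trace, Matrix.diag, Matrix.mul_apply]
  rw [sum_glue A]
  refine Finset.sum_congr rfl fun a _ => ?_
  have : ∀ c : Bits {q // q ∉ A}, ∑ y, density ψ (glue A a c) y * X y (glue A a c)
      = ∑ b, density ψ (glue A a c) (glue A b c) * localMatrix X A b a := by
    intro c
    rw [sum_glue A]
    refine Finset.sum_congr rfl fun b _ => ?_
    simp [apply_glue hX]
  simp only [this]
  rw [Finset.sum_comm]
  refine Finset.sum_congr rfl fun b _ => ?_
  rw [← Finset.sum_mul]; rfl

theorem card_bits_compl (A : Finset (Fin n)) :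
    (2 : ℂ) ^ A.card * Fintype.card (Bits {q // q ∉ A}) = 2 ^ n := by
  have h1 : Fintype.card (Bits (Fin n))
      = Fintype.card (Bits {q // q ∈ A}) * Fintype.card (Bits {q // q ∉ A}) := by
    rw [← Fintype.card_prod]
    exact Fintype.card_congr (Equiv.piEquivPiSubtypeProd (fun q => q ∈ A) fun _ => Fin 2)
  have h2 : Fintype.card (Bits {q // q ∈ A}) = 2 ^ A.card := by simp
  have h3 : Fintype.card (Bits (Fin n)) = 2 ^ n := by simp
  rw [h2, h3] at h1
  exact_mod_cast h1.symm

theorem trace_eq_localMatrix {X : Op n} {A : Finset (Fin n)} (hX : opSupp X ⊆ A) :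
    X.trace / 2 ^ n = (1 / 2 ^ A.card : ℝ) * (localMatrix X A).trace := by
  have : X.trace = Fintype.card (Bits {q // q ∉ A}) * (localMatrix X A).trace := by
    simp only [Matrix.trace, Matrix.diag]
    rw [sum_glue A, Finset.mul_sum]
    refine Finset.sum_congr rfl fun a _ => ?_
    simp [apply_glue hX]
  rw [this, ← card_bits_compl A]
  have h : (Fintype.card (Bits {q // q ∉ A}) : ℂ) ≠ 0 := by
    exact_mod_cast Fintype.card_ne_zero
  push_cast
  field_simp

/-- Padding `v` with the zero basis state outside `A` exhibits the local matrix as a compression of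
`X`. -/
theorem norm_localMatrix_form_le (X : Op n) (A : Finset (Fin n)) (v : Bits {q // q ∈ A} → ℂ)
    (hv : ∑ a, ‖v a‖ ^ 2 = 1) : ‖star v ⬝ᵥ localMatrix X A *ᵥ v‖ ≤ opNorm X := by
  set e := Equiv.piEquivPiSubtypeProd (fun q : Fin n => q ∈ A) fun _ => Fin 2 with he
  set u : Bits (Fin n) → ℂ := fun x => if (e x).2 = 0 then v (e x).1 else 0 with hu
  have hug : ∀ a c, u (glue A a c) = if c = 0 then v a else 0 := by
    intro a c
    have : e (glue A a c) = (a, c) := e.apply_symm_apply (a, c)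
    rw [hu]
    simp only [this]
  have h1 : ∑ x, ‖u x‖ ^ 2 = 1 := by
    rw [sum_glue A, ← hv]
    refine Finset.sum_congr rfl fun a _ => ?_
    rw [Finset.sum_eq_single 0]
    · simp [hug]
    · intro c _ hc; simp [hug, hc]
    · simp
  have h2 : star u ⬝ᵥ X *ᵥ u = star v ⬝ᵥ localMatrix X A *ᵥ v := by
    simp only [dotProduct, Matrix.mulVec]
    rw [sum_glue A]
    refine Finset.sum_congr rfl fun a _ => ?_
    rw [Finset.sum_eq_single 0]
    · rw [sum_glue A]
      simp only [Pi.star_apply, hug, if_true]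
      congr 1
      refine Finset.sum_congr rfl fun b _ => ?_
      rw [Finset.sum_eq_single 0]
      · simp [localMatrix]
      · intro c _ hc; simp [hc]
      · simp
    · intro c _ hc; simp [hug, hc]
    · simp
  have := norm_dotProduct_mulVec_le X u
  rwa [h1, mul_one, h2] at this

theorem reduced_posSemidef (ψ : Bits (Fin n) → ℂ) (A : Finset (Fin n)) :
    (reduced ψ A).PosSemidef := by
  have : reduced ψ A = ∑ c : Bits {q // q ∉ A}, Matrix.vecMulVec (fun a => ψ (glue A a c))
      (star fun a => ψ (glue A a c)) := by
    ext a b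
    simp [reduced, density, Matrix.sum_apply, Matrix.vecMulVec_apply]
  rw [this]
  exact Matrix.posSemidef_sum _ fun c _ => Matrix.posSemidef_vecMulVec_self_star _

theorem reduced_eigenvalues_sum {ψ : Bits (Fin n) → ℂ} (hψ : ∑ b, ‖ψ b‖ ^ 2 = 1)
    (A : Finset (Fin n)) : ∑ i, (reduced_isHermitian ψ A).eigenvalues i = 1 := by
  have h1 := (reduced_isHermitian ψ A).trace_eq_sum_eigenvalues
  have h2 : (reduced ψ A).trace = 1 := by
    have : (reduced ψ A).trace = ((∑ b, ‖ψ b‖ ^ 2 : ℝ) : ℂ) := by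
      rw [sum_glue A]
      push_cast
      simp only [Matrix.trace, Matrix.diag, reduced, Matrix.of_apply, density,
        Matrix.vecMulVec_apply]
      refine Finset.sum_congr rfl fun a _ => Finset.sum_congr rfl fun c _ => ?_
      rw [Pi.star_apply, Complex.star_def, Complex.mul_conj, Complex.normSq_eq_norm_sq]
      push_cast; rfl
    rw [this, hψ, Complex.ofReal_one]
  rw [h2] at h1
  have h3 : ((∑ i, (reduced_isHermitian ψ A).eigenvalues i : ℝ) : ℂ) = 1 := by
    rw [h1]; push_cast; rfl
  exact_mod_cast h3

/-- If the reduced state on the support of `X` has almost maximal entropy, the expectation value of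
`X` is close to its normalized trace. -/
theorem norm_trace_density_sub_le {ψ : Bits (Fin n) → ℂ} (hψ : ∑ b, ‖ψ b‖ ^ 2 = 1) (X : Op n)
    {δ : ℝ} (hδ : 0 ≤ δ) (h : ((opSupp X).card : ℝ) - 1 / 2 * δ ^ 2 ≤ entropy ψ (opSupp X)) :
    ‖(density ψ * X).trace - X.trace / 2 ^ n‖ ≤ 5 / 4 * opNorm X * δ := by
  set A := opSupp X with hA
  have hcard : Fintype.card (Bits {q // q ∈ A}) = 2 ^ A.card := by simp
  have h1 := norm_trace_mul_sub_le (reduced_isHermitian ψ A) (localMatrix X A)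
    (norm_localMatrix_form_le X A) (1 / 2 ^ A.card)
  have h2 := sum_abs_sub_uniform_sq_le (reduced_isHermitian ψ A).eigenvalues
    (fun i => (reduced_posSemidef ψ A).eigenvalues_nonneg i) (reduced_eigenvalues_sum hψ A)
  rw [hcard] at h2
  push_cast at h2
  rw [Real.log_pow] at h2
  rw [trace_density_mul_eq_reduced ψ (hA ▸ subset_rfl : opSupp X ⊆ A),
    trace_eq_localMatrix (hA ▸ subset_rfl : opSupp X ⊆ A)]
  refine h1.trans ?_
  have hlog : 0 < Real.log 2 := Real.log_pos one_lt_two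
  have hlog2 := Real.log_two_lt_d9
  rw [entropy, le_div_iff₀ hlog] at h
  -- The entropy is measured in bits, so the bound is `2 log 2 * δ ^ 2`, and `2 log 2 ≤ (5 / 4) ^
  -- 2`.
  have h3 : (∑ i, |(reduced_isHermitian ψ A).eigenvalues i - 1 / 2 ^ A.card|) ^ 2
      ≤ (5 / 4 * δ) ^ 2 := by
    refine h2.trans ?_
    nlinarith [sq_nonneg δ]
  have h4 := abs_le_of_sq_le_sq h3 (by positivity)
  have h5 := (le_abs_self _).trans h4
  have h6 := opNorm_nonneg X
  calc _ ≤ opNorm X * (5 / 4 * δ) := by gcongr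
    _ = _ := by ring

/-- A second-moment argument: `S† S` is expanded into the `B_j† B_j'`, on whose supports the state
is nearly maximally mixed, so its expectation value is close to the normalized trace `‖S‖₂²`. -/
theorem norm_trace_density_sum_le {J : ℕ} {ψ : Bits (Fin n) → ℂ} (hψ : ∑ b, ‖ψ b‖ ^ 2 = 1)
    (B : Fin J → Op n) (h : EntangledForTerms ψ B) :
    ‖(density ψ * ∑ j, B j).trace‖ ≤ 3 / 2 * pauliNorm (∑ j, B j) := by
  set X := pauliNorm (∑ j, B j) with hX
  set Y := ∑ j, opNorm (B j) with hY
  have hX0 : 0 ≤ X := pauliNorm_nonneg _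
  have hY0 : 0 ≤ Y := Finset.sum_nonneg fun j _ => opNorm_nonneg _
  -- The admitted entropy deficit is `δ ^ 2 / 2`, and the deviations add up to `5 / 4 * Y ^ 2 * δ`.
  set δ := X ^ 2 / Y ^ 2 with hδ
  have hδ0 : 0 ≤ δ := by positivity
  set S := ∑ j, B j with hS
  have hexp : Sᴴ * S = ∑ j, ∑ j', (B j)ᴴ * B j' := by
    rw [hS, Matrix.conjTranspose_sum, Finset.sum_mul]
    exact Finset.sum_congr rfl fun j _ => Finset.mul_sum _ _ _
  have hterm : ∀ j j', ‖(density ψ * ((B j)ᴴ * B j')).trace - ((B j)ᴴ * B j').trace / 2 ^ n‖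
      ≤ 5 / 4 * (opNorm (B j) * opNorm (B j')) * δ := by
    intro j j'
    refine (norm_trace_density_sub_le hψ _ hδ0 ?_).trans ?_
    · refine le_trans (le_of_eq ?_) (h j j')
      rw [hδ, div_pow, ← pow_mul, ← pow_mul, ← mul_div_assoc]
    · have := opNorm_mul_le (B j)ᴴ (B j')
      rw [opNorm_conjTranspose] at this
      gcongr
  have hdiff : ‖(density ψ * (Sᴴ * S)).trace - (Sᴴ * S).trace / 2 ^ n‖ ≤ 5 / 4 * X ^ 2 := by
    have e : (density ψ * (Sᴴ * S)).trace - (Sᴴ * S).trace / 2 ^ n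
        = ∑ j, ∑ j', ((density ψ * ((B j)ᴴ * B j')).trace
          - ((B j)ᴴ * B j').trace / 2 ^ n) := by
      rw [hexp, Finset.mul_sum, Matrix.trace_sum, Matrix.trace_sum, Finset.sum_div,
        ← Finset.sum_sub_distrib]
      refine Finset.sum_congr rfl fun j _ => ?_
      rw [Finset.mul_sum, Matrix.trace_sum, Matrix.trace_sum, Finset.sum_div,
        ← Finset.sum_sub_distrib]
    rw [e]
    have h1 : ∑ j, ∑ j', 5 / 4 * (opNorm (B j) * opNorm (B j')) * δ = 5 / 4 * (Y ^ 2 * δ) := by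
      have : Y ^ 2 = ∑ j, ∑ j', opNorm (B j) * opNorm (B j') := by
        rw [sq, hY, Finset.sum_mul_sum]
      rw [this, Finset.sum_mul, Finset.mul_sum]
      refine Finset.sum_congr rfl fun j _ => ?_
      rw [Finset.sum_mul, Finset.mul_sum]
      exact Finset.sum_congr rfl fun j' _ => by ring
    refine (norm_sum_le _ _).trans ((Finset.sum_le_sum fun j _ => (norm_sum_le _ _).trans
      (Finset.sum_le_sum fun j' _ => hterm j j')).trans ?_)
    rw [h1, hδ]
    -- Only an inequality, in order to include `Y = 0`.
    have h2 : Y ^ 2 * (X ^ 2 / Y ^ 2) ≤ X ^ 2 := by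
      rw [mul_div_left_comm]
      exact mul_le_of_le_one_right (by positivity) (div_self_le_one _)
    linarith
  have htr : ‖(Sᴴ * S).trace / 2 ^ n‖ = X ^ 2 := by
    have : (Sᴴ * S).trace / 2 ^ n = ((X ^ 2 : ℝ) : ℂ) := by
      rw [trace_conjTranspose_mul, hX, pauliNorm_sq_eq_sum]
      push_cast
      rw [mul_div_cancel_left₀ _ (pow_ne_zero _ two_ne_zero)]
      refine Finset.sum_congr rfl fun P _ => ?_
      rw [Complex.star_def, mul_comm, Complex.mul_conj, Complex.normSq_eq_norm_sq]
      push_cast; rfl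
    rw [this, Complex.norm_real, Real.norm_eq_abs, abs_of_nonneg (by positivity)]
  have hsq := norm_trace_density_mul_sq_le hψ S
  have htri : ‖(density ψ * (Sᴴ * S)).trace‖ ≤ 5 / 4 * X ^ 2 + X ^ 2 := by
    have := norm_add_le ((density ψ * (Sᴴ * S)).trace - (Sᴴ * S).trace / 2 ^ n)
      ((Sᴴ * S).trace / 2 ^ n)
    rw [sub_add_cancel, htr] at this
    linarith
  -- The constant is `3 / 2` because `5 / 4 + 1 = (3 / 2) ^ 2`.
  refine le_of_sq_le_sq ?_ (by positivity)
  nlinarith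

/-- Errors of small Pauli norm have small expectation values in sufficiently entangled states. -/
theorem SufficientlyEntangled.norm_trace_le {ψ : Bits (Fin n) → ℂ} (hψ : ∑ b, ‖ψ b‖ ^ 2 = 1)
    {D : Op n} {ε : ℝ} (h : SufficientlyEntangled ψ D (ε / 4)) (hD : pauliNorm D ≤ ε / 4) :
    ‖(density ψ * D).trace‖ ≤ ε := by
  obtain ⟨J, B, hB, hE⟩ := h
  have h1 := norm_trace_density_sum_le hψ B hE
  have h2 := norm_trace_density_mul_le hψ (D - ∑ j, B j)
  have h3 := pauliNorm_sub_le D (D - ∑ j, B j)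
  rw [sub_sub_cancel] at h3
  have h4 := pauliNorm_le_opNorm (D - ∑ j, B j)
  have h0 := opNorm_nonneg (D - ∑ j, B j)
  have e : (density ψ * D).trace = (density ψ * (D - ∑ j, B j)).trace
      + (density ψ * ∑ j, B j).trace := by
    rw [← Matrix.trace_add, ← Matrix.mul_add, sub_add_cancel]
  rw [e]
  -- The tail contributes `ε / 4` and the sum of the `B j` contributes `3 / 2 * (ε / 4 + ε / 4)`, in
  -- total `ε`.
  refine (norm_add_le _ _).trans ?_
  linarith

end LowWeightPauli
end

noncomputable section
namespace LowWeightPauli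

/-! ### Choice of the number of Trotter steps and of the truncation weight -/

theorem layerTime_trotterFactors_mul (Γ p : ℕ) {t : ℝ} (ht : 0 < t) {r : ℕ} (hr : 1 ≤ r) :
    layerTime (trotterFactors Γ p (t / r)) * r = layerTime (trotterFactors Γ p 1) * t := by
  have hr0 : (0 : ℝ) < r := by exact_mod_cast hr
  rw [trotterFactors_eq_scale, layerTime_scaleLayers, abs_of_pos (by positivity)]
  field_simp

theorem length_trotterFactors (Γ p : ℕ) (s : ℝ) :
    (trotterFactors Γ p s).length = (trotterFactors Γ p 1).length := by
  rw [trotterFactors_eq_scale, scaleLayers, List.length_map]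

theorem PauliTable.weightLE_op {n m : ℕ} {O : PauliTable n}
    (hO : ∀ P ∈ O.support, P.weight ≤ m) : WeightLE m O.op := by
  intro P hP
  refine hO P (Finsupp.mem_support_iff.2 fun h => hP ?_)
  rw [pauliCoeff_op, h, Complex.ofReal_zero]

/-- Stated for all `C' ≥ C`, like the next two lemmas, so that one common constant can serve all of
them. -/
theorem exists_trotter_steps (p Γ kh ko : ℕ) (a : ℝ) (hp : p = 1 ∨ (Even p ∧ 2 ≤ p)) :
    ∃ T C : ℝ, 0 < T ∧ ∀ (n : ℕ) (H : LayeredHamiltonian n Γ) (O : PauliTable n)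
      (t ε C' : ℝ) (r : ℕ), H.IsLocal kh a → (∀ P ∈ O.support, P.weight ≤ ko) →
      0 < t → t ≤ T → 0 < ε → 1 ≤ r → C ≤ C' → 1 ≤ C' →
      C' * ((commNorm H p * pauliNorm O.op * ε⁻¹) ^ (1 / (p : ℝ)) * t ^ (1 + 1 / (p : ℝ))) ≤ r →
      pauliNorm (trotterOp H O p t r - exactOp H O t) ≤ ε / 4 := by
  have hp1 : 1 ≤ p := by rcases hp with h | h <;> omega
  have hp0 : (p : ℝ) ≠ 0 := by exact_mod_cast (by omega : p ≠ 0)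
  set κ : ℝ := 2 * |a| * Γ * Real.exp (3 * kh) with hκ
  have hκ0 : 0 ≤ κ := by positivity
  set c := layerTime (trotterFactors Γ p 1) with hc
  have hc0 : 0 ≤ c := layerTime_nonneg _
  -- Satisfies both smallness conditions of `trotter_error_le`.
  set T : ℝ := 1 / ((κ + 1) * (c + 1)) with hT
  have hT0 : 0 < T := by positivity
  have hcT : κ * (c * T) ≤ 1 := by
    rw [hT, ← mul_assoc, mul_one_div, div_le_one (by positivity)]
    nlinarith
  have hκT : κ * T ≤ 1 := by
    rw [hT, mul_one_div, div_le_one (by positivity)]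
    nlinarith
  obtain ⟨C, hC0, hC⟩ := trotter_error_le Γ p kh a κ T hp hκ.ge hT0 hcT hκT
  refine ⟨T, 4 * C * Real.exp (2 * ko), hT0, ?_⟩
  intro n H O t ε C' r hH hO ht htT hε hr hCC' hC' hsteps
  have hr0 : (0 : ℝ) < r := by exact_mod_cast hr
  set A := commNorm H p * pauliNorm O.op * ε⁻¹ with hA
  have hA0 : 0 ≤ A :=
    mul_nonneg (mul_nonneg (commNorm_nonneg p) (pauliNorm_nonneg _)) (inv_nonneg.2 hε.le)
  -- The `p`-th power of the condition on `r`, weakened by `C' ≤ C' ^ p`.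
  have hpow : C' * (A * t ^ (p + 1)) ≤ r ^ p := by
    have h1 := pow_le_pow_left₀ (by positivity) hsteps p
    have h2 : (A ^ (1 / (p : ℝ))) ^ p = A := by
      rw [one_div, Real.rpow_inv_natCast_pow hA0 (by omega)]
    have h3 : (t ^ (1 + 1 / (p : ℝ))) ^ p = t ^ (p + 1) := by
      rw [← Real.rpow_natCast, ← Real.rpow_mul ht.le, ← Real.rpow_natCast]
      congr 1
      push_cast
      field_simp
    rw [mul_pow, mul_pow, h2, h3] at h1
    refine le_trans ?_ h1
    exact mul_le_mul_of_nonneg_right (le_self_pow₀ hC' (by omega)) (by positivity)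
  have hw : wnorm 2 O.op ≤ Real.exp (2 * ko) * pauliNorm O.op :=
    wnorm_le_of_weightLE (PauliTable.weightLE_op hO) (by norm_num)
  have hΛ : 0 ≤ commNorm H p := commNorm_nonneg p
  calc pauliNorm (trotterOp H O p t r - exactOp H O t)
      ≤ C * (t / r) ^ p * t * commNorm H p * wnorm 2 O.op := hC n H O hH t r ht htT hr
    _ ≤ C * (t / r) ^ p * t * commNorm H p * (Real.exp (2 * ko) * pauliNorm O.op) := by gcongr
    _ = (4 * C * Real.exp (2 * ko)) * (A * t ^ (p + 1)) * (ε / 4) / r ^ p := by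
        rw [hA, div_pow]; field_simp; ring
    _ ≤ C' * (A * t ^ (p + 1)) * (ε / 4) / r ^ p := by gcongr
    _ ≤ r ^ p * (ε / 4) / r ^ p := by gcongr
    _ = ε / 4 := by field_simp

/-- The total loss of the parameter is of order `t * exp (μ * kh)`, so `μ` may grow like `log (1 /
t) / (kh + 1)`. Every unit of weight then gains a fixed power of `t`, which is why the condition on
`w` divides by `log (1 / t)`. -/
theorem exists_truncation_weight (p Γ kh ko : ℕ) (a : ℝ) :
    ∃ T C : ℝ, 0 < T ∧ ∀ (n : ℕ) (H : LayeredHamiltonian n Γ) (O : PauliTable n)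
      (t ε C' : ℝ) (r w : ℕ), H.IsLocal kh a → (∀ P ∈ O.support, P.weight ≤ ko) →
      0 < t → t ≤ T → t < 1 → 0 < ε → 1 ≤ r → C ≤ C' → 0 ≤ C' →
      (ko : ℝ) + C' * max 1 (Real.log (t * pauliNorm O.op / ε) / Real.log (1 / t)) ≤ w →
      pauliNorm (trotterOp H O p t r - truncatedOp H O p t r w) ≤ ε / 4 := by
  set c := layerTime (trotterFactors Γ p 1) with hc
  have hc0 : 0 ≤ c := layerTime_nonneg _
  set K : ℝ := 2 * |a| * Γ * c + 1 with hK
  have hK0 : 0 < K := by positivity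
  -- Positive even for `kh = 0`, so that it can be a denominator.
  set k : ℝ := kh + 1 with hk
  have hk0 : 0 < k := by positivity
  -- The first bound on `t` makes `μ - 2` at least `log (1 / t) / (2 k)`; the second lets a spare
  -- power of `t` absorb the prefactor at the end.
  refine ⟨min (Real.exp (-(2 * Real.log K + 4 * k))) (1 / (4 * k * Real.exp (2 * ko))), 6 * k,
    lt_min (Real.exp_pos _) (by positivity), ?_⟩
  intro n H O t ε C' r w hH hO ht htT ht1 hε hr hCC' hC'0 hweight
  have hM : (1 : ℝ) ≤ max 1 (Real.log (t * pauliNorm O.op / ε) / Real.log (1 / t)) :=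
    le_max_left _ _
  have hM' : Real.log (t * pauliNorm O.op / ε) / Real.log (1 / t)
    ≤ max 1 (Real.log (t * pauliNorm O.op / ε) / Real.log (1 / t)) := le_max_right _ _
  set M := max 1 (Real.log (t * pauliNorm O.op / ε) / Real.log (1 / t))
  set l := Real.log (1 / t) with hl
  have hl0 : 0 < l := Real.log_pos ((one_lt_div ht).2 ht1)
  have hlt : Real.exp (-l) = t := by rw [hl, one_div, Real.log_inv, neg_neg, Real.exp_log ht]
  have hlS : 2 * Real.log K + 4 * k ≤ l := by
    have := htT.trans (min_le_left _ _)
    rw [← hlt, Real.exp_le_exp] at this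
    linarith
  have htε := htT.trans (min_le_right _ _)
  -- Chosen so that `exp (μ * k) = 1 / (t * K)`, which keeps the total loss of the parameter at most
  -- one.
  set μ := (l - Real.log K) / k with hμ
  have hμk : μ * k = l - Real.log K := by rw [hμ]; field_simp
  have hμl : l / (2 * k) ≤ μ - 2 := by
    rw [div_le_iff₀ (by positivity)]
    nlinarith
  have hμ2 : 2 ≤ μ := by
    have : 0 ≤ l / (2 * k) := by positivity
    linarith
  have hκt : 2 * |a| * Γ * Real.exp (μ * kh) * layerTime (trotterFactors Γ p (t / r)) * r ≤ 1 := by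
    rw [mul_assoc, layerTime_trotterFactors_mul Γ p ht hr, ← hc]
    have h1 : Real.exp (μ * kh) ≤ 1 / (t * K) := by
      have : Real.exp (μ * k) = 1 / (t * K) := by
        rw [hμk, Real.exp_sub, Real.exp_log hK0, hl, Real.exp_log (by positivity)]
        field_simp
      rw [← this, Real.exp_le_exp, hk]
      nlinarith
    calc 2 * |a| * Γ * Real.exp (μ * kh) * (c * t)
        ≤ 2 * |a| * Γ * (1 / (t * K)) * (c * t) := by gcongr
      _ = (2 * |a| * Γ * c) / K := by field_simp
      _ ≤ 1 := by rw [div_le_one hK0]; linarith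
  have hkow : ko ≤ w := by
    have : (ko : ℝ) ≤ w := by nlinarith
    exact_mod_cast this
  have hOw : ∀ P ∈ O.support, P.weight ≤ w := fun P hP => (hO P hP).trans hkow
  have hmain := truncation_error_le hH p t r w O hOw hμ2 le_rfl hκt
  have hw : wnorm μ O.op ≤ Real.exp (μ * ko) * pauliNorm O.op :=
    wnorm_le_of_weightLE (PauliTable.weightLE_op hO) (by linarith)
  -- For an observable of norm zero the logarithm says nothing, but the error vanishes.
  rcases (pauliNorm_nonneg O.op).eq_or_lt with h0 | h0
  · rw [← h0, mul_zero] at hw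
    have : (kh + 1) * Real.exp (-((μ - 2) * w)) * wnorm μ O.op ≤ 0 :=
      mul_nonpos_of_nonneg_of_nonpos (by positivity) hw
    linarith
  · set N := pauliNorm O.op
    have hM1 : Real.log (t * N / ε) ≤ M * l := (div_le_iff₀ hl0).1 hM'
    have hm : C' * M ≤ w - ko := by linarith
    have hCM : 6 * k * M ≤ C' * M := mul_le_mul_of_nonneg_right hCC' (by linarith)
    -- Here `2 l ≤ 2 l M` and the logarithm is at most `l M`, whence the constant `6 k = 3 * (2 k)`.
    -- The summand `2 l` supplies `t ^ 2`: one power cancels the `t` in the logarithm, the other is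
    -- the spare one.
    have hexp : 2 * l + Real.log (t * N / ε) ≤ (μ - 2) * (w - ko) := by
      calc 2 * l + Real.log (t * N / ε) ≤ 3 * l * M := by nlinarith
        _ = l / (2 * k) * (6 * k * M) := by field_simp; ring
        _ ≤ (μ - 2) * (w - ko) :=
          mul_le_mul hμl (hCM.trans hm) (by positivity) (by linarith)
    have hlog : Real.exp (-(2 * l + Real.log (t * N / ε))) = t * ε / N := by
      rw [neg_add, Real.exp_add, Real.exp_neg (Real.log _), Real.exp_log (by positivity),
        show -(2 * l) = -l + -l by ring, Real.exp_add, hlt]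
      field_simp
    calc _ ≤ (kh + 1) * Real.exp (-((μ - 2) * w)) * wnorm μ O.op := hmain
      _ ≤ k * Real.exp (-((μ - 2) * w)) * (Real.exp (μ * ko) * N) := by gcongr
      _ = k * Real.exp (2 * ko) * N * Real.exp (-((μ - 2) * (w - ko))) := by
          have : Real.exp (-((μ - 2) * w)) * Real.exp (μ * ko)
              = Real.exp (2 * ko) * Real.exp (-((μ - 2) * (w - ko))) := by
            rw [← Real.exp_add, ← Real.exp_add]; congr 1; ring
          linear_combination (k * N) * this
      _ ≤ k * Real.exp (2 * ko) * N * Real.exp (-(2 * l + Real.log (t * N / ε))) := by gcongr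
      _ = k * Real.exp (2 * ko) * ε * t := by rw [hlog]; field_simp
      _ ≤ k * Real.exp (2 * ko) * ε * (1 / (4 * k * Real.exp (2 * ko))) := by gcongr
      _ = ε / 4 := by field_simp

theorem exists_lpd_cost (p Γ kh : ℕ) (a : ℝ) :
    ∃ C : ℝ, ∀ (n : ℕ) (H : LayeredHamiltonian n Γ) (O : PauliTable n) (t C' : ℝ) (r w : ℕ)
      (ψ : Bits (Fin n) → ℂ), 1 ≤ n → H.IsLocal kh a → (∀ P ∈ O.support, P.weight ≤ w) →
      C ≤ C' →
      ((lpd H O ψ p t r w).time : ℝ) ≤ C' ^ (w + 1) * (r + 1) * (n : ℝ) ^ w ∧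
      ((lpd H O ψ p t r w).space : ℝ) ≤ C' ^ (w + 1) * (n : ℝ) ^ w := by
  set L := (trotterFactors Γ p 1).length
  set D := 4 * 2 ^ (L * (kh + 1) ^ L)
  refine ⟨max (3 * L + 2 : ℕ) D, ?_⟩
  intro n H O t C' r w ψ hn hH hO hC'
  obtain ⟨h1, h2⟩ := lpd_cost hn hH p t r w O ψ hO (length_trotterFactors Γ p (t / r))
  have hL : ((3 * L + 2 : ℕ) : ℝ) ≤ C' := (le_max_left _ _).trans hC'
  have hD : (D : ℝ) ≤ C' := (le_max_right _ _).trans hC'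
  have hC0 : 0 ≤ C' := (Nat.cast_nonneg D).trans hD
  have h1' : ((lpd H O ψ p t r w).time : ℝ)
      ≤ ((3 * L + 2 : ℕ) : ℝ) * (D : ℝ) ^ w * (r + 1) * (n : ℝ) ^ w := by exact_mod_cast h1
  have h2' : ((lpd H O ψ p t r w).space : ℝ) ≤ 2 * (D : ℝ) ^ w * (n : ℝ) ^ w := by
    exact_mod_cast h2
  have h2L : (2 : ℝ) ≤ C' := le_trans (by exact_mod_cast Nat.le_add_left 2 (3 * L)) hL
  refine ⟨h1'.trans ?_, h2'.trans ?_⟩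
  · rw [pow_succ']; gcongr
  · rw [pow_succ']; gcongr

end LowWeightPauli
end

/-! ### The main theorem. -/

open LowWeightPauli in
theorem theorem1 (p Γ kh ko : ℕ) (a : ℝ) (hp : p = 1 ∨ (Even p ∧ 2 ≤ p)) :
    ∃ t₀ C : ℝ, 0 < t₀ ∧ t₀ < 1 ∧ 0 < C ∧
      ∀ (n : ℕ) (H : LayeredHamiltonian n Γ) (O : PauliTable n) (t ε : ℝ) (r w : ℕ)
        (ψ : Bits (Fin n) → ℂ),
        1 ≤ n → H.IsLocal kh a → (∀ P ∈ O.support, P.weight ≤ ko) →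
        0 < t → t < t₀ → 0 < ε →
        1 ≤ r →
        C * ((commNorm H p * pauliNorm O.op * ε⁻¹) ^ (1 / (p : ℝ)) * t ^ (1 + 1 / (p : ℝ))) ≤ r →
        (ko : ℝ) + C * max 1 (Real.log (t * pauliNorm O.op / ε) / Real.log (1 / t)) ≤ w →
        ∑ b, ‖ψ b‖ ^ 2 = 1 →
        ((lpd H O ψ p t r w).time : ℝ) ≤ C ^ (w + 1) * (r + 1) * (n : ℝ) ^ w ∧
        ((lpd H O ψ p t r w).space : ℝ) ≤ C ^ (w + 1) * (n : ℝ) ^ w ∧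
        (SufficientlyEntangled ψ (trotterOp H O p t r - exactOp H O t) (ε / 4) →
          SufficientlyEntangled ψ (trotterOp H O p t r - truncatedOp H O p t r w) (ε / 4) →
          ‖((lpd H O ψ p t r w).val : ℂ) - (density ψ * exactOp H O t).trace‖ ≤ 2 * ε) := by
  obtain ⟨T₁, C₁, hT₁, h₁⟩ := exists_trotter_steps p Γ kh ko a hp
  obtain ⟨T₂, C₂, hT₂, h₂⟩ := exists_truncation_weight p Γ kh ko a
  obtain ⟨C₃, h₃⟩ := exists_lpd_cost p Γ kh a
  -- The entry 1 provides `1 ≤ C`, which the step count needs for `C ≤ C ^ p`.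
  set C := max (max C₁ C₂) (max C₃ 1)
  have hC₁ : C₁ ≤ C := (le_max_left _ _).trans (le_max_left _ _)
  have hC₂ : C₂ ≤ C := (le_max_right _ _).trans (le_max_left _ _)
  have hC₃ : C₃ ≤ C := (le_max_left _ _).trans (le_max_right _ _)
  have hC : 1 ≤ C := (le_max_right _ _).trans (le_max_right _ _)
  refine ⟨min (min T₁ T₂) (1 / 2), C, lt_min (lt_min hT₁ hT₂) (by norm_num),
    (min_le_right _ _).trans_lt (by norm_num), by linarith, ?_⟩
  intro n H O t ε r w ψ hn hH hO ht htt hε hr hsteps hweight hψ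
  have ht₁ : t ≤ T₁ := htt.le.trans ((min_le_left _ _).trans (min_le_left _ _))
  have ht₂ : t ≤ T₂ := htt.le.trans ((min_le_left _ _).trans (min_le_right _ _))
  have ht1 : t < 1 := (htt.trans_le (min_le_right _ _)).trans (by norm_num)
  have hkow : ko ≤ w := by
    have h := le_max_left 1 (Real.log (t * pauliNorm O.op / ε) / Real.log (1 / t))
    have : (ko : ℝ) ≤ w := by nlinarith
    exact_mod_cast this
  obtain ⟨htime, hspace⟩ :=
    h₃ n H O t C r w ψ hn hH (fun P hP => (hO P hP).trans hkow) hC₃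
  refine ⟨htime, hspace, fun hE₁ hE₂ => ?_⟩
  have e₁ := hE₁.norm_trace_le hψ (h₁ n H O t ε C r hH hO ht ht₁ hε hr hC₁ hC hsteps)
  have e₂ := hE₂.norm_trace_le hψ
    (h₂ n H O t ε C r w hH hO ht ht₂ ht1 hε hr hC₂ (by linarith) hweight)
  -- The untruncated Trotter evolution cancels, and each of the two error operators contributes at
  -- most `ε`.
  have e : ((lpd H O ψ p t r w).val : ℂ) - (density ψ * exactOp H O t).trace
      = (density ψ * (trotterOp H O p t r - exactOp H O t)).trace
        - (density ψ * (trotterOp H O p t r - truncatedOp H O p t r w)).trace := by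
    rw [lpd_val, Matrix.mul_sub, Matrix.mul_sub, Matrix.trace_sub, Matrix.trace_sub]
    ring
  rw [e]
  refine (norm_sub_le _ _).trans ?_
  linarith
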